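/- **Theorem 3.1 (Vanishing Theorem).** Let $d\ge 2$, $\alpha>0$ and $\beta,a\in\mathbb R$ with $(d-25)+48\beta\neq 0$, put $$\xi = 1+\frac{24(1-a)}{(d-25)+48\beta},$$ and assume $\xi\le 1$. Let $p\in\mathbb R^d$, $p\ne 0$. *Matter.* Let $\eta=\mathrm{diag}(-1,1,\dots,1)$, and let $\mathcal H(p)$ be the complex Fock space generated from a vacuum $\omega(p)$ by modes $a^\mu_m$ ($0\le\mu<d$) and $u_m$ with $[a^\mu_m,a^\nu_n]=m\eta^{\mu\nu}\delta_{m+n}$, $[u_m,u_n]=m\delta_{m+n}$, where $a^\mu_m$ commutes with $u_n$; the modes with $m>0$ annihilate $\omega(p)$, and $a^\mu_0=p^\mu/\sqrt\alpha$, $u_0=0$. Put $$L_m=\tfrac12\sum_{k\in\mathbb Z}:a_{m+k}\cdot a_{-k}:+\tfrac12\sum_{k\in\mathbb Z}:u_{m+k}u_{-k}:+2i\sqrt\beta\,m\,u_m+2\beta\,\delta_{m0},$$ with the principal square root of $\beta$, and $\mathcal H_{\rm phys}(p)=\{v\in\mathcal H(p):(L_m-a\delta_{m0})v=0,\ m\ge0\}$.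 *Ghosts.* Let $\mathcal C_{\rm gh}$ be the fermionic Fock space generated from a vacuum $\omega$ by modes $b_m,c_m$ ($m\in\mathbb Z$) with $\{b_m,c_n\}=\delta_{m+n}$, $\{b_m,b_n\}=\{c_m,c_n\}=0$, $c_m\omega=0$ ($m>0$) and $b_m\omega=0$ ($m\ge0$). Put $\mathcal L_m=\sum_{k}(k-m):c_{-k}b_{m+k}:$ and $d_{\rm gh}=\frac12\sum_{m>0}c_{-m}\mathcal L_m+\frac12c_0\mathcal L_0+\frac12\sum_{m>0}\mathcal L_{-m}c_m$. *Complexes.* On $\mathcal C(p)=\mathcal H(p)\otimes\mathcal C_{\rm gh}$ put $D=\sum_{m\in\mathbb Z}(L_m-\delta_{m0}a)\otimes c_{-m}+1\otimes d_{\rm gh}$ and $L_m^{\rm tot}=L_m+\mathcal L_m-\delta_{m0}a$. The polarized anomalous complex is $\mathcal P(p)=\{\Psi\in\mathcal C(p):[L^{\rm tot}_m,D]\Psi=0,\ m\ge0\}$. Its relative (on-mass-shell) complex is $\mathcal P_{\rm rel}(p)=\{\Psi\in\mathcal P(p): L_0^{\rm tot}\Psi=0,\ b_0\Psi=0\}$,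 with differential $$D_{\rm rel}=D-L_0^{\rm tot}c_0-Mb_0,\qquad M=-2\sum_{m>0}m\,c_{-m}c_m,$$ graded by the relative ghost number $r\in\mathbb Z$, that is, the number of excitations $c_{-m}$ minus the number of excitations $b_{-m}$ ($m>0$). Let $Z^r_{\rm rel}(p)=\ker D_{\rm rel}|_{\mathcal P^r_{\rm rel}(p)}$, $B^r_{\rm rel}(p)=D_{\rm rel}\mathcal P^{r-1}_{\rm rel}(p)$ and $H^r_{\rm rel}(p)=Z^r_{\rm rel}(p)/B^r_{\rm rel}(p)$. For $m>0$ let $\tau_m=\sum_{k>m}(m+k)b_{m-k}c_k$ and $\tau_{-m}=\sum_{k>m}(m+k)c_{-k}b_{k-m}$, and put $$\mathcal D=\sum_{m>0}L_{-m}\otimes c_m+\sum_{m>0}c_m\tau_{-m}-\tfrac12\sum_{m,k>0}(m-k)b_{-k-m}c_kc_m,$$ $$\overline{\mathcal D}=\sum_{m>0}L_m\otimes c_{-m}+\sum_{m>0}c_{-m}\tau_m-\tfrac12\sum_{m,k>0}(m-k)c_{-m}c_{-k}b_{k+m}.$$ Let $\overline{\mathcal Z}^0_0(p)$ be the space of $\Psi\in\mathcal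 P_{\rm rel}(p)$ that contain no excitations $c_{-m}$, $b_{-m}$ ($m>0$) and satisfy $\overline{\mathcal D}\Psi=0$. Let $\mathcal G(p)=\mathcal D\bigl(b_{-1}\overline{\mathcal Z}{}^0_0\bigr)$ be the space of all $\mathcal D(b_{-1}\Phi)$, where $\Phi\in\mathcal P(p)$ contains no excitations $c_0$, $c_{-m}$, $b_{-m}$ ($m>0$), $\overline{\mathcal D}\Phi=0$, and $b_{-1}\Phi$ (rather than $\Phi$) lies in $\mathcal P_{\rm rel}(p)$. Then: 0. $B^r_{\rm rel}(p)\subseteq Z^r_{\rm rel}(p)$ for all $r$, so that $H^r_{\rm rel}(p)$ is defined. 1. $H^r_{\rm rel}(p)=0$ for every $r\ne0$. 2. $\overline{\mathcal Z}^0_0(p)\subseteq Z^0_{\rm rel}(p)$, and $z\mapsto[z]$ induces a linear isomorphism $$H^0_{\rm rel}(p)\cong\begin{cases}\overline{\mathcal Z}^0_0(p), & \xi<1,\\[2pt] \overline{\mathcal Z}^0_0(p)/\mathcal G(p), & \xi=1,\end{cases}$$ where $\mathcal G(p)\subseteq\overline{\mathcal Z}^0_0(p)$ if $\xi=1$. 3.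 $\overline{\mathcal Z}^0_0(p)=\mathcal H_{\rm phys}(p)\otimes\omega$; and if $\xi=1$, then $\mathcal G(p)=\{L_{-1}v\otimes\omega : v\in\mathcal H(p),\ L_mv=0\ (m>0),\ (L_0+1-a)v=0\}$. -/

import Mathlib

open scoped TensorProduct

noncomputable section

namespace MassiveString

/-! ### Sums of operators

The infinite sums of mode operators below are locally finite: on any given vector all but finitely
many summands vanish. -/

/-- The sum `v ↦ ∑ k, T k v` of a family of operators that is locally finite, i.e. such that for
every `v` only finitely many `T k v` are non-zero. -/
def opSum {V κ : Type*} [AddCommGroup V] [Module ℂ V] (T : κ → Module.End ℂ V) :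
    Module.End ℂ V :=
  open Classical in
  if h : ∀ v : V, (Function.support fun k => T k v).Finite then
    { toFun := fun v => ∑ᶠ k, T k v
      map_add' := fun v w => by
        simp only [map_add]
        exact finsum_add_distrib (h v) (h w)
      map_smul' := fun c v => by
        simp only [map_smul, RingHom.id_apply]
        exact (smul_finsum' c (h v)).symm }
  else 0

/-! ### Subquotients -/

section Subquotient

variable {V : Type} [AddCommGroup V] [Module ℂ V]

/-- The quotient `Z / (B ∩ Z)` of subspaces of `V`; this is `Z / B` when `B ≤ Z`. -/
def Subquotient (Z B : Submodule ℂ V) : Type := Z ⧸ B.submoduleOf Z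

instance (Z B : Submodule ℂ V) : AddCommGroup (Subquotient Z B) :=
  inferInstanceAs (AddCommGroup (Z ⧸ B.submoduleOf Z))

instance (Z B : Submodule ℂ V) : Module ℂ (Subquotient Z B) :=
  inferInstanceAs (Module ℂ (Z ⧸ B.submoduleOf Z))

/-- The class of an element of `Z`. -/
def Subquotient.mk (Z B : Submodule ℂ V) : Z →ₗ[ℂ] Subquotient Z B :=
  (B.submoduleOf Z).mkQ

end Subquotient

/-! ### Parameters -/

/-- The parameters of a massive string model: the space-time dimension `d`, the couplings `α`, `β`
of the action, and the intercept `a`. -/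
structure Model where
  d : ℕ
  α : ℝ
  β : ℝ
  a : ℝ

/-- The coefficient `(d - 25) + 48 β` of the anomaly. -/
def Model.anomaly (M : Model) : ℝ := ((M.d : ℝ) - 25) + 48 * M.β

/-- The parameter `ξ = 1 + 24 (1 - a) / ((d - 25) + 48 β)`. -/
def Model.xi (M : Model) : ℝ := 1 + 24 * (1 - M.a) / M.anomaly

/-! ### The matter sector at fixed momentum -/

/-- The oscillator directions: `some μ` is the space-time direction `μ` and `none` is the
Liouville direction. -/
abbrev Direction (d : ℕ) : Type := Option (Fin d)

/-- The metric on the oscillator directions: `η = diag(-1, 1, …, 1)` on space-time, and `1` on the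
Liouville direction. -/
def metric {d : ℕ} : Direction d → ℂ
  | some μ => if (μ : ℕ) = 0 then -1 else 1
  | none => 1

/-- The Fock space `H(p)`: polynomials in the creation operators. The variable `(i, k)` stands for
the creation operator of mode `-(k + 1)` in the direction `i`, and `1` is the vacuum `ω(p)`. -/
abbrev Matter (d : ℕ) : Type := MvPolynomial (Direction d × ℕ) ℂ

variable (M : Model) (p : Fin M.d → ℝ)

/-- The value of the zero mode: `a₀^μ = p^μ / √α`, and the Liouville field has no zero mode. -/
def zeroMode : Direction M.d → ℂ
  | some μ => ((p μ / Real.sqrt M.α : ℝ) : ℂ)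
  | none => 0

/-- The modes `a^μ_n` (for `i = some μ`) and `u_n` (for `i = none`), with
`[a^μ_m, a^ν_n] = m η^{μν} δ_{m+n}`, `[u_m, u_n] = m δ_{m+n}`. -/
def osc (i : Direction M.d) : ℤ → Module.End ℂ (Matter M.d)
  | Int.ofNat 0 => zeroMode M p i • 1
  | Int.ofNat (k + 1) =>
      (((k : ℂ) + 1) * metric i) • (MvPolynomial.pderiv (i, k)).toLinearMap
  | Int.negSucc k => LinearMap.mulLeft ℂ (MvPolynomial.X (i, k))

/-- The normally ordered product `: α^i_m α^i_n :` (annihilation operators to the right). -/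
def oscNormal (i : Direction M.d) (m n : ℤ) : Module.End ℂ (Matter M.d) :=
  if m ≤ n then osc M p i m * osc M p i n else osc M p i n * osc M p i m

/-- The constraint operators
`L_m = ½ ∑_k : a_{m+k} · a_{-k} : + ½ ∑_k : u_{m+k} u_{-k} : + 2 i √β m u_m + 2 β δ_{m0}`. -/
def vir (m : ℤ) : Module.End ℂ (Matter M.d) :=
  (1 / 2 : ℂ) • ∑ i : Direction M.d,
      metric i • opSum (fun k : ℤ => oscNormal M p i (m + k) (-k))
    + (2 * Complex.I * (M.β : ℂ) ^ (1 / 2 : ℂ) * (m : ℂ)) • osc M p none m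
    + (if m = 0 then 2 * (M.β : ℂ) else 0) • 1

/-- The physical states of the old covariant quantization at momentum `p`:
`(L_m - a δ_{m0}) v = 0` for all `m ≥ 0`. -/
def physical : Submodule ℂ (Matter M.d) :=
  ⨅ m : ℕ, LinearMap.ker (vir M p m - (if m = 0 then (M.a : ℂ) else 0) • 1)

/-! ### The ghost sector -/

/-- The fermionic creation operators: `Sum.inl k` is the ghost mode `c_{-k}` (`k ≥ 0`), and
`Sum.inr k` is the anti-ghost mode `b_{-(k+1)}`. -/
abbrev GhostIndex : Type := ℕ ⊕ ℕ

/-- The ghost space, the exterior algebra on the fermionic creation operators; `1` is the ghost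
vacuum `ω`. -/
abbrev Ghost : Type := ExteriorAlgebra ℂ (GhostIndex →₀ ℂ)

/-- Left multiplication by a creation operator. -/
def create (g : GhostIndex) : Module.End ℂ Ghost :=
  LinearMap.mulLeft ℂ (ExteriorAlgebra.ι ℂ (Finsupp.single g 1))

/-- The contraction dual to `create g`. -/
def annihilate (g : GhostIndex) : Module.End ℂ Ghost :=
  CliffordAlgebra.contractLeft (Q := (0 : QuadraticForm ℂ (GhostIndex →₀ ℂ))) (Finsupp.lapply g)

/-- The ghost modes `c_n`; they annihilate the vacuum for `n > 0`. -/
def c : ℤ → Module.End ℂ Ghost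
  | Int.ofNat 0 => create (Sum.inl 0)
  | Int.ofNat (k + 1) => annihilate (Sum.inr k)
  | Int.negSucc k => create (Sum.inl (k + 1))

/-- The anti-ghost modes `b_n`; they annihilate the vacuum for `n ≥ 0`. One has
`{b_m, c_n} = δ_{m+n}`. -/
def b : ℤ → Module.End ℂ Ghost
  | Int.ofNat k => annihilate (Sum.inl k)
  | Int.negSucc k => create (Sum.inr k)

/-- The normally ordered product `: c_m b_n :`, antisymmetrized for the zero modes. -/
def ghostNormal (m n : ℤ) : Module.End ℂ Ghost :=
  if m = 0 ∧ n = 0 then (1 / 2 : ℂ) • (c 0 * b 0 - b 0 * c 0)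
  else if 0 < m then -(b n * c m)
  else c m * b n

/-- The ghost Virasoro operators `∑_k (k - m) : c_{-k} b_{m+k} :`. -/
def ghostVir (m : ℤ) : Module.End ℂ Ghost :=
  opSum fun k : ℤ => ((k : ℂ) - (m : ℂ)) • ghostNormal (-k) (m + k)

/-- The ghost differential
`½ ∑_{m>0} c_{-m} ℒ_m + ½ c_0 ℒ_0 + ½ ∑_{m>0} ℒ_{-m} c_m`. -/
def ghostDiff : Module.End ℂ Ghost :=
  (1 / 2 : ℂ) • opSum (fun m : ℕ+ => c (-(m : ℤ)) * ghostVir (m : ℤ))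
    + (1 / 2 : ℂ) • (c 0 * ghostVir 0)
    + (1 / 2 : ℂ) • opSum (fun m : ℕ+ => ghostVir (-(m : ℤ)) * c (m : ℤ))

/-- The operator counting the ghost excitations `c_{-m}`, `m > 0`. -/
def ghostDegree : Module.End ℂ Ghost :=
  opSum fun m : ℕ+ => c (-(m : ℤ)) * b (m : ℤ)

/-- The operator counting the anti-ghost excitations `b_{-m}`, `m > 0`. -/
def antighostDegree : Module.End ℂ Ghost :=
  opSum fun m : ℕ+ => b (-(m : ℤ)) * c (m : ℤ)

/-- `τ_m = ∑_{k>m} (m + k) b_{m-k} c_k`, for `m > 0`. -/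
def tauPos (m : ℕ+) : Module.End ℂ Ghost :=
  opSum fun k : {k : ℤ // (m : ℤ) < k} =>
    ((m : ℂ) + ((k : ℤ) : ℂ)) • (b ((m : ℤ) - k) * c k)

/-- `τ_{-m} = ∑_{k>m} (m + k) c_{-k} b_{k-m}`, for `m > 0`. -/
def tauNeg (m : ℕ+) : Module.End ℂ Ghost :=
  opSum fun k : {k : ℤ // (m : ℤ) < k} =>
    ((m : ℂ) + ((k : ℤ) : ℂ)) • (c (-(k : ℤ)) * b ((k : ℤ) - m))

/-- `∂ = -½ ∑_{m,k>0} (m - k) b_{-k-m} c_k c_m`. -/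
def del : Module.End ℂ Ghost :=
  (-(1 / 2) : ℂ) • opSum fun mk : ℕ+ × ℕ+ =>
    ((mk.1 : ℂ) - (mk.2 : ℂ)) • (b (-(mk.2 : ℤ) - (mk.1 : ℤ)) * c (mk.2 : ℤ) * c (mk.1 : ℤ))

/-- `∂̄ = -½ ∑_{m,k>0} (m - k) c_{-m} c_{-k} b_{k+m}`. -/
def delBar : Module.End ℂ Ghost :=
  (-(1 / 2) : ℂ) • opSum fun mk : ℕ+ × ℕ+ =>
    ((mk.1 : ℂ) - (mk.2 : ℂ)) • (c (-(mk.1 : ℤ)) * c (-(mk.2 : ℤ)) * b ((mk.2 : ℤ) + (mk.1 : ℤ)))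

/-! ### The string differential space at fixed momentum -/

/-- The space `C(p) = H(p) ⊗ C_gh`. -/
abbrev Total (d : ℕ) : Type := Matter d ⊗[ℂ] Ghost

/-- The operator `A ⊗ B`. -/
abbrev tens {d : ℕ} (A : Module.End ℂ (Matter d)) (B : Module.End ℂ Ghost) :
    Module.End ℂ (Total d) :=
  TensorProduct.map A B

/-- The embedding `v ↦ v ⊗ ω`. -/
def withVacuum (d : ℕ) : Matter d →ₗ[ℂ] Total d :=
  (TensorProduct.mk ℂ (Matter d) Ghost).flip 1

/-- The differential `D = ∑_m (L_m - δ_{m0} a) ⊗ c_{-m} + 1 ⊗ d_gh`. -/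
def diff : Module.End ℂ (Total M.d) :=
  opSum (fun m : ℤ => tens (vir M p m - (if m = 0 then (M.a : ℂ) else 0) • 1) (c (-m)))
    + tens 1 ghostDiff

/-- The ghost extended constraints `L_m^tot = L_m + ℒ_m - δ_{m0} a`. -/
def virTot (m : ℤ) : Module.End ℂ (Total M.d) :=
  tens (vir M p m) 1 + tens 1 (ghostVir m) - (if m = 0 then (M.a : ℂ) else 0) • 1

/-- The space `P(p)` of the polarized anomalous complex: the vectors annihilated by the commutators
`[L_m^tot, D]`, `m ≥ 0`. -/
def polarized : Submodule ℂ (Total M.d) :=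
  ⨅ m : ℕ, LinearMap.ker (virTot M p m * diff M p - diff M p * virTot M p m)

/-! ### The relative complex -/

/-- The operator `M = -2 ∑_{m>0} m c_{-m} c_m`. -/
def opM : Module.End ℂ Ghost :=
  (-2 : ℂ) • opSum fun m : ℕ+ => (m : ℂ) • (c (-(m : ℤ)) * c (m : ℤ))

/-- The relative differential `D_rel = D - L_0^tot c_0 - M b_0`. -/
def diffRel : Module.End ℂ (Total M.d) :=
  diff M p - virTot M p 0 * tens 1 (c 0) - tens 1 (opM * b 0)

/-- The cochains `Ψ ∈ P(p)` without the ghost zero mode, `b_0 Ψ = 0`. -/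
def polNoZero : Submodule ℂ (Total M.d) :=
  polarized M p ⊓ LinearMap.ker (tens (d := M.d) 1 (b 0))

/-- The polarized relative complex `P_rel(p)`: the cochains `Ψ ∈ P(p)` with `L_0^tot Ψ = 0` (the
mass-shell condition) and `b_0 Ψ = 0`. -/
def polRel : Submodule ℂ (Total M.d) :=
  polNoZero M p ⊓ LinearMap.ker (virTot M p 0)

/-- The subspace `P^r_rel(p)` of relative ghost number `r`: the number of `c_{-m}` minus the number
of `b_{-m}`, `m > 0`. -/
def polRelDeg (r : ℤ) : Submodule ℂ (Total M.d) :=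
  polRel M p ⊓ LinearMap.ker (tens 1 (ghostDegree - antighostDegree) - (r : ℂ) • 1)

/-- The relative cocycles `Z^r_rel(p)`. -/
def cocyclesRel (r : ℤ) : Submodule ℂ (Total M.d) :=
  polRelDeg M p r ⊓ LinearMap.ker (diffRel M p)

/-- The relative coboundaries `B^r_rel(p) = D_rel (P^{r-1}_rel(p))`. -/
def coboundariesRel (r : ℤ) : Submodule ℂ (Total M.d) :=
  (polRelDeg M p (r - 1)).map (diffRel M p)

/-- The relative cohomology `H^r_rel(p) = Z^r_rel(p) / B^r_rel(p)`. -/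
abbrev cohomologyRel (r : ℤ) : Type :=
  Subquotient (cocyclesRel M p r) (coboundariesRel M p r)

/-- The cohomology class of a relative cocycle. -/
abbrev classRel (r : ℤ) : cocyclesRel M p r →ₗ[ℂ] cohomologyRel M p r :=
  Subquotient.mk (cocyclesRel M p r) (coboundariesRel M p r)

/-! ### The bigraded structure -/

/-- `𝒟 = ∑_{m>0} L_{-m} ⊗ c_m + ∑_{m>0} c_m τ_{-m} + ∂`. -/
def dolb : Module.End ℂ (Total M.d) :=
  opSum (fun m : ℕ+ => tens (vir M p (-(m : ℤ))) (c (m : ℤ)))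
    + tens 1 (opSum fun m : ℕ+ => c (m : ℤ) * tauNeg m)
    + tens 1 del

/-- `𝒟̄ = ∑_{m>0} L_m ⊗ c_{-m} + ∑_{m>0} c_{-m} τ_m + ∂̄`. -/
def dolbBar : Module.End ℂ (Total M.d) :=
  opSum (fun m : ℕ+ => tens (vir M p (m : ℤ)) (c (-(m : ℤ))))
    + tens 1 (opSum fun m : ℕ+ => c (-(m : ℤ)) * tauPos m)
    + tens 1 delBar

/-- The cochains of `P(p)` without ghost zero mode, of ghost degree `i` and anti-ghost degree `j`,
with no mass-shell condition. -/
def polBi (i j : ℕ) : Submodule ℂ (Total M.d) :=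
  polNoZero M p
    ⊓ LinearMap.ker (tens 1 ghostDegree - (i : ℂ) • 1)
    ⊓ LinearMap.ker (tens 1 antighostDegree - (j : ℂ) • 1)

/-- The `𝒟̄`-cocycles of bidegree `(i, j)`, with no mass-shell condition. -/
def cocyclesBarOff (i j : ℕ) : Submodule ℂ (Total M.d) :=
  polBi M p i j ⊓ LinearMap.ker (dolbBar M p)

/-- The space `Z̄^i_j(p)` of on-mass-shell `𝒟̄`-cocycles of bidegree `(i, j)`. -/
def cocyclesBar (i j : ℕ) : Submodule ℂ (Total M.d) :=
  cocyclesBarOff M p i j ⊓ LinearMap.ker (virTot M p 0)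

/-- The gauge subspace `𝒟 (b_{-1} Z̄^0_0)`. The mode `b_{-1}` raises the level by one, so it is the
cochain `b_{-1} Φ` on which `𝒟` acts, and not `Φ`, that lies on the mass shell, i.e. in
`P_rel(p)`. -/
def gauge : Submodule ℂ (Total M.d) :=
  ((cocyclesBarOff M p 0 0).map (tens 1 (b (-1))) ⊓ polRel M p).map (dolb M p)

/-- The matter states `v` with `L_m v = 0` for `m > 0` and `(L_0 + 1 - a) v = 0`: the states whose
images `L_{-1} v` are on the mass shell. -/
def gaugeParameters : Submodule ℂ (Matter M.d) :=
  ⨅ m : ℕ, LinearMap.ker (vir M p m + (if m = 0 then 1 - (M.a : ℂ) else 0) • 1)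

end MassiveString

end

/-! The constraints are controlled through their commutators with single modes. By a Schur lemma
(`Fock.eq_smul_one`) the commutators of the L_m, and of the ghost ℒ_m, close up to scalars, and
these scalars are read off on the vacuum. Hence [L_m^tot, L_n^tot] = (m-n) L_{m+n}^tot + κ(m)
δ_{m+n}, where κ(m) is a non-zero multiple of m (m² - ξ) (`kappa_eq`). An operator of positive ghost
number that commutes or anticommutes with every b_n is zero (`Fock.eq_zero_of_comm_b`). Together
with {D, b_n} = L_n^tot this yields [L_m^tot, D] = κ(m) c_m and D² = ∑_{m>0} κ(m) c_{-m} c_m. So a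
vector is polarized exactly when c_m kills it for every m > 0 with κ(m) ≠ 0. Since ξ ≤ 1, this
includes every m ≥ 2, and it includes m = 1 unless ξ = 1. The only antighost excitation that can
survive is therefore b_{-1}, and only if ξ = 1. On polarized vectors D² = 0, and on the relative
complex D_rel is just D.

Positive degrees are killed by a light-cone homotopy. Since p ≠ 0, there is a null combination A =
a^0 ± a^j with non-zero zero mode. Put K = ∑_{m>0} A_{-m} b_m and Δ = {D, K}. With respect to a
suitable charge, the lowest part of Δ is a non-zero multiple of an operator counting the excitations
A_{-m} and c_{-m} with positive weights. In positive relative ghost number c-excitations must occur,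
so Δ is injective there (`Fock.LightCone.laplacian_injective`). On cocycles Δ = DK, and the spaces
on the mass shell are finite-dimensional, so every cocycle of positive degree is exact.

In degree 0 the same operator removes the antighosts. On polarized vectors Δ commutes with c_1
(`Fock.LightCone.c_one_laplacian`), and c_1 sends degree 0 to ghost number 1, where Δ is injective.
So for a cocycle v there is a cocycle z with c_1 v = c_1 Δ z. Then v - D K z has no antighosts, and
having ghost number 0 it has no ghosts either (`Fock.LightCone.exists_bare`). Cocycles without ghost
excitations are precisely the physical states.

In negative degrees only vectors b_{-1} u with u free of ghosts are left. Whenever D (b_{-1} u) is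
killed by c_1 it equals L_{-1} u (`Fock.D_b_neg_one`), and L_{-1} is injective by the same
comparison with light-cone modes. So there are no cocycles, and for ξ = 1 the exact states without
ghost excitations are exactly the gauge states L_{-1} u.

All this takes place in an abstract structure `Fock`. The concrete polynomial and exterior algebras
are shown to be Fock representations, and their tensor product is an instance of it (`Fock.tensor`).
-/

noncomputable section

open scoped TensorProduct

namespace MassiveString

/-! ### Locally finite sums -/

section LocFin

variable {V W κ : Type*} [AddCommGroup V] [Module ℂ V] [AddCommGroup W] [Module ℂ W]

/-- A family of operators is locally finite if on every vector all but finitely many vanish. -/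
def LocFin (T : κ → Module.End ℂ V) : Prop :=
  ∀ v : V, (Function.support fun k => T k v).Finite

theorem opSum_apply {T : κ → Module.End ℂ V} (h : LocFin T) (v : V) :
    opSum T v = ∑ᶠ k, T k v := by
  unfold LocFin at h
  simp [opSum, h]

/-- No local finiteness is assumed: the default value of a sum that is not locally finite is the
zero operator, and zero lies in every subspace. Vanishing and raising of charges pass to infinite
sums through this fact. -/
theorem opSum_apply_mem {T : κ → Module.End ℂ V} (S : Submodule ℂ V) (v : V)
    (hS : ∀ k, T k v ∈ S) : opSum T v ∈ S := by
  by_cases h : LocFin T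
  · rw [opSum_apply h]
    exact finsum_induction (· ∈ S) S.zero_mem (fun _ _ => S.add_mem) hS
  · unfold LocFin at h
    simp [opSum, h]

theorem opSum_apply_eq_zero {T : κ → Module.End ℂ V} {v : V} (h : ∀ k, T k v = 0) :
    opSum T v = 0 := by
  have := opSum_apply_mem ⊥ v (fun k => (Submodule.mem_bot ℂ).2 (h k))
  exact (Submodule.mem_bot ℂ).1 this

theorem opSum_apply_eq_single {T : κ → Module.End ℂ V} (hT : LocFin T) {v : V} (k₀ : κ)
    (h : ∀ k, k ≠ k₀ → T k v = 0) : opSum T v = T k₀ v := by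
  rw [opSum_apply hT]
  exact finsum_eq_single _ k₀ h

theorem opSum_apply_eq_sum {T : κ → Module.End ℂ V} (hT : LocFin T) {v : V} (s : Finset κ)
    (h : ∀ k, k ∉ s → T k v = 0) : opSum T v = ∑ k ∈ s, T k v := by
  rw [opSum_apply hT]
  exact finsum_eq_sum_of_support_subset _ fun k hk => by
    by_contra hks
    exact hk (h k hks)

theorem LocFin.add {T U : κ → Module.End ℂ V} (hT : LocFin T) (hU : LocFin U) :
    LocFin fun k => T k + U k := fun v =>
  ((hT v).union (hU v)).subset fun k hk => by
    by_contra hc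
    simp only [Set.mem_union, Function.mem_support, not_or, not_not] at hc
    exact hk (by simp [hc.1, hc.2])

theorem LocFin.comp_left {T : κ → Module.End ℂ V} (hT : LocFin T) (X : Module.End ℂ V) :
    LocFin fun k => X * T k := fun v =>
  (hT v).subset fun _ hk hc => hk ((congrArg X hc).trans (map_zero X))

theorem LocFin.comp_right {T : κ → Module.End ℂ V} (hT : LocFin T) (X : Module.End ℂ V) :
    LocFin fun k => T k * X := fun v => hT (X v)

theorem LocFin.smul {T : κ → Module.End ℂ V} (hT : LocFin T) (a : κ → ℂ) :
    LocFin fun k => a k • T k := fun v =>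
  (hT v).subset fun k hk hc => hk ((congrArg (a k • ·) hc).trans (smul_zero _))

theorem LocFin.neg {T : κ → Module.End ℂ V} (hT : LocFin T) : LocFin fun k => -T k := by
  simpa using hT.smul fun _ => (-1 : ℂ)

theorem LocFin.sub {T U : κ → Module.End ℂ V} (hT : LocFin T) (hU : LocFin U) :
    LocFin fun k => T k - U k := by
  simpa [sub_eq_add_neg] using hT.add hU.neg

theorem LocFin.comp_injective {κ' : Type*} {T : κ → Module.End ℂ V} (hT : LocFin T)
    {f : κ' → κ} (hf : Function.Injective f) : LocFin fun k => T (f k) := fun v =>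
  Set.Finite.preimage hf.injOn (hT v)

theorem LocFin.of_eq_zero {T : κ → Module.End ℂ V} (s : Finset κ) (h : ∀ k, k ∉ s → T k = 0) :
    LocFin T := fun v =>
  s.finite_toSet.subset fun k hk => by
    by_contra hks
    exact hk (by simp [h k hks])

theorem opSum_add {T U : κ → Module.End ℂ V} (hT : LocFin T) (hU : LocFin U) :
    opSum (fun k => T k + U k) = opSum T + opSum U := by
  ext v
  rw [LinearMap.add_apply, opSum_apply (hT.add hU), opSum_apply hT, opSum_apply hU]
  exact finsum_add_distrib (hT v) (hU v)

theorem mul_opSum {T : κ → Module.End ℂ V} (hT : LocFin T) (X : Module.End ℂ V) :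
    X * opSum T = opSum fun k => X * T k := by
  ext v
  rw [Module.End.mul_apply, opSum_apply (hT.comp_left X), opSum_apply hT]
  exact X.toAddMonoidHom.map_finsum (hT v)

theorem opSum_mul {T : κ → Module.End ℂ V} (hT : LocFin T) (X : Module.End ℂ V) :
    opSum T * X = opSum fun k => T k * X := by
  ext v
  rw [Module.End.mul_apply, opSum_apply (hT.comp_right X), opSum_apply hT]
  rfl

theorem smul_opSum {T : κ → Module.End ℂ V} (hT : LocFin T) (a : ℂ) :
    a • opSum T = opSum fun k => a • T k := by
  ext v
  rw [LinearMap.smul_apply, opSum_apply (hT.smul fun _ => a), opSum_apply hT]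
  exact smul_finsum' a (hT v)

theorem opSum_sub {T U : κ → Module.End ℂ V} (hT : LocFin T) (hU : LocFin U) :
    opSum (fun k => T k - U k) = opSum T - opSum U := by
  have h : opSum (fun k => (-1 : ℂ) • U k) = (-1 : ℂ) • opSum U := (smul_opSum hU _).symm
  have h' := opSum_add hT (hU.smul fun _ => (-1 : ℂ))
  rw [h] at h'
  simpa [sub_eq_add_neg] using h'

theorem opSum_commutator {T : κ → Module.End ℂ V} (hT : LocFin T) (X : Module.End ℂ V) :
    opSum T * X - X * opSum T = opSum fun k => T k * X - X * T k := by
  rw [opSum_mul hT, mul_opSum hT, opSum_sub (hT.comp_right X) (hT.comp_left X)]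

theorem opSum_anticommutator {T : κ → Module.End ℂ V} (hT : LocFin T) (X : Module.End ℂ V) :
    opSum T * X + X * opSum T = opSum fun k => T k * X + X * T k := by
  rw [opSum_mul hT, mul_opSum hT, opSum_add (hT.comp_right X) (hT.comp_left X)]

theorem opSum_eq_zero {T : κ → Module.End ℂ V} (h : ∀ k, T k = 0) : opSum T = 0 :=
  LinearMap.ext fun v => opSum_apply_eq_zero fun k => by simp [h k]

theorem opSum_eq_sum {T : κ → Module.End ℂ V} (s : Finset κ) (h : ∀ k, k ∉ s → T k = 0) :
    opSum T = ∑ k ∈ s, T k := by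
  ext v
  rw [opSum_apply_eq_sum (.of_eq_zero s h) s fun k hk => by simp [h k hk], LinearMap.sum_apply]

theorem opSum_eq_single {T : κ → Module.End ℂ V} (k₀ : κ) (h : ∀ k, k ≠ k₀ → T k = 0) :
    opSum T = T k₀ := by
  classical
  rw [opSum_eq_sum {k₀} fun k hk => h k (by simpa using hk), Finset.sum_singleton]

/-- A commutator with a locally finite sum only one of whose terms contributes. -/
theorem opSum_commutator_single {T : κ → Module.End ℂ V} (hT : LocFin T) {X Y : Module.End ℂ V}
    (k₀ : κ) (h : ∀ k, k ≠ k₀ → T k * X - X * T k = 0) (h₀ : T k₀ * X - X * T k₀ = Y) :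
    opSum T * X - X * opSum T = Y := by
  rw [opSum_commutator hT, opSum_eq_single k₀ h, h₀]

theorem opSum_commutator_zero {T : κ → Module.End ℂ V} (hT : LocFin T) {X : Module.End ℂ V}
    (h : ∀ k, T k * X - X * T k = 0) :
    opSum T * X - X * opSum T = 0 := by
  rw [opSum_commutator hT, opSum_eq_zero h]

/-- On a pure tensor a term survives only if both factors do, and every tensor is a finite sum of
pure ones. The condition couples the two factors, so neither family has to be locally finite by
itself. -/
theorem LocFin.map {κ : Type*} {T : κ → Module.End ℂ V} {U : κ → Module.End ℂ W}
    (h : ∀ (v : V) (w : W), {k | T k v ≠ 0 ∧ U k w ≠ 0}.Finite) :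
    LocFin (V := V ⊗[ℂ] W) fun k => TensorProduct.map (T k) (U k) := fun x => by
  induction x using TensorProduct.induction_on with
  | zero => simp
  | tmul v w =>
    refine (h v w).subset fun k hk => ⟨fun hc => hk ?_, fun hc => hk ?_⟩ <;>
      simp [TensorProduct.map_tmul, hc]
  | add x y hx hy =>
    refine (hx.union hy).subset fun k hk => ?_
    by_contra hc
    simp only [Set.mem_union, Function.mem_support, not_or, not_not] at hc
    exact hk (by simp [hc.1, hc.2])

end LocFin

/-! ### Words in creation operators -/

section Words

variable {V Λ : Type*} [AddCommGroup V] [Module ℂ V]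

/-- The vector obtained from a vacuum by applying a list of creation operators. -/
def word (C : Λ → Module.End ℂ V) (vac : V) (l : List Λ) : V :=
  l.foldr (fun x v => C x v) vac

@[simp]
theorem word_nil (C : Λ → Module.End ℂ V) (vac : V) : word C vac [] = vac := rfl

@[simp]
theorem word_cons (C : Λ → Module.End ℂ V) (vac : V) (x : Λ) (l : List Λ) :
    word C vac (x :: l) = C x (word C vac l) := rfl

/-- The span of the words contains the vacuum and is stable under the creators, so cyclicity of the
vacuum applies to it. -/
theorem span_word_eq_top {C : Λ → Module.End ℂ V} {vac : V}
    (h : ∀ S : Submodule ℂ V, vac ∈ S → (∀ x, ∀ v ∈ S, C x v ∈ S) → S = ⊤) :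
    Submodule.span ℂ (Set.range (word C vac)) = ⊤ := by
  refine h _ (Submodule.subset_span ⟨[], rfl⟩) fun x v hv => ?_
  induction hv using Submodule.span_induction with
  | mem v hv =>
    obtain ⟨l, rfl⟩ := hv
    exact Submodule.subset_span ⟨x :: l, rfl⟩
  | zero => simp
  | add v w _ _ hv hw => rw [map_add]; exact Submodule.add_mem _ hv hw
  | smul a v _ hv => rw [map_smul]; exact Submodule.smul_mem _ a hv

/-- Each creator shifts the eigenvalue by its own weight. All the counting operators below are
diagonalized in this way, with no need for the words to be linearly independent. -/
theorem word_eigen {C : Λ → Module.End ℂ V} {vac : V} {O : Module.End ℂ V} {o : ℂ} {w : Λ → ℂ}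
    (hvac : O vac = o • vac) (hC : ∀ x, O * C x - C x * O = w x • C x) (l : List Λ) :
    O (word C vac l) = (o + (l.map w).sum) • word C vac l := by
  induction l with
  | nil => simpa using hvac
  | cons x l ih =>
    have := congrArg (fun X : Module.End ℂ V => X (word C vac l)) (hC x)
    simp only [LinearMap.sub_apply, Module.End.mul_apply, LinearMap.smul_apply, ih, map_smul] at this
    rw [word_cons, eq_add_of_sub_eq this, List.map_cons, List.sum_cons]
    module

/-- Eigenvectors of an operator that is diagonal on a spanning family lie in the span of the members
of the family with the same eigenvalue. -/
theorem mem_span_of_eigen {ι : Type*} {e : ι → V} (he : Submodule.span ℂ (Set.range e) = ⊤)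
    {O : Module.End ℂ V} {ev : ι → ℂ} (hO : ∀ i, O (e i) = ev i • e i) {μ : ℂ} {y : V}
    (hy : O y = μ • y) : y ∈ Submodule.span ℂ (e '' {i | ev i = μ}) := by
  -- Each spanning vector lies either in the target span or in an eigenspace for another eigenvalue;
  -- independence of eigenspaces then kills the second component of `y`.
  have hsplit : y ∈ Submodule.span ℂ (e '' {i | ev i = μ}) ⊔
      ⨆ ν, ⨆ _ : ν ≠ μ, Module.End.eigenspace O ν := by
    have : (⊤ : Submodule ℂ V) ≤ Submodule.span ℂ (e '' {i | ev i = μ}) ⊔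
        ⨆ ν, ⨆ _ : ν ≠ μ, Module.End.eigenspace O ν := by
      rw [← he, Submodule.span_le]
      rintro _ ⟨i, rfl⟩
      by_cases hi : ev i = μ
      · exact Submodule.mem_sup_left (Submodule.subset_span ⟨i, hi, rfl⟩)
      · refine Submodule.mem_sup_right ?_
        exact Submodule.mem_iSup_of_mem (ev i) (Submodule.mem_iSup_of_mem hi
          (Module.End.mem_eigenspace_iff.2 (hO i)))
    exact this trivial
  obtain ⟨a, ha, b, hb, rfl⟩ := Submodule.mem_sup.1 hsplit
  have ha' : a ∈ Module.End.eigenspace O μ := by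
    refine (Submodule.span_le.2 ?_ : Submodule.span ℂ (e '' {i | ev i = μ}) ≤ _) ha
    rintro _ ⟨i, hi, rfl⟩
    exact Module.End.mem_eigenspace_iff.2 (by rw [hO i, hi])
  have hb' : b ∈ Module.End.eigenspace O μ := by
    have := Submodule.sub_mem _ (Module.End.mem_eigenspace_iff.2 hy) ha'
    simpa using this
  have hb0 : b = 0 := by
    have := Submodule.disjoint_def.1 (Module.End.eigenspaces_iSupIndep O μ) b hb' hb
    exact this
  simpa [hb0] using ha

theorem eq_zero_of_eigen {ι : Type*} {e : ι → V} (he : Submodule.span ℂ (Set.range e) = ⊤)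
    {O : Module.End ℂ V} {ev : ι → ℂ} (hO : ∀ i, O (e i) = ev i • e i) {μ : ℂ} {y : V}
    (hy : O y = μ • y) (hμ : ∀ i, ev i ≠ μ) : y = 0 := by
  have := mem_span_of_eigen he hO hy
  have hemp : {i | ev i = μ} = ∅ := Set.eq_empty_of_forall_notMem hμ
  simpa [hemp] using this

/-- Removing the head of a list lowers the sum, because weights are positive, and only finitely many
heads are possible. This is the source of finite-dimensionality at a fixed level. -/
theorem list_finite_of_sum_eq (w : Λ → ℕ) (hpos : ∀ x, 0 < w x)
    (hfin : ∀ n, {x | w x ≤ n}.Finite) (n : ℕ) : {l : List Λ | (l.map w).sum = n}.Finite := by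
  induction n using Nat.strong_induction_on with
  | _ n ih =>
    have : {l : List Λ | (l.map w).sum = n} ⊆
        {[]} ∪ ⋃ x ∈ {x | w x ≤ n}, (fun l => x :: l) '' {l | (l.map w).sum = n - w x} := by
      rintro (_ | ⟨x, l⟩) hl
      · simp
      · simp only [List.map_cons, List.sum_cons, Set.mem_ofPred_eq] at hl
        refine Or.inr (Set.mem_biUnion (x := x) (by simp; omega) ⟨l, ?_, rfl⟩)
        simp only [Set.mem_ofPred_eq]
        omega
    refine ((Set.finite_singleton _).union ((hfin n).biUnion fun x hx => ?_)).subset this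
    have := hpos x
    simp only [Set.mem_ofPred_eq] at hx
    exact (ih (n - w x) (by omega)).image _

end Words

/-! ### Operators raising the charge -/

section Charge

variable {V : Type*} [AddCommGroup V] [Module ℂ V]

/-- The span of the eigenvectors of `F` with integral eigenvalue at least `n`. -/
def chargeGE (F : Module.End ℂ V) (n : ℤ) : Submodule ℂ V :=
  ⨆ k : ℤ, ⨆ _ : n ≤ k, Module.End.eigenspace F (k : ℂ)

theorem eigenspace_le_chargeGE (F : Module.End ℂ V) {n k : ℤ} (h : n ≤ k) :
    Module.End.eigenspace F (k : ℂ) ≤ chargeGE F n :=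
  le_iSup₂_of_le k h le_rfl

theorem chargeGE_anti (F : Module.End ℂ V) {n n' : ℤ} (h : n ≤ n') :
    chargeGE F n' ≤ chargeGE F n :=
  iSup₂_le fun _ hk => eigenspace_le_chargeGE F (h.trans hk)

theorem disjoint_chargeGE (F : Module.End ℂ V) {n k : ℤ} (h : k < n) :
    Disjoint (Module.End.eigenspace F (k : ℂ)) (chargeGE F n) := by
  refine (Module.End.eigenspaces_iSupIndep F (k : ℂ)).mono_right ?_
  refine iSup₂_le fun j hj => le_iSup₂_of_le (j : ℂ) ?_ le_rfl
  exact_mod_cast (by omega : j ≠ k)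

/-- `G` raises the charge `F` by at least `g`. -/
def Raises (F G : Module.End ℂ V) (g : ℤ) : Prop :=
  ∀ n, ∀ v ∈ chargeGE F n, G v ∈ chargeGE F (n + g)

theorem Raises.mono {F G : Module.End ℂ V} {g g' : ℤ} (h : Raises F G g) (hg : g' ≤ g) :
    Raises F G g' := fun n v hv => chargeGE_anti F (by omega) (h n v hv)

theorem mapsTo_eigenspace {F G : Module.End ℂ V} {g : ℂ} (h : F * G - G * F = g • G) {k : ℂ}
    {v : V} (hv : v ∈ Module.End.eigenspace F k) : G v ∈ Module.End.eigenspace F (k + g) := by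
  rw [Module.End.mem_eigenspace_iff] at hv ⊢
  have := congrArg (fun X : Module.End ℂ V => X v) h
  simp only [LinearMap.sub_apply, Module.End.mul_apply, LinearMap.smul_apply, hv, map_smul] at this
  rw [eq_add_of_sub_eq this]
  module

theorem Raises.of_commutator {F G : Module.End ℂ V} {g : ℤ} (h : F * G - G * F = (g : ℂ) • G) :
    Raises F G g := fun n v hv => by
  refine (iSup₂_le fun k hk => ?_ : chargeGE F n ≤ (chargeGE F (n + g)).comap G) hv
  intro x hx
  have := mapsTo_eigenspace h hx
  rw [← Int.cast_add] at this
  exact eigenspace_le_chargeGE F (by omega) this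

theorem Raises.zero (F : Module.End ℂ V) (g : ℤ) : Raises F 0 g := fun _ _ _ => by simp

theorem Raises.add {F G G' : Module.End ℂ V} {g : ℤ} (h : Raises F G g) (h' : Raises F G' g) :
    Raises F (G + G') g := fun n v hv => Submodule.add_mem _ (h n v hv) (h' n v hv)

theorem Raises.smul {F G : Module.End ℂ V} {g : ℤ} (h : Raises F G g) (a : ℂ) :
    Raises F (a • G) g := fun n v hv => Submodule.smul_mem _ a (h n v hv)

theorem Raises.sum {ι : Type*} {F : Module.End ℂ V} {G : ι → Module.End ℂ V} {g : ℤ}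
    (s : Finset ι) (h : ∀ i ∈ s, Raises F (G i) g) : Raises F (∑ i ∈ s, G i) g :=
  fun n v hv => by
    rw [LinearMap.sum_apply]
    exact Submodule.sum_mem _ fun i hi => h i hi n v hv

theorem Raises.mul {F G G' : Module.End ℂ V} {g g' : ℤ} (h : Raises F G g)
    (h' : Raises F G' g') : Raises F (G * G') (g + g') := fun n v hv => by
  have := h _ _ (h' n v hv)
  rwa [add_assoc, add_comm g'] at this

theorem Raises.opSum {κ : Type*} {F : Module.End ℂ V} {G : κ → Module.End ℂ V} {g : ℤ}
    (h : ∀ k, Raises F (G k) g) : Raises F (opSum G) g := fun n v hv =>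
  opSum_apply_mem _ v fun k => h k n v hv

/-- The lowest charge component of a solution of `(G + R) v = 0`, where `R` raises the charge by
more than `G`, is killed by `G`. -/
theorem eq_zero_of_lowest {F N G R : Module.End ℂ V}
    (hF : ⨆ k : ℤ, Module.End.eigenspace F (k : ℂ) = ⊤) (hN : F * N - N * F = 0) {g : ℤ}
    (hG : F * G - G * F = (g : ℂ) • G) (hR : Raises F R (g + 1)) {r : ℂ}
    (hinj : ∀ y, N y = r • y → G y = 0 → y = 0) {v : V} (hv : N v = r • v)
    (h0 : (G + R) v = 0) : v = 0 := by
  by_contra hne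
  obtain ⟨f, hf, hsum⟩ := (Submodule.mem_iSup_iff_exists_finsupp _ v).1
    (hF ▸ Submodule.mem_top : v ∈ ⨆ k : ℤ, Module.End.eigenspace F (k : ℂ))
  have hsupp : f.support.Nonempty := by
    rw [Finset.nonempty_iff_ne_empty]
    intro hs
    rw [Finsupp.support_eq_empty] at hs
    exact hne (by rw [← hsum, hs, Finsupp.sum_zero_index])
  set k₀ := f.support.min' hsupp with hk₀
  have hk₀mem : k₀ ∈ f.support := Finset.min'_mem _ _
  set x := f k₀ with hx
  set y := ∑ k ∈ f.support.erase k₀, f k with hy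
  have hvxy : v = x + y := by
    rw [← hsum, Finsupp.sum, hx, hy, Finset.add_sum_erase _ _ hk₀mem]
  have hxe : x ∈ Module.End.eigenspace F (k₀ : ℂ) := hf k₀
  have hyc : y ∈ chargeGE F (k₀ + 1) := by
    refine Submodule.sum_mem _ fun k hk => eigenspace_le_chargeGE F ?_ (hf k)
    have h1 := Finset.min'_le _ _ (Finset.mem_of_mem_erase hk)
    have h2 := Finset.ne_of_mem_erase hk
    omega
  have hxc : x ∈ chargeGE F k₀ := eigenspace_le_chargeGE F le_rfl hxe
  refine (Finsupp.mem_support_iff.1 hk₀mem) (hinj x ?_ ?_)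
  -- `N - r` preserves the charge and kills `v = x + y`, so it kills the lowest component `x`
  -- separately.
  · have hN' : Raises F (N - r • 1) 0 := by
      refine Raises.of_commutator ?_
      rw [mul_sub, sub_mul, mul_smul_comm, smul_mul_assoc, mul_one, one_mul]
      simpa using hN
    have h1 : (N - r • 1) x ∈ Module.End.eigenspace F (k₀ : ℂ) := by
      have := mapsTo_eigenspace (G := N - r • 1) (g := 0) (F := F) (k := k₀) (v := x) (by
        rw [mul_sub, sub_mul, mul_smul_comm, smul_mul_assoc, mul_one, one_mul]
        simpa using hN) hxe
      simpa using this
    have h2 : (N - r • 1) x ∈ chargeGE F (k₀ + 1) := by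
      have h3 : (N - r • 1) v = 0 := by simp [hv]
      rw [hvxy, map_add] at h3
      rw [eq_neg_of_add_eq_zero_left h3]
      have := hN' _ _ hyc
      rw [add_zero] at this
      exact Submodule.neg_mem _ this
    have := Submodule.disjoint_def.1 (disjoint_chargeGE F (by omega)) _ h1 h2
    simpa [sub_eq_zero] using this
  -- In `(G + R) v = 0` the term `G x` is the only one of charge `k₀ + g`; all the others have
  -- charge at least `k₀ + g + 1`.
  · have h1 : G x ∈ Module.End.eigenspace F ((k₀ + g : ℤ) : ℂ) := by
      have := mapsTo_eigenspace hG hxe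
      simpa using this
    have h2 : G x ∈ chargeGE F (k₀ + g + 1) := by
      rw [hvxy, map_add, LinearMap.add_apply] at h0
      have h3 : G x = -(R x + (G y + R y)) := by
        rw [eq_neg_iff_add_eq_zero, ← h0]
        simp only [LinearMap.add_apply]
        abel
      rw [h3]
      refine Submodule.neg_mem _ (Submodule.add_mem _ ?_ (Submodule.add_mem _ ?_ ?_))
      · exact chargeGE_anti F (by omega) (hR _ _ hxc)
      · exact chargeGE_anti F (by omega) (Raises.of_commutator hG _ _ hyc)
      · exact chargeGE_anti F (by omega) (hR _ _ hyc)
    exact Submodule.disjoint_def.1 (disjoint_chargeGE F (by omega)) _ h1 h2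

end Charge

/-! ### Criteria for local finiteness of families indexed by integers -/

section LocFinBound

variable {V : Type*} [AddCommGroup V] [Module ℂ V]

theorem LocFin.of_int_bound {T : ℤ → Module.End ℂ V}
    (h : ∀ v, ∃ N : ℤ, ∀ k, (N ≤ k ∨ k ≤ -N) → T k v = 0) : LocFin T := fun v => by
  obtain ⟨N, hN⟩ := h v
  refine (Set.finite_Icc (-N) N).subset fun k hk => ?_
  by_contra hc
  rw [Set.mem_Icc, not_and_or, not_le, not_le] at hc
  exact hk (hN k (by omega))

theorem LocFin.of_pnat_bound {T : ℕ+ → Module.End ℂ V}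
    (h : ∀ v, ∃ N : ℤ, ∀ k : ℕ+, N ≤ (k : ℤ) → T k v = 0) : LocFin T := fun v => by
  obtain ⟨N, hN⟩ := h v
  have hfin : {k : ℕ+ | (k : ℤ) ≤ N}.Finite := by
    refine Set.Finite.of_finite_image (f := fun k : ℕ+ => (k : ℤ))
      ((Set.finite_Icc 0 N).subset ?_) ?_
    · rintro _ ⟨k, hk, rfl⟩
      exact ⟨by positivity, hk⟩
    · intro a _ b _ hab
      exact PNat.coe_injective (Int.ofNat_injective hab)
  refine hfin.subset fun k hk => ?_
  by_contra hc
  exact hk (hN k (not_le.1 hc).le)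

end LocFinBound

/-! ### The algebra of the ghost modes -/

/-- A representation of the ghost mode algebra in which every vector is killed by the modes of
large index. -/
structure GhostModes (V : Type*) [AddCommGroup V] [Module ℂ V] where
  c : ℤ → Module.End ℂ V
  b : ℤ → Module.End ℂ V
  c_add_b : ∀ m n, c m * b n + b n * c m = if m + n = 0 then 1 else 0
  c_add_c : ∀ m n, c m * c n + c n * c m = 0
  b_add_b : ∀ m n, b m * b n + b n * b m = 0
  ghost_bound : ∀ v, ∃ N : ℤ, 0 < N ∧ ∀ n, N ≤ n → c n v = 0 ∧ b n v = 0

namespace GhostModes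

variable {V : Type*} [AddCommGroup V] [Module ℂ V] (G : GhostModes V)

/-- The normally ordered product `: c_m b_n :`. -/
def normal (m n : ℤ) : Module.End ℂ V :=
  if m = 0 ∧ n = 0 then (1 / 2 : ℂ) • (G.c 0 * G.b 0 - G.b 0 * G.c 0)
  else if 0 < m then -(G.b n * G.c m)
  else G.c m * G.b n

/-- The ghost Virasoro operators. -/
def ghostVir (m : ℤ) : Module.End ℂ V :=
  opSum fun k : ℤ => ((k : ℂ) - (m : ℂ)) • G.normal (-k) (m + k)

/-- The ghost differential. -/
def ghostDiff : Module.End ℂ V :=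
  (1 / 2 : ℂ) • opSum (fun m : ℕ+ => G.c (-(m : ℤ)) * G.ghostVir (m : ℤ))
    + (1 / 2 : ℂ) • (G.c 0 * G.ghostVir 0)
    + (1 / 2 : ℂ) • opSum (fun m : ℕ+ => G.ghostVir (-(m : ℤ)) * G.c (m : ℤ))

/-- The number of excitations `c_{-m}`, `m > 0`. -/
def ghostDegree : Module.End ℂ V :=
  opSum fun m : ℕ+ => G.c (-(m : ℤ)) * G.b (m : ℤ)

/-- The number of excitations `b_{-m}`, `m > 0`. -/
def antighostDegree : Module.End ℂ V :=
  opSum fun m : ℕ+ => G.b (-(m : ℤ)) * G.c (m : ℤ)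

/-- Normal ordering changes the product only by a scalar, so commutators can be computed from the
unordered product. -/
theorem normal_eq (m n : ℤ) : ∃ s : ℂ, G.normal m n = G.c m * G.b n - s • 1 := by
  unfold normal
  have h := G.c_add_b m n
  split_ifs with h0 h1
  · obtain ⟨rfl, rfl⟩ := h0
    refine ⟨1 / 2, ?_⟩
    rw [if_pos (by simp)] at h
    rw [← h]
    module
  · by_cases hmn : m + n = 0
    · refine ⟨1, ?_⟩
      rw [if_pos hmn] at h
      rw [← h]
      module
    · refine ⟨0, ?_⟩
      rw [if_neg hmn] at h
      rw [eq_neg_of_add_eq_zero_left h]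
      module
  · exact ⟨0, by simp⟩

theorem cb_comm_b (m n k : ℤ) :
    G.c m * G.b n * G.b k - G.b k * (G.c m * G.b n) = -(if m + k = 0 then G.b n else 0) := by
  have h : -(if m + k = 0 then G.b n else 0 : Module.End ℂ V)
      = -((if m + k = 0 then 1 else 0) * G.b n) := by split_ifs <;> simp
  rw [h, ← G.c_add_b]
  linear_combination (norm := noncomm_ring) G.c m * G.b_add_b n k

theorem cb_comm_c (m n k : ℤ) :
    G.c m * G.b n * G.c k - G.c k * (G.c m * G.b n) = if n + k = 0 then G.c m else 0 := by
  have h : (if n + k = 0 then G.c m else 0 : Module.End ℂ V)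
      = G.c m * (if k + n = 0 then 1 else 0) := by
    rw [add_comm k n]; split_ifs <;> simp
  rw [h, ← G.c_add_b]
  linear_combination (norm := noncomm_ring) -G.c_add_c k m * G.b n

theorem normal_comm_b (m n k : ℤ) :
    G.normal m n * G.b k - G.b k * G.normal m n = -(if m + k = 0 then G.b n else 0) := by
  obtain ⟨s, hs⟩ := G.normal_eq m n
  rw [hs, ← G.cb_comm_b, sub_mul, mul_sub, smul_mul_assoc, mul_smul_comm, one_mul, mul_one]
  abel

theorem normal_comm_c (m n k : ℤ) :
    G.normal m n * G.c k - G.c k * G.normal m n = if n + k = 0 then G.c m else 0 := by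
  obtain ⟨s, hs⟩ := G.normal_eq m n
  rw [hs, ← G.cb_comm_c, sub_mul, mul_sub, smul_mul_assoc, mul_smul_comm, one_mul, mul_one]
  abel

theorem locFin_ghostVir (m : ℤ) :
    LocFin fun k : ℤ => ((k : ℂ) - (m : ℂ)) • G.normal (-k) (m + k) := by
  refine LocFin.smul (T := fun k : ℤ => G.normal (-k) (m + k)) (.of_int_bound fun v => ?_) _
  obtain ⟨N, h0, hN⟩ := G.ghost_bound v
  refine ⟨N + |m|, fun k hk => ?_⟩
  have hm := neg_abs_le m
  have hm' := abs_nonneg m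
  unfold normal
  rw [if_neg (by omega)]
  split_ifs with h1
  · rw [LinearMap.neg_apply, Module.End.mul_apply, (hN _ (by omega)).1]
    simp
  · rw [Module.End.mul_apply, (hN _ (by omega)).2]
    simp

/-- Only the summand `k = n` contains the mode c_{-n} that is paired with b_n. The companion formula
for c_n likewise comes from one summand. -/
theorem ghostVir_comm_b (m n : ℤ) :
    G.ghostVir m * G.b n - G.b n * G.ghostVir m = ((m : ℂ) - n) • G.b (m + n) := by
  refine opSum_commutator_single (G.locFin_ghostVir m) n (fun k hk => ?_) ?_
  · rw [smul_mul_assoc, mul_smul_comm, ← smul_sub, G.normal_comm_b, if_neg (by omega)]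
    simp
  · rw [smul_mul_assoc, mul_smul_comm, ← smul_sub, G.normal_comm_b, if_pos (by omega)]
    module

theorem ghostVir_comm_c (m n : ℤ) :
    G.ghostVir m * G.c n - G.c n * G.ghostVir m = (-(2 * (m : ℂ) + n)) • G.c (m + n) := by
  refine opSum_commutator_single (G.locFin_ghostVir m) (-m - n) (fun k hk => ?_) ?_
  · rw [smul_mul_assoc, mul_smul_comm, ← smul_sub, G.normal_comm_c, if_neg (by omega)]
    simp
  · rw [smul_mul_assoc, mul_smul_comm, ← smul_sub, G.normal_comm_c, if_pos (by omega)]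
    have : -(-m - n) = m + n := by ring
    rw [this]
    push_cast
    congr 1
    ring

/-- The indices of the two modes in a summand add up to `m ≥ 2N`, so one of them is at least `N`. As
`m ≠ 0` the two modes anticommute, and the one that kills `v` can be moved to the right. -/
theorem ghostVir_bound (v : V) : ∃ N : ℤ, 0 < N ∧ ∀ m, N ≤ m → G.ghostVir m v = 0 := by
  obtain ⟨N, h0, hN⟩ := G.ghost_bound v
  refine ⟨2 * N, by omega, fun m hm => opSum_apply_eq_zero fun k => ?_⟩
  rw [LinearMap.smul_apply]
  convert smul_zero _
  unfold normal
  rw [if_neg (by omega)]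
  split_ifs with h1
  · rw [LinearMap.neg_apply, neg_eq_zero]
    by_cases hk : N ≤ -k
    · rw [Module.End.mul_apply, (hN _ hk).1, map_zero]
    · have := congrArg (fun X : Module.End ℂ V => X v) (G.c_add_b (-k) (m + k))
      rw [if_neg (by omega)] at this
      simp only [LinearMap.add_apply, Module.End.mul_apply, LinearMap.zero_apply,
        (hN (m + k) (by omega)).2, map_zero, zero_add] at this
      exact this
  · rw [Module.End.mul_apply, (hN _ (by omega)).2, map_zero]

theorem ghostVir_vac {v : V} (hc : ∀ n, 0 < n → G.c n v = 0) (hb : ∀ n, 0 ≤ n → G.b n v = 0)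
    {m : ℤ} (hm : 0 ≤ m) : G.ghostVir m v = 0 := by
  refine opSum_apply_eq_zero fun k => ?_
  rw [LinearMap.smul_apply]
  unfold normal
  split_ifs with h0 h1
  -- The zero mode term, whose antisymmetrized ordering does not kill the vacuum, enters with the
  -- coefficient `k - m = 0`.
  · have : k = m := by omega
    simp [this]
  · rw [LinearMap.neg_apply, Module.End.mul_apply, hc _ h1]
    simp
  · rw [Module.End.mul_apply, hb _ (by omega)]
    simp

/-! ### Counting operators -/

theorem locFin_mul_b (w : ℕ+ → ℂ) (X : ℕ+ → Module.End ℂ V) :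
    LocFin fun m : ℕ+ => w m • (X m * G.b (m : ℤ)) := by
  refine LocFin.smul (T := fun m : ℕ+ => X m * G.b (m : ℤ)) (.of_pnat_bound fun v => ?_) w
  obtain ⟨N, -, hN⟩ := G.ghost_bound v
  exact ⟨N, fun k hk => by rw [Module.End.mul_apply, (hN _ hk).2, map_zero]⟩

theorem locFin_mul_c (w : ℕ+ → ℂ) (X : ℕ+ → Module.End ℂ V) :
    LocFin fun m : ℕ+ => w m • (X m * G.c (m : ℤ)) := by
  refine LocFin.smul (T := fun m : ℕ+ => X m * G.c (m : ℤ)) (.of_pnat_bound fun v => ?_) w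
  obtain ⟨N, -, hN⟩ := G.ghost_bound v
  exact ⟨N, fun k hk => by rw [Module.End.mul_apply, (hN _ hk).1, map_zero]⟩

/-- The weighted number of excitations `c_{-m}`, `m > 0`. -/
def ghostWeight (w : ℤ → ℂ) : Module.End ℂ V :=
  opSum fun m : ℕ+ => w m • (G.c (-(m : ℤ)) * G.b (m : ℤ))

/-- The weighted number of excitations `b_{-m}`, `m > 0`. -/
def antighostWeight (w : ℤ → ℂ) : Module.End ℂ V :=
  opSum fun m : ℕ+ => w m • (G.b (-(m : ℤ)) * G.c (m : ℤ))

theorem ghostDegree_eq : G.ghostDegree = G.ghostWeight fun _ => 1 := by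
  simp [ghostDegree, ghostWeight]

theorem antighostDegree_eq : G.antighostDegree = G.antighostWeight fun _ => 1 := by
  simp [antighostDegree, antighostWeight]

theorem _root_.MassiveString.exists_pnat {n : ℤ} (h : 0 < n) : ∃ k : ℕ+, (k : ℤ) = n :=
  ⟨⟨n.toNat, by omega⟩, by change (n.toNat : ℤ) = n; omega⟩

theorem _root_.MassiveString.pnat_ne {k l : ℕ+} (h : k ≠ l) : (k : ℤ) ≠ l := fun hkl =>
  h (PNat.coe_injective (Int.ofNat_injective hkl))

theorem ghostWeight_comm_b (w : ℤ → ℂ) (n : ℤ) :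
    G.ghostWeight w * G.b n - G.b n * G.ghostWeight w = if 0 < n then -w n • G.b n else 0 := by
  split_ifs with h
  · obtain ⟨l, rfl⟩ := exists_pnat h
    refine opSum_commutator_single (G.locFin_mul_b (fun m => w m) _) l (fun k hk => ?_) ?_
    · have := pnat_ne hk
      rw [smul_mul_assoc, mul_smul_comm, ← smul_sub, cb_comm_b, if_neg (by omega), neg_zero,
        smul_zero]
    · rw [smul_mul_assoc, mul_smul_comm, ← smul_sub, cb_comm_b, if_pos (by omega)]
      module
  · refine opSum_commutator_zero (G.locFin_mul_b (fun m => w m) _) fun k => ?_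
    have := k.pos
    rw [smul_mul_assoc, mul_smul_comm, ← smul_sub, cb_comm_b, if_neg (by omega), neg_zero,
      smul_zero]

theorem ghostWeight_comm_c (w : ℤ → ℂ) (n : ℤ) :
    G.ghostWeight w * G.c n - G.c n * G.ghostWeight w = if n < 0 then w (-n) • G.c n else 0 := by
  split_ifs with h
  · obtain ⟨l, hl⟩ := exists_pnat (n := -n) (by omega)
    obtain rfl : n = -l := by omega
    refine opSum_commutator_single (G.locFin_mul_b (fun m => w m) _) l (fun k hk => ?_) ?_
    · have := pnat_ne hk
      rw [smul_mul_assoc, mul_smul_comm, ← smul_sub, cb_comm_c, if_neg (by omega), smul_zero]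
    · rw [smul_mul_assoc, mul_smul_comm, ← smul_sub, cb_comm_c, if_pos (by omega), neg_neg]
  · refine opSum_commutator_zero (G.locFin_mul_b (fun m => w m) _) fun k => ?_
    have := k.pos
    rw [smul_mul_assoc, mul_smul_comm, ← smul_sub, cb_comm_c, if_neg (by omega), smul_zero]

theorem ghostDegree_comm_b (n : ℤ) :
    G.ghostDegree * G.b n - G.b n * G.ghostDegree = if 0 < n then -G.b n else 0 := by
  rw [G.ghostDegree_eq, G.ghostWeight_comm_b]
  split_ifs <;> simp

theorem ghostDegree_comm_c (n : ℤ) :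
    G.ghostDegree * G.c n - G.c n * G.ghostDegree = if n < 0 then G.c n else 0 := by
  rw [G.ghostDegree_eq, G.ghostWeight_comm_c]
  split_ifs <;> simp

theorem bc_comm_b (m n k : ℤ) :
    G.b m * G.c n * G.b k - G.b k * (G.b m * G.c n) = if n + k = 0 then G.b m else 0 := by
  have h : (if n + k = 0 then G.b m else 0 : Module.End ℂ V)
      = G.b m * (if n + k = 0 then 1 else 0) := by split_ifs <;> simp
  rw [h, ← G.c_add_b]
  linear_combination (norm := noncomm_ring) -G.b_add_b k m * G.c n

theorem bc_comm_c (m n k : ℤ) :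
    G.b m * G.c n * G.c k - G.c k * (G.b m * G.c n) = -(if m + k = 0 then G.c n else 0) := by
  have h : -(if m + k = 0 then G.c n else 0 : Module.End ℂ V)
      = -((if k + m = 0 then 1 else 0) * G.c n) := by
    rw [add_comm k m]; split_ifs <;> simp
  rw [h, ← G.c_add_b]
  linear_combination (norm := noncomm_ring) G.b m * G.c_add_c n k

theorem antighostWeight_comm_b (w : ℤ → ℂ) (n : ℤ) :
    G.antighostWeight w * G.b n - G.b n * G.antighostWeight w
      = if n < 0 then w (-n) • G.b n else 0 := by
  split_ifs with h
  · obtain ⟨l, hl⟩ := exists_pnat (n := -n) (by omega)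
    obtain rfl : n = -l := by omega
    refine opSum_commutator_single (G.locFin_mul_c (fun m => w m) _) l (fun k hk => ?_) ?_
    · have := pnat_ne hk
      rw [smul_mul_assoc, mul_smul_comm, ← smul_sub, bc_comm_b, if_neg (by omega), smul_zero]
    · rw [smul_mul_assoc, mul_smul_comm, ← smul_sub, bc_comm_b, if_pos (by omega), neg_neg]
  · refine opSum_commutator_zero (G.locFin_mul_c (fun m => w m) _) fun k => ?_
    have := k.pos
    rw [smul_mul_assoc, mul_smul_comm, ← smul_sub, bc_comm_b, if_neg (by omega), smul_zero]

theorem antighostWeight_comm_c (w : ℤ → ℂ) (n : ℤ) :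
    G.antighostWeight w * G.c n - G.c n * G.antighostWeight w
      = if 0 < n then -w n • G.c n else 0 := by
  split_ifs with h
  · obtain ⟨l, rfl⟩ := exists_pnat h
    refine opSum_commutator_single (G.locFin_mul_c (fun m => w m) _) l (fun k hk => ?_) ?_
    · have := pnat_ne hk
      rw [smul_mul_assoc, mul_smul_comm, ← smul_sub, bc_comm_c, if_neg (by omega), neg_zero,
        smul_zero]
    · rw [smul_mul_assoc, mul_smul_comm, ← smul_sub, bc_comm_c, if_pos (by omega)]
      module
  · refine opSum_commutator_zero (G.locFin_mul_c (fun m => w m) _) fun k => ?_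
    have := k.pos
    rw [smul_mul_assoc, mul_smul_comm, ← smul_sub, bc_comm_c, if_neg (by omega), neg_zero,
      smul_zero]

theorem antighostDegree_comm_b (n : ℤ) :
    G.antighostDegree * G.b n - G.b n * G.antighostDegree = if n < 0 then G.b n else 0 := by
  rw [antighostDegree_eq, antighostWeight_comm_b]
  split_ifs <;> simp

theorem antighostDegree_comm_c (n : ℤ) :
    G.antighostDegree * G.c n - G.c n * G.antighostDegree = if 0 < n then -G.c n else 0 := by
  rw [antighostDegree_eq, antighostWeight_comm_c]
  split_ifs <;> simp

/-- The ghost number, counting all the excitations `c_{-m}`, `m ≥ 0`, with sign `+` and the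
excitations `b_{-m}`, `m > 0`, with sign `-`. -/
def ghostNumber : Module.End ℂ V := G.ghostDegree - G.antighostDegree + G.c 0 * G.b 0

theorem ghostNumber_comm_b (n : ℤ) : G.ghostNumber * G.b n - G.b n * G.ghostNumber = -G.b n := by
  have h1 := G.ghostDegree_comm_b n
  have h2 := G.antighostDegree_comm_b n
  have h3 := G.cb_comm_b 0 0 n
  have h : -G.b n = (if 0 < n then -G.b n else 0) - (if n < 0 then G.b n else 0)
      + -(if 0 + n = 0 then G.b 0 else 0) := by
    rcases lt_trichotomy n 0 with h | rfl | h
    · rw [if_neg (by omega), if_pos h, if_neg (by omega)]; simp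
    · simp
    · rw [if_pos h, if_neg (by omega), if_neg (by omega)]; simp
  rw [h, ← h1, ← h2, ← h3, ghostNumber]
  noncomm_ring

theorem ghostNumber_comm_c (n : ℤ) : G.ghostNumber * G.c n - G.c n * G.ghostNumber = G.c n := by
  have h1 := G.ghostDegree_comm_c n
  have h2 := G.antighostDegree_comm_c n
  have h3 := G.cb_comm_c 0 0 n
  have h : G.c n = (if n < 0 then G.c n else 0) - (if 0 < n then -G.c n else 0)
      + (if 0 + n = 0 then G.c 0 else 0) := by
    rcases lt_trichotomy n 0 with h | rfl | h
    · rw [if_pos h, if_neg (by omega), if_neg (by omega)]; simp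
    · simp
    · rw [if_neg (by omega), if_pos h, if_neg (by omega)]; simp
  conv_rhs => rw [h, ← h1, ← h2, ← h3]
  rw [ghostNumber]
  noncomm_ring

end GhostModes

/-! ### Virasoro cocycles -/

/-- The Jacobi identity, in the form that carries known commutators with a single mode over to a
commutator of two constraints. -/
theorem commutator_commutator {R : Type*} [Ring R] (A B C : R) :
    (A * B - B * A) * C - C * (A * B - B * A)
      = (A * (B * C - C * B) - (B * C - C * B) * A) - (B * (A * C - C * A) - (A * C - C * A) * B) := by
  noncomm_ring

/-- A central extension of the Witt algebra is determined by the values of its cocycle on the pairs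
`(1, -1)` and `(2, -2)`. -/
theorem virasoro_of_scalar {R : Type*} [Ring R] [Algebra ℂ R] [Nontrivial R] {L : ℤ → R}
    (s : ℤ → ℤ → ℂ)
    (hs : ∀ m n : ℤ, L m * L n - L n * L m = ((m : ℂ) - n) • L (m + n) + s m n • (1 : R))
    (h0 : ∀ m : ℤ, L 0 * L m - L m * L 0 = (-(m : ℂ)) • L m) {x y : ℂ}
    (h1 : s 1 (-1) = x + y) (h2 : s 2 (-2) = 8 * x + 2 * y) (m n : ℤ) :
    L m * L n - L n * L m
      = ((m : ℂ) - n) • L (m + n) + (if m + n = 0 then x * (m : ℂ) ^ 3 + y * m else 0) • (1 : R) := by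
  have hinj : ∀ z : ℂ, z • (1 : R) = 0 → z = 0 := fun z hz => by
    rwa [smul_eq_zero_iff_left one_ne_zero] at hz
  -- The Jacobi identity with L_0 gives `(m + n) s(m, n) = 0`, so the cocycle lives on `m + n = 0`.
  have hne : ∀ m n : ℤ, m + n ≠ 0 → s m n = 0 := fun m n hmn => by
    have e : ((m : ℂ) + n) • (s m n • (1 : R)) = 0 := by
      have j := commutator_commutator (L m) (L n) (L 0)
      have hm := h0 m
      have hn := h0 n
      have hmn := h0 (m + n)
      have k := hs m n
      have j1 : (L m * L n - L n * L m) * L 0 - L 0 * (L m * L n - L n * L m)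
          = ((m : ℂ) + n) • (L m * L n - L n * L m) := by
        have hm' : L m * L 0 - L 0 * L m = (m : ℂ) • L m := by
          rw [← neg_sub, hm, neg_smul, neg_neg]
        have hn' : L n * L 0 - L 0 * L n = (n : ℂ) • L n := by
          rw [← neg_sub, hn, neg_smul, neg_neg]
        rw [j, hm', hn']
        simp only [smul_mul_assoc, mul_smul_comm]
        module
      rw [k] at j1
      have hmn' : L (m + n) * L 0 - L 0 * L (m + n) = ((m : ℂ) + n) • L (m + n) := by
        rw [← neg_sub, hmn, neg_smul, neg_neg]
        push_cast
        rfl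
      have j2 : (((m : ℂ) - n) • L (m + n) + s m n • (1 : R)) * L 0
          - L 0 * (((m : ℂ) - n) • L (m + n) + s m n • (1 : R))
          = ((m : ℂ) - n) • (L (m + n) * L 0 - L 0 * L (m + n)) := by
        simp only [add_mul, mul_add, smul_mul_assoc, mul_smul_comm, one_mul, mul_one]
        module
      rw [j2, hmn'] at j1
      linear_combination (norm := module) -j1
    have hc : ((m : ℂ) + n) ≠ 0 := by exact_mod_cast hmn
    rw [smul_smul] at e
    exact (mul_eq_zero.1 (hinj _ e)).resolve_left hc
  have hanti : ∀ m n, s m n = -s n m := fun m n => by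
    have e : (s m n + s n m) • (1 : R) = 0 := by
      have k1 := hs m n
      have k2 := hs n m
      rw [add_comm n m] at k2
      linear_combination (norm := module) -k1 - k2
    exact eq_neg_of_add_eq_zero_left (hinj _ e)
  -- This is the Jacobi identity for L_m, L_1 and L_{-(m+1)}.
  have hrec : ∀ m : ℤ, ((m : ℂ) - 1) * s (m + 1) (-(m + 1))
      = (m + 2) * s m (-m) - (2 * m + 1) * s 1 (-1) := fun m => by
    have e : (((m : ℂ) + 2) * s m (-m) - (2 * m + 1) * s 1 (-1)
        - ((m : ℂ) - 1) * s (m + 1) (-(m + 1))) • (1 : R) = 0 := by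
      have j := commutator_commutator (L m) (L 1) (L (-(m + 1)))
      have k1 := hs m 1
      have k2 := hs 1 (-(m + 1))
      have k3 := hs m (-(m + 1))
      have k4 := hs (m + 1) (-(m + 1))
      have k5 := hs m (-m)
      have k6 := hs 1 (-1)
      have e1 : 1 + -(m + 1) = -m := by ring
      have e2 : m + -(m + 1) = -1 := by ring
      simp only [e1, e2, add_neg_cancel] at k2 k3 k4 k5 k6
      push_cast at k1 k2 k3 k4 k5 k6
      rw [k1, k2, k3] at j
      have j' : ((m : ℂ) - 1) • (L (m + 1) * L (-(m + 1)) - L (-(m + 1)) * L (m + 1))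
          = (1 - (-((m : ℂ) + 1))) • (L m * L (-m) - L (-m) * L m)
          - ((m : ℂ) - (-(m + 1))) • (L 1 * L (-1) - L (-1) * L 1) := by
        simp only [add_mul, mul_add, smul_mul_assoc, mul_smul_comm, one_mul, mul_one] at j
        linear_combination (norm := module) j
      rw [k4, k5, k6] at j'
      linear_combination (norm := module) -j'
    linear_combination -(hinj _ e)
  -- At `m = 1` the factor `m - 1` in the recursion vanishes, so `s(2, -2)` is a second free initial
  -- value and the recursion is started at 2. Both `m³` and `m` solve it.
  have hnat : ∀ k : ℕ, s (k + 2) (-(k + 2)) = x * ((k : ℂ) + 2) ^ 3 + y * (k + 2) := fun k => by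
    induction k with
    | zero => norm_num at h2 ⊢; linear_combination h2
    | succ k ih =>
      have r := hrec (k + 2)
      have hk : ((k : ℂ) + 1) ≠ 0 := by exact_mod_cast k.succ_ne_zero
      push_cast at r ⊢
      have e : (k : ℤ) + 1 + 2 = k + 2 + 1 := by ring
      rw [e]
      apply mul_left_cancel₀ hk
      linear_combination r + (k + 4) * ih - (2 * (k + 2) + 1) * h1
  have hpos : ∀ m : ℤ, 0 < m → s m (-m) = x * (m : ℂ) ^ 3 + y * m := fun m hm => by
    rcases eq_or_lt_of_le (Int.add_one_le_of_lt hm) with h | h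
    · obtain rfl : m = 1 := by omega
      rw [h1]
      push_cast
      ring
    · obtain ⟨k, rfl⟩ : ∃ k : ℕ, m = k + 2 := ⟨(m - 2).toNat, by omega⟩
      rw [hnat]
      push_cast
      ring
  rw [hs]
  congr 2
  split_ifs with h
  · obtain rfl : n = -m := by omega
    rcases lt_trichotomy m 0 with hm | rfl | hm
    · rw [hanti]
      have := hpos (-m) (by omega)
      rw [neg_neg] at this
      rw [this]
      push_cast
      ring
    · have := hanti 0 0
      simp only [neg_zero, Int.cast_zero]
      linear_combination this / 2
    · exact hpos m hm
  · exact hne m n h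

/-! ### Fock spaces -/

/-- The letters labelling the creation operators of a string with oscillator directions `ι`. -/
abbrev Letter (ι : Type*) := (ι × ℕ+) ⊕ (ℕ ⊕ ℕ+)

/-- The creation operators `f i (-k)`, `c (-k)`, `b (-k)`. -/
def creator {ι V : Type*} [AddCommGroup V] [Module ℂ V] (f : ι → ℤ → Module.End ℂ V)
    (c b : ℤ → Module.End ℂ V) : Letter ι → Module.End ℂ V
  | Sum.inl (i, k) => f i (-(k : ℤ))
  | Sum.inr (Sum.inl k) => c (-(k : ℤ))
  | Sum.inr (Sum.inr k) => b (-(k : ℤ))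

/-- A Fock space of matter and ghost modes, together with the parameters of the constraints. -/
structure Fock (ι : Type*) [Fintype ι] [DecidableEq ι] (V : Type*) [AddCommGroup V] [Module ℂ V]
    extends GhostModes V where
  a : ι → ℤ → Module.End ℂ V
  metric : ι → ℂ
  zero : ι → ℂ
  vac : V
  liouville : ι
  slope : ℂ
  shift : ℂ
  intercept : ℂ
  metric_mul_self : ∀ i, metric i * metric i = 1
  a_zero : ∀ i, a i 0 = zero i • 1
  a_comm : ∀ i j m n, a i m * a j n - a j n * a i m
    = if i = j ∧ m + n = 0 then ((m : ℂ) * metric i) • 1 else 0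
  a_comm_c : ∀ i m n, a i m * c n = c n * a i m
  a_comm_b : ∀ i m n, a i m * b n = b n * a i m
  matter_bound : ∀ v, ∃ N : ℤ, 0 < N ∧ ∀ n, N ≤ n → ∀ i, a i n v = 0
  vac_ne_zero : vac ≠ 0
  a_vac : ∀ i n, 0 < n → a i n vac = 0
  c_vac : ∀ n, 0 < n → c n vac = 0
  b_vac : ∀ n, 0 ≤ n → b n vac = 0
  cyclic : ∀ S : Submodule ℂ V, vac ∈ S → (∀ x, ∀ v ∈ S, creator a c b x v ∈ S) → S = ⊤
  metric_liouville : metric liouville = 1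
  zero_liouville : zero liouville = 0
  slope_sq : slope ^ 2 = -2 * shift

/-! ### The matter constraints and their commutators with single modes -/

namespace Fock

variable {ι : Type*} [Fintype ι] [DecidableEq ι] {V : Type*} [AddCommGroup V] [Module ℂ V]
  (X : Fock ι V)

/-- The normally ordered product of two matter modes. -/
def matterNormal (i : ι) (m n : ℤ) : Module.End ℂ V :=
  if m ≤ n then X.a i m * X.a i n else X.a i n * X.a i m

/-- The matter constraints. -/
def L (m : ℤ) : Module.End ℂ V :=
  (1 / 2 : ℂ) • ∑ i, X.metric i • opSum (fun k : ℤ => X.matterNormal i (m + k) (-k))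
    + (X.slope * m) • X.a X.liouville m + (if m = 0 then X.shift else 0) • 1

theorem matterNormal_eq (i : ι) (m n : ℤ) :
    ∃ s : ℂ, X.matterNormal i m n = X.a i m * X.a i n - s • 1 := by
  unfold matterNormal
  have h := X.a_comm i i m n
  simp only [true_and] at h
  split_ifs with h0
  · exact ⟨0, by simp⟩
  · refine ⟨if m + n = 0 then m * X.metric i else 0, ?_⟩
    rw [ite_smul, zero_smul, ← h]
    abel

theorem matterNormal_comm_a (i j : ι) (m n k : ℤ) :
    X.matterNormal i m n * X.a j k - X.a j k * X.matterNormal i m n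
      = (if i = j ∧ n + k = 0 then ((n : ℂ) * X.metric i) • X.a i m else 0)
        + if i = j ∧ m + k = 0 then ((m : ℂ) * X.metric i) • X.a i n else 0 := by
  obtain ⟨s, hs⟩ := X.matterNormal_eq i m n
  have e1 : (if i = j ∧ n + k = 0 then ((n : ℂ) * X.metric i) • X.a i m else 0)
      = X.a i m * (if i = j ∧ n + k = 0 then ((n : ℂ) * X.metric i) • 1 else 0) := by
    split_ifs <;> simp
  have e2 : (if i = j ∧ m + k = 0 then ((m : ℂ) * X.metric i) • X.a i n else 0)
      = (if i = j ∧ m + k = 0 then ((m : ℂ) * X.metric i) • 1 else 0) * X.a i n := by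
    split_ifs <;> simp
  rw [e1, e2, ← X.a_comm, ← X.a_comm, hs]
  simp only [sub_mul, mul_sub, smul_mul_assoc, mul_smul_comm, one_mul, mul_one, mul_assoc]
  abel

theorem locFin_matterNormal (i : ι) (m : ℤ) :
    LocFin fun k : ℤ => X.matterNormal i (m + k) (-k) := by
  refine .of_int_bound fun v => ?_
  obtain ⟨N, h0, hN⟩ := X.matter_bound v
  refine ⟨N + |m|, fun k hk => ?_⟩
  have hm := neg_abs_le m
  have hm' := abs_nonneg m
  unfold matterNormal
  split_ifs with h1 <;> rw [Module.End.mul_apply, hN _ (by omega), map_zero]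

/-- Exactly two summands contain the mode paired with a_n, namely `k = n` and `k = -m - n`. They
contribute equally, which gives the 2 that cancels the factor 1/2 in L_m. -/
theorem quadratic_comm_a (i j : ι) (m n : ℤ) :
    opSum (fun k : ℤ => X.matterNormal i (m + k) (-k)) * X.a j n
      - X.a j n * opSum (fun k : ℤ => X.matterNormal i (m + k) (-k))
      = if i = j then (-2 * (n : ℂ) * X.metric i) • X.a i (m + n) else 0 := by
  rw [opSum_commutator (X.locFin_matterNormal i m)]
  simp only [matterNormal_comm_a]
  rw [opSum_add (.of_eq_zero {n} fun k hk => ?_) (.of_eq_zero {-m - n} fun k hk => ?_),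
    opSum_eq_single n fun k hk => ?_, opSum_eq_single (-m - n) fun k hk => ?_]
  · have e : -(-m - n) = m + n := by ring
    have e' : m + (-m - n) = -n := by ring
    rw [e, e']
    by_cases hij : i = j
    · rw [if_pos ⟨hij, by omega⟩, if_pos hij]
      push_cast
      module
    · rw [if_neg fun h => hij h.1, if_neg hij, add_zero]
  · rw [if_neg]; rintro ⟨-, h⟩; exact hk (by omega)
  · rw [if_neg]; rintro ⟨-, h⟩; exact hk (by omega)
  · rw [if_neg]; rintro ⟨-, h⟩; exact hk (by simp; omega)
  · rw [if_neg]; rintro ⟨-, h⟩; exact hk (by simp; omega)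

theorem L_comm_a (m : ℤ) (j : ι) (n : ℤ) :
    X.L m * X.a j n - X.a j n * X.L m = (-(n : ℂ)) • X.a j (m + n)
      + (if j = X.liouville ∧ m + n = 0 then X.slope * (m : ℂ) ^ 2 else 0) • 1 := by
  have h : X.L m * X.a j n - X.a j n * X.L m
      = (1 / 2 : ℂ) • ∑ i, X.metric i • (opSum (fun k : ℤ => X.matterNormal i (m + k) (-k)) * X.a j n
        - X.a j n * opSum (fun k : ℤ => X.matterNormal i (m + k) (-k)))
        + (X.slope * m) • (X.a X.liouville m * X.a j n - X.a j n * X.a X.liouville m) := by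
    simp only [L, add_mul, mul_add, smul_mul_assoc, mul_smul_comm, one_mul, mul_one,
      Finset.sum_mul, Finset.mul_sum, smul_sub, Finset.sum_sub_distrib]
    abel
  rw [h, X.a_comm]
  simp only [quadratic_comm_a]
  congr 1
  · rw [Finset.sum_eq_single j (fun i _ hi => by rw [if_neg hi, smul_zero]) (by simp), if_pos rfl,
      smul_smul, smul_smul]
    congr 1
    linear_combination (-(n : ℂ)) * X.metric_mul_self j
  · by_cases h1 : X.liouville = j ∧ m + n = 0
    · rw [if_pos h1, if_pos ⟨h1.1.symm, h1.2⟩, X.metric_liouville, smul_smul]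
      congr 1
      ring
    · rw [if_neg h1, if_neg fun h => h1 ⟨h.1.symm, h.2⟩, smul_zero, zero_smul]

theorem opSum_commute {κ W : Type*} [AddCommGroup W] [Module ℂ W] {T : κ → Module.End ℂ W}
    (hT : LocFin T) {Y : Module.End ℂ W} (h : ∀ k, T k * Y = Y * T k) :
    opSum T * Y = Y * opSum T := by
  rw [opSum_mul hT, mul_opSum hT]
  simp only [h]

theorem L_commute {Y : Module.End ℂ V} (h : ∀ i n, X.a i n * Y = Y * X.a i n) (m : ℤ) :
    X.L m * Y = Y * X.L m := by
  have hN : ∀ i m n, X.matterNormal i m n * Y = Y * X.matterNormal i m n := fun i m n => by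
    unfold matterNormal
    split_ifs <;> rw [mul_assoc, h, ← mul_assoc, h, mul_assoc]
  simp only [L, add_mul, mul_add, smul_mul_assoc, mul_smul_comm, one_mul, mul_one,
    Finset.sum_mul, Finset.mul_sum, opSum_commute (X.locFin_matterNormal _ m) fun k => hN _ _ _, h]

theorem L_comm_c (m n : ℤ) : X.L m * X.c n = X.c n * X.L m :=
  X.L_commute (fun i k => X.a_comm_c i k n) m

theorem L_comm_b (m n : ℤ) : X.L m * X.b n = X.b n * X.L m :=
  X.L_commute (fun i k => X.a_comm_b i k n) m

theorem normal_comm_a (m n : ℤ) (i : ι) (k : ℤ) :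
    X.normal m n * X.a i k = X.a i k * X.normal m n := by
  obtain ⟨s, hs⟩ := X.normal_eq m n
  rw [hs]
  have h1 := X.a_comm_c i k m
  have h2 := X.a_comm_b i k n
  simp only [sub_mul, mul_sub, smul_mul_assoc, mul_smul_comm, one_mul, mul_one, mul_assoc, ← h2]
  simp only [← mul_assoc, h1]

theorem ghostVir_comm_a (m : ℤ) (i : ι) (k : ℤ) :
    X.ghostVir m * X.a i k = X.a i k * X.ghostVir m :=
  opSum_commute (X.locFin_ghostVir m) fun j => by
    rw [smul_mul_assoc, mul_smul_comm, normal_comm_a]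

theorem L_comm_ghostVir (m n : ℤ) : X.L m * X.ghostVir n = X.ghostVir n * X.L m :=
  X.L_commute (fun i k => (X.ghostVir_comm_a n i k).symm) m

theorem L_bound (v : V) : ∃ N : ℤ, 0 < N ∧ ∀ m, N ≤ m → X.L m v = 0 := by
  obtain ⟨N, h0, hN⟩ := X.matter_bound v
  refine ⟨2 * N, by omega, fun m hm => ?_⟩
  have h : ∀ i, opSum (fun k : ℤ => X.matterNormal i (m + k) (-k)) v = 0 := fun i =>
    opSum_apply_eq_zero fun k => by
      unfold matterNormal
      split_ifs <;> rw [Module.End.mul_apply, hN _ (by omega), map_zero]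
  simp only [L, LinearMap.add_apply, LinearMap.smul_apply, LinearMap.sum_apply, h]
  rw [hN m (by omega), if_neg (by omega)]
  simp

theorem L_pos_of_killed {v : V} (hv : ∀ i n, 0 < n → X.a i n v = 0) {m : ℤ} (hm : 0 < m) :
    X.L m v = 0 := by
  have h : ∀ i, opSum (fun k : ℤ => X.matterNormal i (m + k) (-k)) v = 0 := fun i =>
    opSum_apply_eq_zero fun k => by
      unfold matterNormal
      split_ifs <;> rw [Module.End.mul_apply, hv _ _ (by omega), map_zero]
  simp only [L, LinearMap.add_apply, LinearMap.smul_apply, LinearMap.sum_apply, h]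
  rw [hv _ m hm, if_neg (by omega)]
  simp

/-- The conformal weight of the matter vacuum. -/
def weight : ℂ := (1 / 2 : ℂ) * ∑ i, X.metric i * X.zero i ^ 2 + X.shift

theorem L_zero_of_killed {v : V} (hv : ∀ i n, 0 < n → X.a i n v = 0) :
    X.L 0 v = X.weight • v := by
  have h : ∀ i, opSum (fun k : ℤ => X.matterNormal i (0 + k) (-k)) v = X.zero i ^ 2 • v := fun i => by
    rw [opSum_apply_eq_single (X.locFin_matterNormal i 0) 0 fun k hk => ?_]
    · simp [matterNormal, a_zero, smul_smul, sq]
    · unfold matterNormal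
      split_ifs <;> rw [Module.End.mul_apply, hv _ _ (by omega), map_zero]
  simp only [L, LinearMap.add_apply, LinearMap.smul_apply, LinearMap.sum_apply, h]
  simp only [weight, Int.cast_zero, mul_zero, zero_smul, add_zero, if_true, Module.End.one_apply,
    add_smul, mul_smul, Finset.sum_smul]

theorem L_zero_comm_matterNormal (i : ι) (m n : ℤ) :
    X.L 0 * X.matterNormal i m n - X.matterNormal i m n * X.L 0
      = (-((m : ℂ) + n)) • X.matterNormal i m n := by
  have h : ∀ n, X.L 0 * X.a i n - X.a i n * X.L 0 = (-(n : ℂ)) • X.a i n := fun n => by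
    rw [L_comm_a]
    simp
  have hprod : ∀ m n, X.L 0 * (X.a i m * X.a i n) - X.a i m * X.a i n * X.L 0
      = (-((m : ℂ) + n)) • (X.a i m * X.a i n) := fun m n => by
    have : X.L 0 * (X.a i m * X.a i n) - X.a i m * X.a i n * X.L 0
        = (X.L 0 * X.a i m - X.a i m * X.L 0) * X.a i n
          + X.a i m * (X.L 0 * X.a i n - X.a i n * X.L 0) := by noncomm_ring
    rw [this, h, h, smul_mul_assoc, mul_smul_comm]
    module
  unfold matterNormal
  split_ifs
  · exact hprod m n
  · rw [hprod n m, add_comm (n : ℂ)]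

/-- Every normally ordered product in L_m is homogeneous of degree `m` for L_0. This case is needed
in advance, because the normal form of the Virasoro cocycle presupposes that none occurs against
L_0. -/
theorem L_zero_comm_L (m : ℤ) : X.L 0 * X.L m - X.L m * X.L 0 = (-(m : ℂ)) • X.L m := by
  have hq : ∀ i, X.L 0 * opSum (fun k : ℤ => X.matterNormal i (m + k) (-k))
      - opSum (fun k : ℤ => X.matterNormal i (m + k) (-k)) * X.L 0
      = (-(m : ℂ)) • opSum (fun k : ℤ => X.matterNormal i (m + k) (-k)) := fun i => by
    have hl := X.locFin_matterNormal i m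
    rw [smul_opSum hl, mul_opSum hl, opSum_mul hl, ← opSum_sub (hl.comp_left _) (hl.comp_right _)]
    congr 1
    funext k
    rw [L_zero_comm_matterNormal]
    push_cast
    congr 1
    ring
  have hl : X.L 0 * X.a X.liouville m - X.a X.liouville m * X.L 0
      = (-(m : ℂ)) • X.a X.liouville m := by
    rw [L_comm_a]
    simp
  -- L_0 is made opaque so that unfolding `L` affects L_m only.
  generalize hL0 : X.L 0 = Z at hq hl ⊢
  have : Z * X.L m - X.L m * Z
      = (1 / 2 : ℂ) • ∑ i, X.metric i • (Z * opSum (fun k : ℤ => X.matterNormal i (m + k) (-k))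
        - opSum (fun k : ℤ => X.matterNormal i (m + k) (-k)) * Z)
        + (X.slope * m) • (Z * X.a X.liouville m - X.a X.liouville m * Z) := by
    simp only [L, add_mul, mul_add, smul_mul_assoc, mul_smul_comm, one_mul, mul_one,
      Finset.sum_mul, Finset.mul_sum, smul_sub, Finset.sum_sub_distrib]
    abel
  rw [this, hl]
  simp only [hq]
  have hm : (-(m : ℂ)) • ((if m = 0 then X.shift else 0) • (1 : Module.End ℂ V)) = 0 := by
    split_ifs with h <;> simp [h]
  rw [L, smul_add, hm, smul_add, add_zero]
  congr 1
  · simp only [Finset.smul_sum]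
    exact Finset.sum_congr rfl fun i _ => by module
  · module

end Fock

namespace Fock

variable {ι : Type*} [Fintype ι] [DecidableEq ι] {V : Type*} [AddCommGroup V] [Module ℂ V]
  (X : Fock ι V)

/-! ### Words and the level -/

/-- The vector obtained from the vacuum by applying a list of creation operators. -/
abbrev fockWord : List (Letter ι) → V := word (creator X.a X.c X.b) X.vac

theorem span_fockWord : Submodule.span ℂ (Set.range X.fockWord) = ⊤ :=
  span_word_eq_top X.cyclic

/-- The total level, in which the zero mode `c_0` is given the weight one. -/
def level : Module.End ℂ V := X.L 0 + X.ghostVir 0 + X.c 0 * X.b 0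

/-- The weight of a creation operator with respect to `Fock.level`. -/
def letterLevel : Letter ι → ℕ
  | Sum.inl (_, k) => k
  | Sum.inr (Sum.inl k) => if k = 0 then 1 else k
  | Sum.inr (Sum.inr k) => k

theorem level_comm_creator (x : Letter ι) :
    X.level * creator X.a X.c X.b x - creator X.a X.c X.b x * X.level
      = (letterLevel x : ℂ) • creator X.a X.c X.b x := by
  have key : ∀ Y : Module.End ℂ V, X.level * Y - Y * X.level = (X.L 0 * Y - Y * X.L 0)
      + (X.ghostVir 0 * Y - Y * X.ghostVir 0) + (X.c 0 * X.b 0 * Y - Y * (X.c 0 * X.b 0)) := by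
    intro Y
    simp only [level, add_mul, mul_add]
    abel
  rw [key]
  rcases x with ⟨i, k⟩ | k | k
  · simp only [creator, letterLevel, X.L_comm_a, X.ghostVir_comm_a, sub_self,
      mul_assoc, ← X.a_comm_b, zero_add]
    rw [← mul_assoc, ← X.a_comm_c, mul_assoc, sub_self]
    simp
  · simp only [creator, letterLevel, X.L_comm_c, sub_self, X.ghostVir_comm_c, X.cb_comm_c, zero_add]
    rcases Nat.eq_zero_or_pos k with rfl | hk
    · simp
    · rw [if_neg (by omega), if_neg (by omega)]
      simp
  · have := k.pos
    simp only [creator, letterLevel, X.L_comm_b, sub_self, X.ghostVir_comm_b, X.cb_comm_b, zero_add]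
    rw [if_neg (by omega)]
    simp

/-- A vector killed by all the annihilation operators. -/
def IsVac (v : V) : Prop :=
  (∀ i n, 0 < n → X.a i n v = 0) ∧ (∀ n, 0 < n → X.c n v = 0) ∧ ∀ n, 0 ≤ n → X.b n v = 0

theorem isVac_vac : X.IsVac X.vac := ⟨X.a_vac, X.c_vac, X.b_vac⟩

theorem level_of_isVac {v : V} (hv : X.IsVac v) : X.level v = X.weight • v := by
  simp only [level, LinearMap.add_apply, Module.End.mul_apply, X.L_zero_of_killed hv.1,
    X.ghostVir_vac hv.2.1 hv.2.2 le_rfl, hv.2.2 0 le_rfl, map_zero, add_zero]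

theorem level_fockWord (l : List (Letter ι)) :
    X.level (X.fockWord l) = (X.weight + ((l.map letterLevel).sum : ℕ)) • X.fockWord l := by
  rw [word_eigen (X.level_of_isVac X.isVac_vac) X.level_comm_creator, Nat.cast_list_sum,
    List.map_map]
  rfl

/-- This is the reason for giving c_0 the weight one: with weight zero, arbitrarily many letters c_0
could be inserted in a word without changing its level. -/
theorem letterLevel_pos (x : Letter ι) : 0 < letterLevel x := by
  rcases x with ⟨i, k⟩ | k | k
  · exact k.pos
  · change 0 < if k = 0 then 1 else k
    split_ifs <;> omega
  · exact k.pos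

theorem finite_letterLevel_le (n : ℕ) : {x : Letter ι | letterLevel x ≤ n}.Finite := by
  have h1 : {k : ℕ+ | (k : ℕ) ≤ n}.Finite :=
    Set.Finite.of_finite_image (f := fun k : ℕ+ => (k : ℕ))
      ((Set.finite_Iic n).subset (by rintro _ ⟨k, hk, rfl⟩; exact hk))
      (fun _ _ _ _ h => PNat.coe_injective h)
  have h2 : {x : Letter ι | letterLevel x ≤ n} ⊆
      Sum.inl '' ((Set.univ : Set ι) ×ˢ {k : ℕ+ | (k : ℕ) ≤ n}) ∪
      (Sum.inr '' (Sum.inl '' Set.Iic n) ∪ Sum.inr '' (Sum.inr '' {k : ℕ+ | (k : ℕ) ≤ n})) := by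
    rintro (⟨i, k⟩ | k | k) hx
    · exact Or.inl ⟨(i, k), ⟨trivial, hx⟩, rfl⟩
    · refine Or.inr (Or.inl ⟨_, ⟨k, ?_, rfl⟩, rfl⟩)
      simp only [letterLevel, Set.mem_ofPred_eq] at hx
      simp only [Set.mem_Iic]
      split_ifs at hx <;> omega
    · exact Or.inr (Or.inr ⟨_, ⟨k, hx, rfl⟩, rfl⟩)
  refine Set.Finite.subset ?_ h2
  exact ((Set.finite_univ.prod h1).image _).union
    ((((Set.finite_Iic n).image _).image _).union ((h1.image _).image _))

/-- Such a vector has the level of the vacuum, and as all letters have positive level the empty word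
is the only word of that level. -/
theorem eq_smul_vac {v : V} (hv : X.IsVac v) : ∃ s : ℂ, v = s • X.vac := by
  have h := mem_span_of_eigen X.span_fockWord X.level_fockWord (X.level_of_isVac hv)
  have : X.fockWord '' {l | X.weight + (((l.map letterLevel).sum : ℕ) : ℂ) = X.weight}
      ⊆ {X.vac} := by
    rintro _ ⟨l, hl, rfl⟩
    have h0 : (l.map letterLevel).sum = 0 := by
      have hl' : X.weight + (((l.map letterLevel).sum : ℕ) : ℂ) = X.weight := hl
      exact Nat.cast_eq_zero.1 (add_eq_left.1 hl')
    cases l with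
    | nil => simp
    | cons x l =>
      have := letterLevel_pos x
      simp only [List.map_cons, List.sum_cons] at h0
      omega
  obtain ⟨s, hs⟩ := Submodule.mem_span_singleton.1 (Submodule.span_mono this h)
  exact ⟨s, hs.symm⟩

/-- Finitely many words have a given level. This makes the mass-shell spaces finite-dimensional, so
that injectivity of the Laplacian implies surjectivity. -/
theorem finiteDimensional_eigenspace_level (μ : ℂ) :
    FiniteDimensional ℂ (Module.End.eigenspace X.level μ) := by
  have hfin : (X.fockWord '' {l | X.weight + (((l.map letterLevel).sum : ℕ) : ℂ) = μ}).Finite := by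
    refine Set.Finite.image _ ?_
    by_cases hμ : ∃ n : ℕ, X.weight + n = μ
    · obtain ⟨n, rfl⟩ := hμ
      refine (list_finite_of_sum_eq letterLevel letterLevel_pos finite_letterLevel_le n).subset ?_
      intro l hl
      simpa [-Nat.cast_list_sum] using hl
    · convert Set.finite_empty
      exact Set.eq_empty_of_forall_notMem fun l hl => hμ ⟨_, hl⟩
  have := FiniteDimensional.span_of_finite ℂ hfin
  exact Submodule.finiteDimensional_of_le fun v hv =>
    mem_span_of_eigen X.span_fockWord X.level_fockWord (Module.End.mem_eigenspace_iff.1 hv)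

/-- Schur's lemma for a cyclic module: the image of the vacuum is again killed by all annihilators,
hence is a multiple of the vacuum, and the same multiple then occurs on every word. -/
theorem eq_smul_one {Y : Module.End ℂ V} (ha : ∀ i n, Y * X.a i n = X.a i n * Y)
    (hc : ∀ n, Y * X.c n = X.c n * Y) (hb : ∀ n, Y * X.b n = X.b n * Y) :
    ∃ s : ℂ, Y = s • 1 := by
  have key : ∀ Z : Module.End ℂ V, Y * Z = Z * Y → ∀ v, Z (Y v) = Y (Z v) := fun Z hZ v =>
    (congrArg (fun W : Module.End ℂ V => W v) hZ).symm
  obtain ⟨s, hs⟩ := X.eq_smul_vac (v := Y X.vac)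
    ⟨fun i n hn => by rw [key _ (ha i n), X.a_vac i n hn, map_zero],
      fun n hn => by rw [key _ (hc n), X.c_vac n hn, map_zero],
      fun n hn => by rw [key _ (hb n), X.b_vac n hn, map_zero]⟩
  refine ⟨s, LinearMap.ext_on X.span_fockWord ?_⟩
  rintro _ ⟨l, rfl⟩
  induction l with
  | nil => simpa using hs
  | cons x l ih =>
    have hx : Y * creator X.a X.c X.b x = creator X.a X.c X.b x * Y := by
      rcases x with ⟨i, k⟩ | k | k
      exacts [ha _ _, hc _, hb _]
    simp only [fockWord, word_cons] at ih ⊢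
    rw [← key _ hx, ih]
    simp

/-! ### The Virasoro algebra -/

/-- The Jacobi identity shows that [L_m, L_n] and (m - n) L_{m+n} have the same commutator with each
matter mode; the scalar terms coming from the Liouville slope agree as well. -/
theorem L_commutator_comm_a (m n : ℤ) (i : ι) (k : ℤ) :
    (X.L m * X.L n - X.L n * X.L m - ((m : ℂ) - n) • X.L (m + n)) * X.a i k
      = X.a i k * (X.L m * X.L n - X.L n * X.L m - ((m : ℂ) - n) • X.L (m + n)) := by
  have j := commutator_commutator (X.L m) (X.L n) (X.a i k)
  have e := X.L_comm_a (m + n) i k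
  have hsc : ∀ (Y : Module.End ℂ V) (z w : ℂ) (A : Module.End ℂ V),
      Y * (z • A + w • 1) - (z • A + w • 1) * Y = z • (Y * A - A * Y) := fun Y z w A => by
    simp only [add_mul, mul_add, smul_mul_assoc, mul_smul_comm, one_mul, mul_one]
    module
  rw [X.L_comm_a, X.L_comm_a, hsc, hsc, X.L_comm_a, X.L_comm_a] at j
  have e1 : n + (m + k) = m + n + k := by ring
  have e2 : m + (n + k) = m + n + k := by ring
  rw [e1, e2] at j
  have hgoal : (X.L m * X.L n - X.L n * X.L m - ((m : ℂ) - n) • X.L (m + n)) * X.a i k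
      - X.a i k * (X.L m * X.L n - X.L n * X.L m - ((m : ℂ) - n) • X.L (m + n))
      = ((X.L m * X.L n - X.L n * X.L m) * X.a i k - X.a i k * (X.L m * X.L n - X.L n * X.L m))
        - ((m : ℂ) - n) • (X.L (m + n) * X.a i k - X.a i k * X.L (m + n)) := by
    simp only [sub_mul, mul_sub, smul_mul_assoc, mul_smul_comm]
    module
  rw [← sub_eq_zero, hgoal, j, e]
  push_cast
  by_cases h : i = X.liouville ∧ m + n + k = 0
  · rw [if_pos h, if_pos h, if_pos h]
    have hk : (k : ℂ) = -((m : ℂ) + n) := by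
      have : (m : ℂ) + n + k = 0 := by exact_mod_cast h.2
      linear_combination this
    rw [hk]
    module
  · rw [if_neg h, if_neg h, if_neg h]
    module

theorem exists_L_scalar (m n : ℤ) : ∃ s : ℂ,
    X.L m * X.L n - X.L n * X.L m = ((m : ℂ) - n) • X.L (m + n) + s • (1 : Module.End ℂ V) := by
  have hcomm : ∀ Y : Module.End ℂ V, (∀ k, X.L k * Y = Y * X.L k) →
      (X.L m * X.L n - X.L n * X.L m - ((m : ℂ) - n) • X.L (m + n)) * Y
      = Y * (X.L m * X.L n - X.L n * X.L m - ((m : ℂ) - n) • X.L (m + n)) := fun Y hY => by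
    simp only [sub_mul, mul_sub, smul_mul_assoc, mul_smul_comm, mul_assoc, hY]
    simp only [← mul_assoc, hY]
  obtain ⟨s, hs⟩ := X.eq_smul_one (X.L_commutator_comm_a m n)
    (fun k => hcomm _ fun j => X.L_comm_c j k) (fun k => hcomm _ fun j => X.L_comm_b j k)
  exact ⟨s, by rw [← hs]; abel⟩

theorem apply_of_commutator {A B C : Module.End ℂ V} (h : A * B - B * A = C) (v : V) :
    A (B v) = B (A v) + C v := by
  rw [← h]
  simp

theorem apply_of_anticommutator {A B C : Module.End ℂ V} (h : A * B + B * A = C) (v : V) :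
    A (B v) = C v - B (A v) := by
  rw [← h]
  simp

theorem L_a_vac {m : ℤ} (hm : 0 < m) (i : ι) (n : ℤ) :
    X.L m (X.a i n X.vac) = (-(n : ℂ)) • X.a i (m + n) X.vac
      + (if i = X.liouville ∧ m + n = 0 then X.slope * (m : ℂ) ^ 2 else 0) • X.vac := by
  rw [apply_of_commutator (X.L_comm_a m i n), X.L_pos_of_killed X.a_vac hm, map_zero, zero_add,
    LinearMap.add_apply, LinearMap.smul_apply, LinearMap.smul_apply, Module.End.one_apply]

theorem a_a_vac (i : ι) {n : ℤ} (hn : 0 < n) :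
    X.a i n (X.a i (-n) X.vac) = ((n : ℂ) * X.metric i) • X.vac := by
  rw [apply_of_commutator (X.a_comm i i n (-n)), X.a_vac i n hn]
  simp

theorem quadratic_vac_eq_zero (i : ι) {m k : ℤ} (h : 0 < m + k ∨ 0 < -k) :
    X.matterNormal i (m + k) (-k) X.vac = 0 := by
  unfold matterNormal
  split_ifs <;> rw [Module.End.mul_apply, X.a_vac _ _ (by omega), map_zero]

theorem L_neg_one_vac : X.L (-1) X.vac
    = ∑ i, (X.metric i * X.zero i) • X.a i (-1) X.vac - X.slope • X.a X.liouville (-1) X.vac := by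
  have h : ∀ i, opSum (fun k : ℤ => X.matterNormal i (-1 + k) (-k)) X.vac
      = (2 * X.zero i) • X.a i (-1) X.vac := fun i => by
    rw [opSum_apply_eq_sum (X.locFin_matterNormal i (-1)) {0, 1} fun k hk =>
      X.quadratic_vac_eq_zero i (by simp at hk; omega), Finset.sum_pair (by decide)]
    simp only [matterNormal]
    norm_num [X.a_zero]
    module
  simp only [L, LinearMap.add_apply, LinearMap.smul_apply, LinearMap.sum_apply, h]
  rw [if_neg (by decide), zero_smul, add_zero, Finset.smul_sum, sub_eq_add_neg]
  congr 1
  · exact Finset.sum_congr rfl fun i _ => by module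
  · push_cast; module

theorem L_neg_two_vac : X.L (-2) X.vac
    = ∑ i, ((X.metric i * X.zero i) • X.a i (-2) X.vac
        + (X.metric i / 2) • X.a i (-1) (X.a i (-1) X.vac))
      - (2 * X.slope) • X.a X.liouville (-2) X.vac := by
  have h : ∀ i, opSum (fun k : ℤ => X.matterNormal i (-2 + k) (-k)) X.vac
      = (2 * X.zero i) • X.a i (-2) X.vac + X.a i (-1) (X.a i (-1) X.vac) := fun i => by
    rw [opSum_apply_eq_sum (X.locFin_matterNormal i (-2)) {0, 1, 2} fun k hk =>
      X.quadratic_vac_eq_zero i (by simp at hk; omega), Finset.sum_insert (by decide),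
      Finset.sum_pair (by decide)]
    simp only [matterNormal]
    norm_num [X.a_zero]
    module
  simp only [L, LinearMap.add_apply, LinearMap.smul_apply, LinearMap.sum_apply, h]
  rw [if_neg (by decide), zero_smul, add_zero, Finset.smul_sum, sub_eq_add_neg]
  congr 1
  · exact Finset.sum_congr rfl fun i _ => by module
  · push_cast; module

/-- The central charge of the matter sector. -/
def charge : ℂ := Fintype.card ι + 24 * X.shift

theorem L_comm_L (m n : ℤ) : X.L m * X.L n - X.L n * X.L m
    = ((m : ℂ) - n) • X.L (m + n)
      + (if m + n = 0 then X.charge / 12 * (m : ℂ) ^ 3 + -(X.charge / 12) * m else 0) • 1 := by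
  have : Nontrivial (Module.End ℂ V) :=
    ⟨1, 0, fun h => X.vac_ne_zero (congrArg (fun Y : Module.End ℂ V => Y X.vac) h)⟩
  choose s hs using X.exists_L_scalar
  have hinj := smul_left_injective ℂ X.vac_ne_zero
  have hz : ∑ i, X.metric i * X.zero i
      * (if i = X.liouville then X.slope else 0) = 0 := by
    simp [X.zero_liouville]
  -- The commutators for `(1, -1)` and `(2, -2)` are evaluated on the vacuum. By `slope_sq` the
  -- shift cancels in the first, so `s(1, -1) = 0`, and the second gives `s(2, -2) = charge / 2`.
  refine virasoro_of_scalar s hs X.L_zero_comm_L ?_ ?_ m n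
  · have h := congrArg (fun Y : Module.End ℂ V => Y X.vac) (hs 1 (-1))
    simp only [LinearMap.sub_apply, LinearMap.add_apply, Module.End.mul_apply, LinearMap.smul_apply,
      X.L_pos_of_killed X.a_vac one_pos, map_zero, sub_zero, X.L_neg_one_vac, map_sub, map_sum,
      map_smul, X.L_a_vac one_pos, add_neg_cancel, X.a_zero, Module.End.one_apply,
      X.L_zero_of_killed X.a_vac, and_true, smul_smul, ← add_smul, ← Finset.sum_smul,
      ← sub_smul, X.zero_liouville] at h
    have h' := hinj h
    simp only [Int.cast_neg, Int.cast_one, if_true, mul_add, Finset.sum_add_distrib, one_pow,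
      mul_one, hz] at h'
    have h2 : ∑ i, X.metric i * X.zero i * (- -1 * X.zero i)
        = ∑ i, X.metric i * X.zero i ^ 2 := Finset.sum_congr rfl fun i _ => by ring
    rw [h2] at h'
    unfold weight at h'
    linear_combination -h' - X.slope_sq
  · have h := congrArg (fun Y : Module.End ℂ V => Y X.vac) (hs 2 (-2))
    have hq : ∀ i, X.L 2 (X.a i (-1) (X.a i (-1) X.vac)) = X.metric i • X.vac := fun i => by
      have e := X.a_a_vac i one_pos
      have e1 := X.a_vac i 1 one_pos
      rw [apply_of_commutator (X.L_comm_a 2 i (-1)), X.L_a_vac two_pos]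
      norm_num [e, e1]
    simp only [LinearMap.sub_apply, LinearMap.add_apply, Module.End.mul_apply, LinearMap.smul_apply,
      X.L_pos_of_killed X.a_vac two_pos, map_zero, sub_zero, X.L_neg_two_vac, map_sub, map_sum,
      map_add, map_smul, X.L_a_vac two_pos, hq, add_neg_cancel, X.a_zero, Module.End.one_apply,
      X.L_zero_of_killed X.a_vac, and_true, smul_smul, ← add_smul, ← Finset.sum_smul,
      ← sub_smul, X.zero_liouville] at h
    have h' := hinj h
    have h2 : ∑ i, (X.metric i * X.zero i * (-((-2 : ℤ) : ℂ) * X.zero i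
        + if i = X.liouville then X.slope * ((2 : ℤ) : ℂ) ^ 2 else 0)
        + X.metric i / 2 * X.metric i)
        = 2 * ∑ i, X.metric i * X.zero i ^ 2 + Fintype.card ι / 2 := by
      have : ∀ i, (X.metric i * X.zero i * (-((-2 : ℤ) : ℂ) * X.zero i
        + if i = X.liouville then X.slope * ((2 : ℤ) : ℂ) ^ 2 else 0)
        + X.metric i / 2 * X.metric i)
        = 2 * (X.metric i * X.zero i ^ 2)
          + 4 * (X.metric i * X.zero i * (if i = X.liouville then X.slope else 0)) + 1 / 2 := by
        intro i
        split_ifs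
        · push_cast; linear_combination X.metric_mul_self i / 2
        · push_cast; linear_combination X.metric_mul_self i / 2
      simp only [this, Finset.sum_add_distrib, ← Finset.mul_sum, hz]
      simp
      ring
    rw [h2] at h'
    simp only [if_true] at h'
    unfold weight at h'
    unfold charge
    push_cast at h'
    linear_combination -h' - 8 * X.slope_sq

end Fock

/-- The three pieces are rewritten as sums over all integers with indicator coefficients, and these
coefficients add up to one. -/
theorem opSum_int_split {V : Type*} [AddCommGroup V] [Module ℂ V] {T : ℤ → Module.End ℂ V}
    (hT : LocFin T) : opSum T = opSum (fun m : ℕ+ => T m) + T 0 + opSum fun m : ℕ+ => T (-m) := by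
  have hcoe : Function.Injective fun m : ℕ+ => (m : ℤ) := fun k l h =>
    PNat.coe_injective (Int.ofNat_injective h)
  have hneg : Function.Injective fun m : ℕ+ => -(m : ℤ) := neg_injective.comp hcoe
  have hinj : ∀ {f : ℕ+ → ℤ}, Function.Injective f →
      opSum (fun k => T (f k))
        = opSum fun k : ℤ => (Set.range f).indicator (fun _ => (1 : ℂ)) k • T k := fun {f} hf => by
    ext v
    rw [opSum_apply (hT.comp_injective hf), opSum_apply (hT.smul _),
      ← finsum_mem_range (f := fun k => T k v) hf, finsum_mem_def]
    refine finsum_congr fun k => ?_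
    by_cases hk : k ∈ Set.range f
    · simp [Set.indicator_of_mem hk]
    · simp [Set.indicator_of_notMem hk]
  have h0 : T 0 = opSum fun k : ℤ => (if k = 0 then (1 : ℂ) else 0) • T k := by
    rw [opSum_eq_single 0 fun k hk => by rw [if_neg hk, zero_smul], if_pos rfl, one_smul]
  rw [hinj hcoe, hinj hneg, h0, ← opSum_add (hT.smul _) (hT.smul _),
    ← opSum_add ((hT.smul _).add (hT.smul _)) (hT.smul _)]
  congr 1
  funext k
  rw [← add_smul, ← add_smul]
  have : (Set.range fun m : ℕ+ => (m : ℤ)).indicator (fun _ => (1 : ℂ)) k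
      + (if k = 0 then 1 else 0)
      + (Set.range fun m : ℕ+ => -(m : ℤ)).indicator (fun _ => (1 : ℂ)) k = 1 := by
    rcases lt_trichotomy k 0 with h | rfl | h
    · obtain ⟨l, hl⟩ := exists_pnat (n := -k) (by omega)
      rw [Set.indicator_of_notMem, if_neg (by omega), Set.indicator_of_mem (s := Set.range fun m : ℕ+ => -(m : ℤ)) ⟨l, by simp [hl]⟩]
      · simp
      · rintro ⟨m, hm⟩
        have := m.pos
        simp only at hm
        omega
    · rw [Set.indicator_of_notMem, Set.indicator_of_notMem]
      · simp
      · rintro ⟨m, hm⟩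
        have := m.pos
        simp only at hm
        omega
      · rintro ⟨m, hm⟩
        have := m.pos
        simp only at hm
        omega
    · obtain ⟨l, hl⟩ := exists_pnat h
      rw [Set.indicator_of_mem (s := Set.range fun m : ℕ+ => (m : ℤ)) ⟨l, by simp [hl]⟩, if_neg (by omega), Set.indicator_of_notMem]
      · simp
      · rintro ⟨m, hm⟩
        have := m.pos
        simp only at hm
        omega
  rw [this, one_smul]

/-! ### Commutators of the ghost constraints and of the ghost differential -/

namespace GhostModes

variable {V : Type*} [AddCommGroup V] [Module ℂ V] (G : GhostModes V)

theorem ghostVir_zero_comm_normal (m n : ℤ) :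
    G.ghostVir 0 * G.normal m n - G.normal m n * G.ghostVir 0
      = (-((m : ℂ) + n)) • G.normal m n := by
  have hc : ∀ n, G.ghostVir 0 * G.c n - G.c n * G.ghostVir 0 = (-(n : ℂ)) • G.c n := fun n => by
    rw [ghostVir_comm_c]
    simp
  have hb : ∀ n, G.ghostVir 0 * G.b n - G.b n * G.ghostVir 0 = (-(n : ℂ)) • G.b n := fun n => by
    rw [ghostVir_comm_b]
    simp
  have hprod : ∀ {A B : Module.End ℂ V} {m n : ℤ},
      G.ghostVir 0 * A - A * G.ghostVir 0 = (-(m : ℂ)) • A →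
      G.ghostVir 0 * B - B * G.ghostVir 0 = (-(n : ℂ)) • B →
      G.ghostVir 0 * (A * B) - A * B * G.ghostVir 0 = (-((m : ℂ) + n)) • (A * B) := by
    intro A B m n hA hB
    have : G.ghostVir 0 * (A * B) - A * B * G.ghostVir 0
        = (G.ghostVir 0 * A - A * G.ghostVir 0) * B
          + A * (G.ghostVir 0 * B - B * G.ghostVir 0) := by noncomm_ring
    rw [this, hA, hB, smul_mul_assoc, mul_smul_comm]
    module
  unfold normal
  split_ifs with h0 h1
  · obtain ⟨rfl, rfl⟩ := h0
    have h1 := hprod (hc 0) (hb 0)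
    have h2 := hprod (hb 0) (hc 0)
    simp only [Int.cast_zero, add_zero, neg_zero, zero_smul] at h1 h2 ⊢
    rw [mul_smul_comm, smul_mul_assoc, ← smul_sub, mul_sub, sub_mul]
    rw [sub_sub_sub_comm, h1, h2]
    simp
  · rw [mul_neg, neg_mul, smul_neg, add_comm (m : ℂ), ← hprod (hb n) (hc m)]
    abel
  · exact hprod (hc m) (hb n)

theorem ghostVir_zero_comm_ghostVir (m : ℤ) :
    G.ghostVir 0 * G.ghostVir m - G.ghostVir m * G.ghostVir 0 = (-(m : ℂ)) • G.ghostVir m := by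
  have hl := G.locFin_ghostVir m
  have e : G.ghostVir m = opSum fun k : ℤ => ((k : ℂ) - (m : ℂ)) • G.normal (-k) (m + k) := rfl
  rw [e, smul_opSum hl, mul_opSum hl, opSum_mul hl, ← opSum_sub (hl.comp_left _) (hl.comp_right _)]
  congr 1
  funext k
  rw [mul_smul_comm, smul_mul_assoc, ← smul_sub, ghostVir_zero_comm_normal]
  push_cast
  module

theorem ghostVir_commutator_comm_c (m n k : ℤ) :
    (G.ghostVir m * G.ghostVir n - G.ghostVir n * G.ghostVir m
      - ((m : ℂ) - n) • G.ghostVir (m + n)) * G.c k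
      = G.c k * (G.ghostVir m * G.ghostVir n - G.ghostVir n * G.ghostVir m
        - ((m : ℂ) - n) • G.ghostVir (m + n)) := by
  have j := commutator_commutator (G.ghostVir m) (G.ghostVir n) (G.c k)
  have e := G.ghostVir_comm_c (m + n) k
  rw [ghostVir_comm_c, ghostVir_comm_c] at j
  simp only [mul_smul_comm, smul_mul_assoc, ← smul_sub, ghostVir_comm_c] at j
  have e1 : n + (m + k) = m + n + k := by ring
  have e2 : m + (n + k) = m + n + k := by ring
  rw [e1, e2] at j
  rw [← sub_eq_zero, sub_mul, mul_sub, sub_sub_sub_comm, j, smul_mul_assoc, mul_smul_comm,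
    ← smul_sub, e]
  push_cast
  module

theorem ghostVir_commutator_comm_b (m n k : ℤ) :
    (G.ghostVir m * G.ghostVir n - G.ghostVir n * G.ghostVir m
      - ((m : ℂ) - n) • G.ghostVir (m + n)) * G.b k
      = G.b k * (G.ghostVir m * G.ghostVir n - G.ghostVir n * G.ghostVir m
        - ((m : ℂ) - n) • G.ghostVir (m + n)) := by
  have j := commutator_commutator (G.ghostVir m) (G.ghostVir n) (G.b k)
  have e := G.ghostVir_comm_b (m + n) k
  rw [ghostVir_comm_b, ghostVir_comm_b] at j
  simp only [mul_smul_comm, smul_mul_assoc, ← smul_sub, ghostVir_comm_b] at j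
  have e1 : n + (m + k) = m + n + k := by ring
  have e2 : m + (n + k) = m + n + k := by ring
  rw [e1, e2] at j
  rw [← sub_eq_zero, sub_mul, mul_sub, sub_sub_sub_comm, j, smul_mul_assoc, mul_smul_comm,
    ← smul_sub, e]
  push_cast
  module

theorem locFin_c_ghostVir : LocFin fun m : ℕ+ => G.c (-(m : ℤ)) * G.ghostVir (m : ℤ) :=
  .of_pnat_bound fun v => by
    obtain ⟨N, -, hN⟩ := G.ghostVir_bound v
    exact ⟨N, fun k hk => by rw [Module.End.mul_apply, hN _ hk, map_zero]⟩

theorem locFin_ghostVir_c : LocFin fun m : ℕ+ => G.ghostVir (-(m : ℤ)) * G.c (m : ℤ) := by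
  simpa using G.locFin_mul_c (fun _ => 1) fun m => G.ghostVir (-(m : ℤ))

/-- In each product of c with ℒ the mode b_n can meet either factor. Meeting the factors ℒ_m it
rebuilds the normally ordered sum for ℒ_n, split by the sign of the index. Meeting the factors c it
picks out ℒ_n itself once. The two copies of ℒ_n are compensated by the prefactor 1/2. -/
theorem ghostDiff_anticomm_b (n : ℤ) :
    G.ghostDiff * G.b n + G.b n * G.ghostDiff = G.ghostVir n := by
  have h1 : ∀ m : ℤ, G.c (-m) * G.ghostVir m * G.b n + G.b n * (G.c (-m) * G.ghostVir m)
      = ((m : ℂ) - n) • (G.c (-m) * G.b (m + n)) + if m = n then G.ghostVir m else 0 := fun m => by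
    have e : (if m = n then G.ghostVir m else 0)
        = (if -m + n = 0 then 1 else 0) * G.ghostVir m := by
      by_cases h : m = n
      · rw [if_pos h, if_pos (by omega), one_mul]
      · rw [if_neg h, if_neg (by omega), zero_mul]
    rw [e, ← G.c_add_b, ← mul_smul_comm, ← ghostVir_comm_b]
    noncomm_ring
  have h2 : ∀ m : ℤ, G.ghostVir (-m) * G.c m * G.b n + G.b n * (G.ghostVir (-m) * G.c m)
      = ((m : ℂ) + n) • (G.b (n - m) * G.c m) + if m = -n then G.ghostVir (-m) else 0 := fun m => by
    have e : (if m = -n then G.ghostVir (-m) else 0)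
        = G.ghostVir (-m) * (if m + n = 0 then 1 else 0) := by
      by_cases h : m = -n
      · rw [if_pos h, if_pos (by omega), mul_one]
      · rw [if_neg h, if_neg (by omega), mul_zero]
    have e' := G.ghostVir_comm_b (-m) n
    have e3 : -m + n = n - m := by ring
    rw [e3] at e'
    have e4 : ((m : ℂ) + n) • (G.b (n - m) * G.c m)
        = -((G.ghostVir (-m) * G.b n - G.b n * G.ghostVir (-m)) * G.c m) := by
      rw [e', smul_mul_assoc]
      push_cast
      module
    rw [e, ← G.c_add_b, e4]
    noncomm_ring
  have hs := G.locFin_ghostVir n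
  have hT1 : ∀ m : ℕ+, ((m : ℂ) - n) • (G.c (-(m : ℤ)) * G.b (m + n))
      = (((m : ℤ) : ℂ) - n) • G.normal (-(m : ℤ)) (n + m) := fun m => by
    have := m.pos
    unfold normal
    rw [if_neg (by omega), if_neg (by omega), add_comm (m : ℤ)]
    rfl
  have hT2 : ∀ m : ℕ+, ((m : ℂ) + n) • (G.b (n - m) * G.c m)
      = (((-(m : ℤ) : ℤ) : ℂ) - n) • G.normal (-(-(m : ℤ))) (n + -(m : ℤ)) := fun m => by
    have := m.pos
    unfold normal
    rw [if_neg (by omega), if_pos (by omega), neg_neg, ← sub_eq_add_neg]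
    push_cast
    module
  have hL1 : LocFin fun m : ℕ+ => ((m : ℂ) - n) • (G.c (-(m : ℤ)) * G.b (m + n)) := by
    simp only [hT1]
    exact hs.comp_injective (f := fun m : ℕ+ => (m : ℤ)) fun k l h =>
      PNat.coe_injective (Int.ofNat_injective h)
  have hL2 : LocFin fun m : ℕ+ => ((m : ℂ) + n) • (G.b (n - m) * G.c m) := by
    simp only [hT2]
    exact hs.comp_injective (f := fun m : ℕ+ => -(m : ℤ)) fun k l h =>
      PNat.coe_injective (Int.ofNat_injective (neg_injective h))
  have hsplit := opSum_int_split hs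
  -- A sum over positive indices sees the mode paired with b_n in at most one term, and only if the
  -- sign of the index allows it.
  have hdelta : ∀ Y : ℤ → Module.End ℂ V, ∀ l : ℤ,
      LocFin (fun m : ℕ+ => if (m : ℤ) = l then Y m else 0) ∧
      opSum (fun m : ℕ+ => if (m : ℤ) = l then Y m else 0) = if 0 < l then Y l else 0 := by
    intro Y l
    by_cases hl : 0 < l
    · obtain ⟨k, rfl⟩ := exists_pnat hl
      have h : ∀ m : ℕ+, m ≠ k → (if (m : ℤ) = k then Y m else 0) = 0 := fun m hm =>
        if_neg (pnat_ne hm)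
      exact ⟨.of_eq_zero {k} fun m hm => h m (by simpa using hm),
        by rw [opSum_eq_single k h, if_pos rfl, if_pos hl]⟩
    · have h : ∀ m : ℕ+, (if (m : ℤ) = l then Y m else 0) = 0 := fun m => if_neg fun h => by
        have := m.pos
        omega
      exact ⟨.of_eq_zero ∅ fun m _ => h m, by rw [opSum_eq_zero h, if_neg hl]⟩
  have E1 : opSum (fun m : ℕ+ => G.c (-(m : ℤ)) * G.ghostVir m) * G.b n
      + G.b n * opSum (fun m : ℕ+ => G.c (-(m : ℤ)) * G.ghostVir m)
      = opSum (fun m : ℕ+ => (((m : ℤ) : ℂ) - n) • G.normal (-(m : ℤ)) (n + m))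
        + if 0 < n then G.ghostVir n else 0 := by
    rw [opSum_anticommutator G.locFin_c_ghostVir]
    simp only [h1]
    rw [← (hdelta (fun m => G.ghostVir m) n).2]
    simp only [← hT1]
    exact opSum_add hL1 (hdelta (fun m => G.ghostVir m) n).1
  have E2 : opSum (fun m : ℕ+ => G.ghostVir (-(m : ℤ)) * G.c m) * G.b n
      + G.b n * opSum (fun m : ℕ+ => G.ghostVir (-(m : ℤ)) * G.c m)
      = opSum (fun m : ℕ+ => (((-(m : ℤ) : ℤ) : ℂ) - n) • G.normal (-(-(m : ℤ))) (n + -(m : ℤ)))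
        + if 0 < -n then G.ghostVir n else 0 := by
    rw [opSum_anticommutator G.locFin_ghostVir_c]
    simp only [h2]
    have := (hdelta (fun m => G.ghostVir (-m)) (-n)).2
    rw [neg_neg] at this
    rw [← this]
    simp only [← hT2]
    exact opSum_add hL2 (hdelta (fun m => G.ghostVir (-m)) (-n)).1
  have E3 : G.c 0 * G.ghostVir 0 * G.b n + G.b n * (G.c 0 * G.ghostVir 0)
      = (((0 : ℤ) : ℂ) - n) • G.normal (-0) (n + 0) + if n = 0 then G.ghostVir n else 0 := by
    have := h1 0
    rw [neg_zero] at this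
    rw [this, zero_add, neg_zero, add_zero]
    by_cases h : n = 0
    · simp [h]
    · rw [if_neg (Ne.symm h), if_neg h]
      congr 2
      unfold normal
      rw [if_neg (by omega), if_neg (by omega)]
  -- According to the sign of `n`, exactly one of the three parts of the differential contains the
  -- mode paired with b_n.
  have hdelta' : (if 0 < n then G.ghostVir n else 0) + (if n = 0 then G.ghostVir n else 0)
      + (if 0 < -n then G.ghostVir n else 0) = G.ghostVir n := by
    rcases lt_trichotomy n 0 with h | h | h
    · rw [if_neg (by omega), if_neg (by omega), if_pos (by omega)]; simp
    · rw [if_neg (by omega), if_pos (by omega), if_neg (by omega)]; simp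
    · rw [if_pos (by omega), if_neg (by omega), if_neg (by omega)]; simp
  have hfin : G.ghostDiff * G.b n + G.b n * G.ghostDiff
      = (1 / 2 : ℂ) • ((opSum (fun m : ℕ+ => G.c (-(m : ℤ)) * G.ghostVir m) * G.b n
      + G.b n * opSum (fun m : ℕ+ => G.c (-(m : ℤ)) * G.ghostVir m))
      + (G.c 0 * G.ghostVir 0 * G.b n + G.b n * (G.c 0 * G.ghostVir 0))
      + (opSum (fun m : ℕ+ => G.ghostVir (-(m : ℤ)) * G.c m) * G.b n
      + G.b n * opSum (fun m : ℕ+ => G.ghostVir (-(m : ℤ)) * G.c m))) := by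
    simp only [ghostDiff, add_mul, mul_add, smul_mul_assoc, mul_smul_comm]
    module
  have hv : G.ghostVir n = opSum (fun m : ℕ+ => (((m : ℤ) : ℂ) - n) • G.normal (-(m : ℤ)) (n + m))
      + (((0 : ℤ) : ℂ) - n) • G.normal (-0) (n + 0)
      + opSum (fun m : ℕ+ => (((-(m : ℤ) : ℤ) : ℂ) - n) • G.normal (-(-(m : ℤ))) (n + -(m : ℤ))) :=
    hsplit
  rw [hfin, E1, E2, E3]
  linear_combination (norm := module) (1 / 2 : ℂ) • hdelta' - (1 / 2 : ℂ) • hv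

theorem ghostNumber_comm_ghostDiff :
    G.ghostNumber * G.ghostDiff - G.ghostDiff * G.ghostNumber = G.ghostDiff := by
  have hprod : ∀ {A B : Module.End ℂ V} {x y : ℂ},
      G.ghostNumber * A - A * G.ghostNumber = x • A →
      G.ghostNumber * B - B * G.ghostNumber = y • B →
      G.ghostNumber * (A * B) - A * B * G.ghostNumber = (x + y) • (A * B) := by
    intro A B x y hA hB
    have : G.ghostNumber * (A * B) - A * B * G.ghostNumber
        = (G.ghostNumber * A - A * G.ghostNumber) * B
          + A * (G.ghostNumber * B - B * G.ghostNumber) := by noncomm_ring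
    rw [this, hA, hB, smul_mul_assoc, mul_smul_comm]
    module
  have hc : ∀ n, G.ghostNumber * G.c n - G.c n * G.ghostNumber = (1 : ℂ) • G.c n := fun n => by
    rw [ghostNumber_comm_c, one_smul]
  have hb : ∀ n, G.ghostNumber * G.b n - G.b n * G.ghostNumber = (-1 : ℂ) • G.b n := fun n => by
    rw [ghostNumber_comm_b, neg_one_smul]
  have hnormal : ∀ m n, G.ghostNumber * G.normal m n = G.normal m n * G.ghostNumber := by
    intro m n
    have h1 := hprod (hc m) (hb n)
    rw [add_neg_cancel, zero_smul, sub_eq_zero] at h1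
    obtain ⟨s, hs⟩ := G.normal_eq m n
    rw [hs, mul_sub, sub_mul, h1]
    simp
  have hvir : ∀ m, G.ghostNumber * G.ghostVir m - G.ghostVir m * G.ghostNumber
      = (0 : ℂ) • G.ghostVir m := fun m => by
    rw [zero_smul, sub_eq_zero]
    change G.ghostNumber * opSum _ = opSum _ * G.ghostNumber
    rw [mul_opSum (G.locFin_ghostVir m), opSum_mul (G.locFin_ghostVir m)]
    simp only [mul_smul_comm, smul_mul_assoc, hnormal]
  have hop : ∀ T : ℕ+ → Module.End ℂ V, LocFin T →
      (∀ m, G.ghostNumber * T m - T m * G.ghostNumber = T m) →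
      G.ghostNumber * opSum T - opSum T * G.ghostNumber = opSum T := fun T hT h => by
    rw [mul_opSum hT, opSum_mul hT, ← opSum_sub (hT.comp_left _) (hT.comp_right _)]
    simp only [h]
  have h1 := hop _ G.locFin_c_ghostVir fun m => by
    rw [hprod (hc _) (hvir _), add_zero, one_smul]
  have h2 := hop _ G.locFin_ghostVir_c fun m => by
    rw [hprod (hvir _) (hc _), zero_add, one_smul]
  have h3 := hprod (hc 0) (hvir 0)
  rw [add_zero, one_smul] at h3
  have : G.ghostNumber * G.ghostDiff - G.ghostDiff * G.ghostNumber
      = (1 / 2 : ℂ) • (G.ghostNumber * opSum (fun m : ℕ+ => G.c (-(m : ℤ)) * G.ghostVir m)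
        - opSum (fun m : ℕ+ => G.c (-(m : ℤ)) * G.ghostVir m) * G.ghostNumber)
      + (1 / 2 : ℂ) • (G.ghostNumber * (G.c 0 * G.ghostVir 0) - G.c 0 * G.ghostVir 0 * G.ghostNumber)
      + (1 / 2 : ℂ) • (G.ghostNumber * opSum (fun m : ℕ+ => G.ghostVir (-(m : ℤ)) * G.c m)
        - opSum (fun m : ℕ+ => G.ghostVir (-(m : ℤ)) * G.c m) * G.ghostNumber) := by
    simp only [ghostDiff, add_mul, mul_add, smul_mul_assoc, mul_smul_comm]
    module
  rw [this, h1, h2, h3, ghostDiff]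

end GhostModes

namespace Fock

variable {ι : Type*} [Fintype ι] [DecidableEq ι] {V : Type*} [AddCommGroup V] [Module ℂ V]
  (X : Fock ι V)

/-! ### The ghost Virasoro algebra -/

theorem normal_vac_eq_zero {m k : ℤ} (h : 0 ≤ m + k ∨ 0 < -k) (hm : m ≠ 0) :
    X.normal (-k) (m + k) X.vac = 0 := by
  unfold GhostModes.normal
  rw [if_neg (by omega)]
  split_ifs with h1
  · rw [LinearMap.neg_apply, Module.End.mul_apply, X.c_vac _ h1, map_zero, neg_zero]
  · rw [Module.End.mul_apply, X.b_vac _ (by omega), map_zero]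

theorem ghostVir_neg_one_vac : X.ghostVir (-1) X.vac = X.c 0 (X.b (-1) X.vac) := by
  refine (opSum_apply_eq_single (X.locFin_ghostVir (-1)) 0 fun k hk => ?_).trans ?_
  · rw [LinearMap.smul_apply, X.normal_vac_eq_zero (by omega) (by decide), smul_zero]
  · simp [GhostModes.normal]

theorem ghostVir_neg_two_vac : X.ghostVir (-2) X.vac
    = (2 : ℂ) • X.c 0 (X.b (-2) X.vac) + (3 : ℂ) • X.c (-1) (X.b (-1) X.vac) := by
  refine (opSum_apply_eq_sum (X.locFin_ghostVir (-2)) {0, 1} fun k hk => ?_).trans ?_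
  · simp only [Finset.mem_insert, Finset.mem_singleton, not_or] at hk
    rw [LinearMap.smul_apply, X.normal_vac_eq_zero (by omega) (by decide), smul_zero]
  · rw [Finset.sum_pair (by decide)]
    norm_num [GhostModes.normal]

theorem ghostVir_c_b_vac {m : ℤ} (hm : 0 < m) (k l : ℤ) :
    X.ghostVir m (X.c k (X.b l X.vac)) = (-(2 * (m : ℂ) + k)) • X.c (m + k) (X.b l X.vac)
      + ((m : ℂ) - l) • X.c k (X.b (m + l) X.vac) := by
  rw [apply_of_commutator (X.ghostVir_comm_c m k), apply_of_commutator (X.ghostVir_comm_b m l),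
    X.ghostVir_vac X.c_vac X.b_vac hm.le]
  simp [add_comm]

theorem c_b_vac {n : ℤ} (hn : 0 < n) : X.c n (X.b (-n) X.vac) = X.vac := by
  rw [apply_of_anticommutator (X.c_add_b n (-n)), X.c_vac n hn]
  simp

/-- The scalars are found as for the matter sector: on the vacuum the pairs `(1, -1)` and `(2, -2)`
give -2 and -17, which is the cocycle of central charge -26 with a linear shift. -/
theorem ghostVir_comm_ghostVir (m n : ℤ) : X.ghostVir m * X.ghostVir n - X.ghostVir n * X.ghostVir m
    = ((m : ℂ) - n) • X.ghostVir (m + n)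
      + (if m + n = 0 then -(13 / 6) * (m : ℂ) ^ 3 + 1 / 6 * m else 0) • 1 := by
  have : Nontrivial (Module.End ℂ V) :=
    ⟨1, 0, fun h => X.vac_ne_zero (congrArg (fun Y : Module.End ℂ V => Y X.vac) h)⟩
  have hex : ∀ m n : ℤ, ∃ s : ℂ, X.ghostVir m * X.ghostVir n - X.ghostVir n * X.ghostVir m
      = ((m : ℂ) - n) • X.ghostVir (m + n) + s • (1 : Module.End ℂ V) := fun m n => by
    obtain ⟨s, hs⟩ := X.eq_smul_one
      (Y := X.ghostVir m * X.ghostVir n - X.ghostVir n * X.ghostVir m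
        - ((m : ℂ) - n) • X.ghostVir (m + n)) (fun i k => by
        simp only [sub_mul, mul_sub, smul_mul_assoc, mul_smul_comm, mul_assoc, X.ghostVir_comm_a]
        simp only [← mul_assoc, X.ghostVir_comm_a])
      (X.ghostVir_commutator_comm_c m n) (X.ghostVir_commutator_comm_b m n)
    exact ⟨s, by rw [← hs]; abel⟩
  choose s hs using hex
  have hinj := smul_left_injective ℂ X.vac_ne_zero
  have hv0 := X.ghostVir_vac X.c_vac X.b_vac (le_refl 0)
  refine virasoro_of_scalar s hs X.ghostVir_zero_comm_ghostVir ?_ ?_ m n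
  · have h := congrArg (fun Y : Module.End ℂ V => Y X.vac) (hs 1 (-1))
    have h1 := X.c_b_vac one_pos
    have h2 := X.b_vac 0 le_rfl
    simp only [LinearMap.sub_apply, LinearMap.add_apply, Module.End.mul_apply, LinearMap.smul_apply,
      X.ghostVir_vac X.c_vac X.b_vac zero_le_one, map_zero, sub_zero, X.ghostVir_neg_one_vac,
      X.ghostVir_c_b_vac one_pos, add_neg_cancel, add_zero, h1, h2, hv0, smul_zero, zero_add,
      Module.End.one_apply] at h
    have h' := hinj h
    push_cast at h'
    linear_combination -h'
  · have h := congrArg (fun Y : Module.End ℂ V => Y X.vac) (hs 2 (-2))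
    have h1 := X.c_b_vac one_pos
    have h2 := X.c_b_vac two_pos
    have h3 := X.b_vac 0 le_rfl
    have h4 := X.b_vac 1 zero_le_one
    have e : (2 : ℤ) + -1 = 1 := rfl
    simp only [LinearMap.sub_apply, LinearMap.add_apply, Module.End.mul_apply, LinearMap.smul_apply,
      X.ghostVir_vac X.c_vac X.b_vac zero_le_two, map_zero, sub_zero, X.ghostVir_neg_two_vac,
      X.ghostVir_c_b_vac two_pos, add_neg_cancel, add_zero, h1, h2, h3, h4, hv0, smul_zero,
      zero_add, Module.End.one_apply, map_add, map_smul, e, smul_smul, ← add_smul] at h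
    have h' := hinj h
    push_cast at h'
    linear_combination -h'

/-! ### The ghost extended constraints -/

/-- The ghost extended constraints. -/
def Ltot (m : ℤ) : Module.End ℂ V :=
  X.L m + X.ghostVir m - (if m = 0 then X.intercept else 0) • 1

theorem Ltot_comm_b (m n : ℤ) :
    X.Ltot m * X.b n - X.b n * X.Ltot m = ((m : ℂ) - n) • X.b (m + n) := by
  rw [← X.ghostVir_comm_b]
  simp only [Ltot, add_mul, mul_add, sub_mul, mul_sub, smul_mul_assoc, mul_smul_comm, one_mul,
    mul_one, X.L_comm_b]
  abel

theorem Ltot_comm_c (m n : ℤ) :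
    X.Ltot m * X.c n - X.c n * X.Ltot m = (-(2 * (m : ℂ) + n)) • X.c (m + n) := by
  rw [← X.ghostVir_comm_c]
  simp only [Ltot, add_mul, mul_add, sub_mul, mul_sub, smul_mul_assoc, mul_smul_comm, one_mul,
    mul_one, X.L_comm_c]
  abel

/-- The anomaly of the ghost extended constraints. -/
def kappa (m : ℤ) : ℂ :=
  (X.charge / 12 - 13 / 6) * (m : ℂ) ^ 3 + (2 * X.intercept + 1 / 6 - X.charge / 12) * m

@[simp]
theorem kappa_zero : X.kappa 0 = 0 := by simp [kappa]

theorem kappa_neg (m : ℤ) : X.kappa (-m) = -X.kappa m := by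
  simp only [kappa]
  push_cast
  ring

/-- Matter and ghost constraints commute with each other, so their cocycles add. The intercept
enters through 2m L_0 on the right-hand side and contributes `2 m a`. -/
theorem Ltot_comm_Ltot (m n : ℤ) : X.Ltot m * X.Ltot n - X.Ltot n * X.Ltot m
    = ((m : ℂ) - n) • X.Ltot (m + n) + (if m + n = 0 then X.kappa m else 0) • 1 := by
  have h1 := X.L_comm_L m n
  have h2 := X.ghostVir_comm_ghostVir m n
  have h3 : X.Ltot m * X.Ltot n - X.Ltot n * X.Ltot m
      = (X.L m * X.L n - X.L n * X.L m)
        + (X.ghostVir m * X.ghostVir n - X.ghostVir n * X.ghostVir m) := by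
    simp only [Ltot, add_mul, mul_add, sub_mul, mul_sub, smul_mul_assoc, mul_smul_comm, one_mul,
      mul_one, X.L_comm_ghostVir]
    module
  rw [h3, h1, h2, Ltot]
  by_cases h : m + n = 0
  · have hn : (n : ℂ) = -(m : ℂ) := by
      have : (m : ℂ) + n = 0 := by exact_mod_cast h
      linear_combination this
    rw [if_pos h, if_pos h, if_pos h, if_pos h, hn, kappa]
    module
  · rw [if_neg h, if_neg h, if_neg h, if_neg h]
    module

/-! ### The differential -/

/-- For large negative `m` the mode c_{-m} annihilates the given vector. For large positive `m` it
is a creator, but it commutes with L_m, which then annihilates the vector. -/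
theorem locFin_diff : LocFin fun m : ℤ =>
    (X.L m - (if m = 0 then X.intercept else 0) • 1) * X.c (-m) := by
  refine .of_int_bound fun v => ?_
  obtain ⟨N, h0, hN⟩ := X.ghost_bound v
  obtain ⟨N', h0', hN'⟩ := X.L_bound v
  refine ⟨max N N', fun k hk => ?_⟩
  rcases hk with hk | hk
  · have : (X.L k - (if k = 0 then X.intercept else 0) • 1) * X.c (-k) = X.c (-k) * X.L k := by
      rw [if_neg (by omega), zero_smul, sub_zero, L_comm_c]
    rw [this, Module.End.mul_apply, hN' k (by omega), map_zero]
  · rw [Module.End.mul_apply, (hN (-k) (by omega)).1, map_zero]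

/-- The differential. -/
def D : Module.End ℂ V :=
  opSum (fun m : ℤ => (X.L m - (if m = 0 then X.intercept else 0) • 1) * X.c (-m)) + X.ghostDiff

/-- This is the analogue of Cartan's formula. In the matter part only the term with c_{-n}
anticommutes non-trivially with b_n and leaves L_n - a δ_{n0}; the ghost part supplies ℒ_n. -/
theorem D_anticomm_b (n : ℤ) : X.D * X.b n + X.b n * X.D = X.Ltot n := by
  have h1 := X.ghostDiff_anticomm_b n
  have h2 : ∀ m : ℤ, (X.L m - (if m = 0 then X.intercept else 0) • 1) * X.c (-m) * X.b n
      + X.b n * ((X.L m - (if m = 0 then X.intercept else 0) • 1) * X.c (-m))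
      = (X.L m - (if m = 0 then X.intercept else 0) • 1) * (if -m + n = 0 then 1 else 0) := by
    intro m
    have e : X.b n * (X.L m - (if m = 0 then X.intercept else 0) • 1)
        = (X.L m - (if m = 0 then X.intercept else 0) • 1) * X.b n := by
      simp only [mul_sub, sub_mul, X.L_comm_b, mul_smul_comm, smul_mul_assoc, one_mul, mul_one]
    rw [← mul_assoc, e, ← X.c_add_b]
    noncomm_ring
  have h3 := opSum_anticommutator X.locFin_diff (X.b n)
  simp only [h2] at h3
  have h4 := h3.trans (opSum_eq_single n fun k hk => by
    rw [if_neg (show ¬(-k + n = 0) by omega), mul_zero])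
  rw [if_pos (show -n + n = 0 by omega), mul_one] at h4
  rw [Ltot, ← h1, D, add_mul, mul_add]
  linear_combination (norm := abel) h4

theorem ghostNumber_comm_a (i : ι) (n : ℤ) :
    X.ghostNumber * X.a i n = X.a i n * X.ghostNumber := by
  have h : ∀ m k, X.c m * X.b k * X.a i n = X.a i n * (X.c m * X.b k) := fun m k => by
    rw [mul_assoc, ← X.a_comm_b, ← mul_assoc, ← X.a_comm_c, mul_assoc]
  have h' : ∀ m k, X.b m * X.c k * X.a i n = X.a i n * (X.b m * X.c k) := fun m k => by
    rw [mul_assoc, ← X.a_comm_c, ← mul_assoc, ← X.a_comm_b, mul_assoc]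
  have h1 : X.ghostDegree * X.a i n = X.a i n * X.ghostDegree :=
    opSum_commute (by simpa using X.locFin_mul_b (fun _ => 1) fun m : ℕ+ => X.c (-(m : ℤ)))
      fun _ => h _ _
  have h2 : X.antighostDegree * X.a i n = X.a i n * X.antighostDegree :=
    opSum_commute (by simpa using X.locFin_mul_c (fun _ => 1) fun m : ℕ+ => X.b (-(m : ℤ)))
      fun _ => h' _ _
  rw [GhostModes.ghostNumber, add_mul, mul_add, sub_mul, mul_sub, h1, h2, h]

theorem ghostNumber_comm_D : X.ghostNumber * X.D - X.D * X.ghostNumber = X.D := by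
  have h : ∀ m, X.ghostNumber * ((X.L m - (if m = 0 then X.intercept else 0) • 1) * X.c (-m))
      - (X.L m - (if m = 0 then X.intercept else 0) • 1) * X.c (-m) * X.ghostNumber
      = (X.L m - (if m = 0 then X.intercept else 0) • 1) * X.c (-m) := fun m => by
    have e : X.ghostNumber * (X.L m - (if m = 0 then X.intercept else 0) • 1)
        = (X.L m - (if m = 0 then X.intercept else 0) • 1) * X.ghostNumber := by
      rw [mul_sub, sub_mul, X.L_commute fun i n => (X.ghostNumber_comm_a i n).symm]
      simp
    conv_rhs => rw [← X.ghostNumber_comm_c (-m)]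
    rw [← mul_assoc, e]
    noncomm_ring
  have hl := X.locFin_diff
  have h' : X.ghostNumber * opSum (fun m : ℤ =>
        (X.L m - (if m = 0 then X.intercept else 0) • 1) * X.c (-m))
      - opSum (fun m : ℤ => (X.L m - (if m = 0 then X.intercept else 0) • 1) * X.c (-m))
        * X.ghostNumber
      = opSum (fun m : ℤ => (X.L m - (if m = 0 then X.intercept else 0) • 1) * X.c (-m)) := by
    rw [mul_opSum hl, opSum_mul hl, ← opSum_sub (hl.comp_left _) (hl.comp_right _)]
    simp only [h]
  have h2 := X.ghostNumber_comm_ghostDiff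
  simp only [D, mul_add, add_mul]
  linear_combination (norm := abel) h' + h2

theorem ghostNumber_comm_Ltot (m : ℤ) : X.ghostNumber * X.Ltot m - X.Ltot m * X.ghostNumber = 0 := by
  have h := X.ghostNumber_comm_D
  have hb := X.ghostNumber_comm_b m
  have e : X.ghostNumber * X.Ltot m - X.Ltot m * X.ghostNumber
      = (X.ghostNumber * X.D - X.D * X.ghostNumber) * X.b m
        + X.D * (X.ghostNumber * X.b m - X.b m * X.ghostNumber)
        + (X.ghostNumber * X.b m - X.b m * X.ghostNumber) * X.D
        + X.b m * (X.ghostNumber * X.D - X.D * X.ghostNumber) := by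
    rw [← X.D_anticomm_b]
    noncomm_ring
  rw [e, h, hb]
  noncomm_ring

end Fock

namespace Fock

variable {ι : Type*} [Fintype ι] [DecidableEq ι] {V : Type*} [AddCommGroup V] [Module ℂ V]
  (X : Fock ι V)

/-! ### Operators characterized by their commutators with the modes `b_n` -/

theorem ghostDegree_comm_a (i : ι) (n : ℤ) :
    X.ghostDegree * X.a i n = X.a i n * X.ghostDegree :=
  opSum_commute (by simpa using X.locFin_mul_b (fun _ => 1) fun m : ℕ+ => X.c (-(m : ℤ)))
    fun _ => by rw [mul_assoc, ← X.a_comm_b, ← mul_assoc, ← X.a_comm_c, mul_assoc]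

theorem antighostDegree_comm_a (i : ι) (n : ℤ) :
    X.antighostDegree * X.a i n = X.a i n * X.antighostDegree :=
  opSum_commute (by simpa using X.locFin_mul_c (fun _ => 1) fun m : ℕ+ => X.b (-(m : ℤ)))
    fun _ => by rw [mul_assoc, ← X.a_comm_c, ← mul_assoc, ← X.a_comm_b, mul_assoc]

theorem c_b_zero_comm_a (i : ι) (n : ℤ) :
    X.c 0 * X.b 0 * X.a i n = X.a i n * (X.c 0 * X.b 0) := by
  rw [mul_assoc, ← X.a_comm_b, ← mul_assoc, ← X.a_comm_c, mul_assoc]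

theorem ghostDegree_of_b_eq_zero {v : V} (hv : ∀ n, 0 < n → X.b n v = 0) : X.ghostDegree v = 0 :=
  opSum_apply_eq_zero fun k => by
    rw [Module.End.mul_apply, hv _ (by exact_mod_cast k.pos), map_zero]

theorem antighostDegree_of_c_eq_zero {v : V} (hv : ∀ n, 0 < n → X.c n v = 0) :
    X.antighostDegree v = 0 :=
  opSum_apply_eq_zero fun k => by
    rw [Module.End.mul_apply, hv _ (by exact_mod_cast k.pos), map_zero]

/-- A vector without antighost excitations has non-negative ghost number. -/
theorem eq_zero_of_ghostNumber_neg {v : V} (hv : ∀ n, 0 < n → X.c n v = 0) {s : ℤ} (hs : s < 0)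
    (h : X.ghostNumber v = (s : ℂ) • v) : v = 0 := by
  -- In the absence of antighosts the ghost number agrees with `O`, which counts all c-letters of a
  -- word and so has only natural numbers as eigenvalues.
  set O := X.ghostDegree + X.c 0 * X.b 0 with hO
  have hOv : O v = (s : ℂ) • v := by
    rw [← h, GhostModes.ghostNumber]
    simp [hO, X.antighostDegree_of_c_eq_zero hv]
  let w : Letter ι → ℕ := Sum.elim (fun _ => 0) (Sum.elim (fun _ => 1) fun _ => 0)
  have hw : ∀ x, O * creator X.a X.c X.b x - creator X.a X.c X.b x * O
      = (w x : ℂ) • creator X.a X.c X.b x := by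
    have key : ∀ Y : Module.End ℂ V, O * Y - Y * O = (X.ghostDegree * Y - Y * X.ghostDegree)
        + (X.c 0 * X.b 0 * Y - Y * (X.c 0 * X.b 0)) := fun Y => by
      rw [hO]; noncomm_ring
    intro x
    rw [key]
    rcases x with ⟨i, k⟩ | k | k
    · simp [w, creator, X.ghostDegree_comm_a, X.c_b_zero_comm_a]
    · simp only [w, creator, X.ghostDegree_comm_c, X.cb_comm_c]
      rcases Nat.eq_zero_or_pos k with rfl | hk
      · simp
      · rw [if_pos (by omega), if_neg (by omega)]
        simp
    · have := k.pos
      simp only [w, creator, X.ghostDegree_comm_b, X.cb_comm_b]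
      rw [if_neg (by omega), if_neg (by omega)]
      simp
  have hvac : O X.vac = (0 : ℂ) • X.vac := by
    simp [hO, X.ghostDegree_of_b_eq_zero fun n hn => X.b_vac n hn.le, X.b_vac]
  refine eq_zero_of_eigen X.span_fockWord (word_eigen hvac hw) hOv fun l hl => ?_
  have : (((l.map w).sum : ℤ) : ℂ) = s := by
    rw [← hl, zero_add]
    push_cast
    simp [List.map_map, Function.comp_def]
  have := Int.cast_injective this
  omega

/-- On words the operator counts the letters b, so its eigenvalues are natural numbers. -/
theorem eq_zero_of_antighostDegree_neg {v : V} {s : ℤ} (hs : s < 0)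
    (hOv : X.antighostDegree v = (s : ℂ) • v) : v = 0 := by
  let w : Letter ι → ℕ := Sum.elim (fun _ => 0) (Sum.elim (fun _ => 0) fun _ => 1)
  have hw : ∀ x, X.antighostDegree * creator X.a X.c X.b x
      - creator X.a X.c X.b x * X.antighostDegree = (w x : ℂ) • creator X.a X.c X.b x := by
    rintro (⟨i, k⟩ | k | k)
    · simp [w, creator, X.antighostDegree_comm_a]
    · simp only [w, creator, X.antighostDegree_comm_c]
      rw [if_neg (by omega)]
      simp
    · have := k.pos
      simp only [w, creator, X.antighostDegree_comm_b]
      rw [if_pos (by omega)]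
      simp
  have hvac : X.antighostDegree X.vac = (0 : ℂ) • X.vac := by
    simp [X.antighostDegree_of_c_eq_zero X.c_vac]
  refine eq_zero_of_eigen X.span_fockWord (word_eigen hvac hw) hOv fun l hl => ?_
  have : (((l.map w).sum : ℤ) : ℂ) = s := by
    rw [← hl, zero_add]
    push_cast
    simp [List.map_map, Function.comp_def]
  have := Int.cast_injective this
  omega

/-- A vector without ghost excitations has non-positive ghost number. -/
theorem eq_zero_of_ghostNumber_pos {v : V} (hv : ∀ n, 0 ≤ n → X.b n v = 0) {s : ℤ} (hs : 0 < s)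
    (h : X.ghostNumber v = (s : ℂ) • v) : v = 0 := by
  refine X.eq_zero_of_antighostDegree_neg (s := -s) (by omega) ?_
  rw [GhostModes.ghostNumber] at h
  simp only [LinearMap.add_apply, LinearMap.sub_apply, Module.End.mul_apply, hv 0 le_rfl,
    X.ghostDegree_of_b_eq_zero fun n hn => hv n hn.le] at h
  rw [Int.cast_neg, neg_smul, ← h]
  simp

/-- The creation operators other than the antighosts. -/
def creatorNoB : (ι × ℕ+) ⊕ ℕ → Module.End ℂ V
  | Sum.inl (i, k) => X.a i (-(k : ℤ))
  | Sum.inr k => X.c (-(k : ℤ))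

/-- Every vector is a combination of words with the antighosts on the left. -/
theorem span_ordered : Submodule.span ℂ (Set.range fun l : List ℕ+ × List ((ι × ℕ+) ⊕ ℕ) =>
    word (fun k : ℕ+ => X.b (-(k : ℤ))) (word X.creatorNoB X.vac l.2) l.1) = ⊤ := by
  set W := fun l : List ℕ+ × List ((ι × ℕ+) ⊕ ℕ) =>
    word (fun k : ℕ+ => X.b (-(k : ℤ))) (word X.creatorNoB X.vac l.2) l.1 with hW
  have hb : ∀ k : ℕ+, ∀ v ∈ Submodule.span ℂ (Set.range W),
      X.b (-(k : ℤ)) v ∈ Submodule.span ℂ (Set.range W) := fun k v hv => by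
    refine (Submodule.span_le.2 ?_ : Submodule.span ℂ (Set.range W) ≤
      (Submodule.span ℂ (Set.range W)).comap (X.b (-(k : ℤ)))) hv
    rintro _ ⟨⟨l, l'⟩, rfl⟩
    exact Submodule.subset_span ⟨(k :: l, l'), rfl⟩
  -- A matter creator commutes with every b_{-k} and a ghost creator anticommutes with it, so all of
  -- them pass to the right of the antighosts up to a sign.
  have hcomm : ∀ x, ∃ s : ℂ, ∀ k : ℕ+,
      X.creatorNoB x * X.b (-(k : ℤ)) = s • (X.b (-(k : ℤ)) * X.creatorNoB x) := by
    rintro (⟨i, j⟩ | j)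
    · exact ⟨1, fun k => by rw [one_smul]; exact X.a_comm_b i _ _⟩
    · refine ⟨-1, fun k => ?_⟩
      have h := X.c_add_b (-(j : ℤ)) (-(k : ℤ))
      have := k.pos
      rw [if_neg (by omega)] at h
      rw [neg_one_smul]
      exact eq_neg_of_add_eq_zero_left h
  have hx : ∀ x, ∀ v ∈ Submodule.span ℂ (Set.range W),
      X.creatorNoB x v ∈ Submodule.span ℂ (Set.range W) := fun x v hv => by
    refine (Submodule.span_le.2 ?_ : Submodule.span ℂ (Set.range W) ≤
      (Submodule.span ℂ (Set.range W)).comap (X.creatorNoB x)) hv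
    rintro _ ⟨⟨l, l'⟩, rfl⟩
    obtain ⟨s, hs⟩ := hcomm x
    change X.creatorNoB x (W (l, l')) ∈ Submodule.span ℂ (Set.range W)
    induction l with
    | nil => exact Submodule.subset_span ⟨([], x :: l'), rfl⟩
    | cons k l ih =>
      have : X.creatorNoB x (W (k :: l, l')) = s • X.b (-(k : ℤ)) (X.creatorNoB x (W (l, l'))) :=
        congrArg (fun Y : Module.End ℂ V => Y (W (l, l'))) (hs k)
      rw [this]
      exact Submodule.smul_mem _ s (hb k _ ih)
  refine X.cyclic _ (Submodule.subset_span ⟨([], []), rfl⟩) ?_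
  rintro (⟨i, k⟩ | k | k) v hv
  exacts [hx (Sum.inl (i, k)) v hv, hx (Sum.inr k) v hv, hb k v hv]

theorem c_wordNoB (l : List ((ι × ℕ+) ⊕ ℕ)) {n : ℤ} (hn : 0 < n) :
    X.c n (word X.creatorNoB X.vac l) = 0 := by
  induction l with
  | nil => exact X.c_vac n hn
  | cons x l ih =>
    rw [word_cons]
    rcases x with ⟨i, k⟩ | k
    · have := congrArg (fun Y : Module.End ℂ V => Y (word X.creatorNoB X.vac l))
        (X.a_comm_c i (-(k : ℤ)) n)
      simp only [Module.End.mul_apply, ih, map_zero] at this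
      exact this.symm
    · change X.c n (X.c (-(k : ℤ)) _) = 0
      rw [apply_of_anticommutator (X.c_add_c n _), ih]
      simp

theorem ghostNumber_wordNoB (l : List ((ι × ℕ+) ⊕ ℕ)) : ∃ n : ℕ,
    X.ghostNumber (word X.creatorNoB X.vac l) = (n : ℂ) • word X.creatorNoB X.vac l := by
  let w : (ι × ℕ+) ⊕ ℕ → ℕ := Sum.elim (fun _ => 0) fun _ => 1
  have hw : ∀ x, X.ghostNumber * X.creatorNoB x - X.creatorNoB x * X.ghostNumber
      = (w x : ℂ) • X.creatorNoB x := by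
    rintro (⟨i, k⟩ | k)
    · simp [w, creatorNoB, X.ghostNumber_comm_a]
    · simp [w, creatorNoB, X.ghostNumber_comm_c]
  have hvac : X.ghostNumber X.vac = (0 : ℂ) • X.vac := by
    simp [GhostModes.ghostNumber, X.ghostDegree_of_b_eq_zero fun n hn => X.b_vac n hn.le,
      X.b_vac, X.antighostDegree_of_c_eq_zero X.c_vac]
  refine ⟨(l.map w).sum, ?_⟩
  rw [word_eigen hvac hw, zero_add, Nat.cast_list_sum, List.map_map]
  rfl

/-- An operator of positive ghost number that commutes or anticommutes with all the modes `b_n`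
vanishes. -/
theorem eq_zero_of_comm_b {Y : Module.End ℂ V} {ε : ℂ} (hε : ε * ε = 1)
    (hb : ∀ n, Y * X.b n = ε • (X.b n * Y)) {q : ℤ} (hq : 0 < q)
    (hN : X.ghostNumber * Y - Y * X.ghostNumber = (q : ℂ) • Y) : Y = 0 := by
  have hb' : ∀ n v, X.b n (Y v) = ε • Y (X.b n v) := fun n v => by
    have := congrArg (fun Z : Module.End ℂ V => Z v) (hb n)
    simp only [Module.End.mul_apply, LinearMap.smul_apply] at this
    rw [this, smul_smul, hε, one_smul]
  -- Induction on the ghost number of a vector `v` without antighosts. For `n ≥ 0` the vector b_n v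
  -- has no antighosts either and a smaller ghost number, so `Y` kills it. Hence every such b_n
  -- kills `Y v`, which then has no ghosts, although its ghost number is positive; so `Y v = 0`. In
  -- the base case b_n v itself vanishes.
  have key : ∀ i : ℕ, ∀ v, (∀ n, 0 < n → X.c n v = 0) → X.ghostNumber v = (i : ℂ) • v →
      Y v = 0 := by
    intro i
    induction i with
    | zero =>
      intro v hc hv
      refine X.eq_zero_of_ghostNumber_pos (fun n hn => ?_) hq ?_
      · have : X.b n v = 0 := by
          refine X.eq_zero_of_ghostNumber_neg (s := -1) (fun m hm => ?_) (by decide) ?_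
          · rw [apply_of_anticommutator (X.c_add_b m n), hc m hm, if_neg (by omega)]
            simp
          · rw [apply_of_commutator (X.ghostNumber_comm_b n), hv]
            simp
        rw [hb', this, map_zero, smul_zero]
      · rw [apply_of_commutator hN, hv]
        simp
    | succ i ih =>
      intro v hc hv
      refine X.eq_zero_of_ghostNumber_pos (s := i + 1 + q) (fun n hn => ?_) (by omega) ?_
      · have : Y (X.b n v) = 0 := by
          refine ih _ (fun m hm => ?_) ?_
          · rw [apply_of_anticommutator (X.c_add_b m n), hc m hm, if_neg (by omega)]
            simp
          · rw [apply_of_commutator (X.ghostNumber_comm_b n), hv, map_smul, LinearMap.neg_apply]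
            push_cast
            module
        rw [hb', this, smul_zero]
      · rw [apply_of_commutator hN, hv, map_smul, LinearMap.smul_apply]
        push_cast
        module
  -- In ordered words the antighosts stand on the left, and `Y` passes through them by `hb`; what
  -- remains is a vector without antighosts.
  refine LinearMap.ext_on X.span_ordered ?_
  rintro _ ⟨⟨l, l'⟩, rfl⟩
  induction l with
  | nil =>
    obtain ⟨n, hn⟩ := X.ghostNumber_wordNoB l'
    exact key n _ (fun m hm => X.c_wordNoB l' hm) hn
  | cons k l ih =>
    have := congrArg (fun Z : Module.End ℂ V =>
      Z (word (fun k : ℕ+ => X.b (-(k : ℤ))) (word X.creatorNoB X.vac l') l)) (hb (-(k : ℤ)))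
    simp only [Module.End.mul_apply, LinearMap.smul_apply, LinearMap.zero_apply] at this ih ⊢
    rw [word_cons, this, ih, map_zero, smul_zero]

/-! ### The anomaly -/

/-- Both sides have ghost number one, so it suffices to compare their anticommutators with b_n. By
the Jacobi identity and {D, b_n} = L_n^tot, the left side gives [L_m^tot, L_n^tot] - (m-n)
L_{m+n}^tot, that is, the anomaly. -/
theorem Ltot_comm_D (m : ℤ) : X.Ltot m * X.D - X.D * X.Ltot m = X.kappa m • X.c m := by
  rw [← sub_eq_zero]
  refine X.eq_zero_of_comm_b (ε := -1) (by norm_num) (fun n => ?_) one_pos ?_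
  · have h1 := X.D_anticomm_b n
    have h2 := X.D_anticomm_b (m + n)
    have h3 := X.Ltot_comm_b m n
    have h4 := X.Ltot_comm_Ltot m n
    have h5 := X.c_add_b m n
    have e : (X.Ltot m * X.D - X.D * X.Ltot m) * X.b n + X.b n * (X.Ltot m * X.D - X.D * X.Ltot m)
        = (X.Ltot m * (X.D * X.b n + X.b n * X.D) - (X.D * X.b n + X.b n * X.D) * X.Ltot m)
          - (X.D * (X.Ltot m * X.b n - X.b n * X.Ltot m)
            + (X.Ltot m * X.b n - X.b n * X.Ltot m) * X.D) := by noncomm_ring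
    rw [h1, h3, mul_smul_comm, smul_mul_assoc, ← smul_add, h2, h4] at e
    have e2 : (if m + n = 0 then X.kappa m else 0) • (1 : Module.End ℂ V)
        = X.kappa m • (X.c m * X.b n + X.b n * X.c m) := by
      rw [h5]
      split_ifs <;> simp
    rw [e2] at e
    simp only [sub_mul, mul_sub, smul_mul_assoc, mul_smul_comm] at e ⊢
    linear_combination (norm := module) e
  · have h1 := X.ghostNumber_comm_D
    have h2 := X.ghostNumber_comm_Ltot m
    have h3 := X.ghostNumber_comm_c m
    have e : X.ghostNumber * (X.Ltot m * X.D - X.D * X.Ltot m)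
        - (X.Ltot m * X.D - X.D * X.Ltot m) * X.ghostNumber
        = (X.ghostNumber * X.Ltot m - X.Ltot m * X.ghostNumber) * X.D
          + X.Ltot m * (X.ghostNumber * X.D - X.D * X.ghostNumber)
          - (X.ghostNumber * X.D - X.D * X.ghostNumber) * X.Ltot m
          - X.D * (X.ghostNumber * X.Ltot m - X.Ltot m * X.ghostNumber) := by noncomm_ring
    rw [h1, h2, zero_mul, mul_zero] at e
    rw [mul_sub, sub_mul, mul_smul_comm, smul_mul_assoc, sub_sub_sub_comm, e, ← smul_sub, h3]
    simp

/-- The operator measuring the failure of the differential to be nilpotent. -/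
def anomalyOp : Module.End ℂ V :=
  opSum fun m : ℕ+ => X.kappa m • (X.c (-(m : ℤ)) * X.c m)

/-- The mode b_n meets c_{-n} in the first factor when `n > 0` and in the second when `n < 0`. The
resulting signs differ, and this is offset by κ being odd. -/
theorem anomalyOp_comm_b (n : ℤ) :
    X.anomalyOp * X.b n - X.b n * X.anomalyOp = -(X.kappa n • X.c n) := by
  have hl := X.locFin_mul_c (fun m => X.kappa m) fun m : ℕ+ => X.c (-(m : ℤ))
  have key : ∀ m : ℤ, (X.kappa m • (X.c (-m) * X.c m)) * X.b n
      - X.b n * (X.kappa m • (X.c (-m) * X.c m))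
      = X.kappa m • (X.c (-m) * (if m + n = 0 then 1 else 0)
        - (if -m + n = 0 then 1 else 0) * X.c m) := fun m => by
    rw [smul_mul_assoc, mul_smul_comm, ← smul_sub, ← X.c_add_b, ← X.c_add_b]
    congr 1
    noncomm_ring
  rcases lt_trichotomy n 0 with hn | rfl | hn
  · obtain ⟨l, hl'⟩ := exists_pnat (n := -n) (by omega)
    obtain rfl : n = -l := by omega
    refine opSum_commutator_single hl l (fun k hk => ?_) ?_
    · have := pnat_ne hk
      have := k.pos
      rw [key, if_neg (by omega), if_neg (by omega)]
      simp
    · rw [key, if_pos (by omega), if_neg (by omega), kappa_neg]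
      simp
  · rw [kappa_zero, zero_smul, neg_zero]
    refine opSum_commutator_zero hl fun k => ?_
    have := k.pos
    rw [key, if_neg (by omega), if_neg (by omega)]
    simp
  · obtain ⟨l, rfl⟩ := exists_pnat hn
    refine opSum_commutator_single hl l (fun k hk => ?_) ?_
    · have := pnat_ne hk
      rw [key, if_neg (by omega), if_neg (by omega)]
      simp
    · rw [key, if_neg (by omega), if_pos (by omega)]
      simp

/-- Both sides have ghost number two and the same commutators with b_n, since [D², b_n] = [D,
L_n^tot] = -κ(n) c_n. -/
theorem D_mul_D : X.D * X.D = X.anomalyOp := by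
  rw [← sub_eq_zero]
  refine X.eq_zero_of_comm_b (ε := 1) (by norm_num) (fun n => ?_) two_pos ?_
  · have h1 := X.D_anticomm_b n
    have h2 := X.Ltot_comm_D n
    have h3 := X.anomalyOp_comm_b n
    have e : X.D * X.D * X.b n - X.b n * (X.D * X.D)
        = X.D * (X.D * X.b n + X.b n * X.D) - (X.D * X.b n + X.b n * X.D) * X.D := by
      noncomm_ring
    rw [h1] at e
    rw [one_smul, sub_mul, mul_sub]
    linear_combination (norm := abel) e - h2 - h3
  · have h1 := X.ghostNumber_comm_D
    have h2 : X.ghostNumber * X.anomalyOp - X.anomalyOp * X.ghostNumber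
        = (2 : ℂ) • X.anomalyOp := by
      have hl := X.locFin_mul_c (fun m => X.kappa m) fun m : ℕ+ => X.c (-(m : ℤ))
      rw [anomalyOp, smul_opSum hl, mul_opSum hl, opSum_mul hl,
        ← opSum_sub (hl.comp_left _) (hl.comp_right _)]
      congr 1
      funext m
      have : X.ghostNumber * (X.c (-(m : ℤ)) * X.c m) - X.c (-(m : ℤ)) * X.c m * X.ghostNumber
          = (X.ghostNumber * X.c (-(m : ℤ)) - X.c (-(m : ℤ)) * X.ghostNumber) * X.c m
            + X.c (-(m : ℤ)) * (X.ghostNumber * X.c m - X.c m * X.ghostNumber) := by noncomm_ring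
      rw [mul_smul_comm, smul_mul_assoc, ← smul_sub, this, X.ghostNumber_comm_c,
        X.ghostNumber_comm_c]
      module
    have e : X.ghostNumber * (X.D * X.D) - X.D * X.D * X.ghostNumber
        = (X.ghostNumber * X.D - X.D * X.ghostNumber) * X.D
          + X.D * (X.ghostNumber * X.D - X.D * X.ghostNumber) := by noncomm_ring
    rw [h1] at e
    rw [mul_sub, sub_mul]
    push_cast
    linear_combination (norm := module) e - h2

/-! ### The anticommutator of the differential with `c_1` -/

/-- The anticommutator of the differential with `c_n`. -/
def gamma (n : ℤ) : Module.End ℂ V := X.D * X.c n + X.c n * X.D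

/-- The Jacobi identity for D, c_n and b_m, where {c_n, b_m} = 0 by assumption, leaves only
-[L_m^tot, c_n]. -/
theorem gamma_comm_b {m n : ℤ} (h : n + m ≠ 0) :
    X.gamma n * X.b m - X.b m * X.gamma n = (2 * (m : ℂ) + n) • X.c (m + n) := by
  have h1 := X.D_anticomm_b m
  have h2 := X.Ltot_comm_c m n
  have h3 := X.c_add_b n m
  rw [if_neg h] at h3
  have e : X.gamma n * X.b m - X.b m * X.gamma n
      = X.D * (X.c n * X.b m + X.b m * X.c n) - (X.c n * X.b m + X.b m * X.c n) * X.D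
        - ((X.D * X.b m + X.b m * X.D) * X.c n - X.c n * (X.D * X.b m + X.b m * X.D)) := by
    rw [gamma]
    noncomm_ring
  rw [e, h1, h2, h3, mul_zero, zero_mul, sub_zero, zero_sub]
  module

theorem ghostDiff_comm_a (i : ι) (k : ℤ) : X.ghostDiff * X.a i k = X.a i k * X.ghostDiff := by
  have e1 : opSum (fun m : ℕ+ => X.c (-(m : ℤ)) * X.ghostVir (m : ℤ)) * X.a i k
      = X.a i k * opSum (fun m : ℕ+ => X.c (-(m : ℤ)) * X.ghostVir (m : ℤ)) :=
    opSum_commute X.locFin_c_ghostVir fun m => by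
      rw [mul_assoc, X.ghostVir_comm_a, ← mul_assoc, ← X.a_comm_c, mul_assoc]
  have e2 : opSum (fun m : ℕ+ => X.ghostVir (-(m : ℤ)) * X.c (m : ℤ)) * X.a i k
      = X.a i k * opSum (fun m : ℕ+ => X.ghostVir (-(m : ℤ)) * X.c (m : ℤ)) :=
    opSum_commute X.locFin_ghostVir_c fun m => by
      rw [mul_assoc, ← X.a_comm_c, ← mul_assoc, X.ghostVir_comm_a, mul_assoc]
  have e3 : X.c 0 * X.ghostVir 0 * X.a i k = X.a i k * (X.c 0 * X.ghostVir 0) := by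
    rw [mul_assoc, X.ghostVir_comm_a, ← mul_assoc, ← X.a_comm_c, mul_assoc]
  simp only [GhostModes.ghostDiff, add_mul, mul_add, smul_mul_assoc, mul_smul_comm, e1, e2, e3]

/-- The matter part of D contains the ghosts only through a single c and so anticommutes with c_n.
The anticommutator therefore involves the ghost differential alone. -/
theorem gamma_comm_a (n : ℤ) (i : ι) (k : ℤ) : X.gamma n * X.a i k = X.a i k * X.gamma n := by
  have h0 : ∀ m : ℤ, (X.L m - (if m = 0 then X.intercept else 0) • 1) * X.c (-m) * X.c n
      + X.c n * ((X.L m - (if m = 0 then X.intercept else 0) • 1) * X.c (-m)) = 0 := fun m => by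
    have e : X.c n * (X.L m - (if m = 0 then X.intercept else 0) • 1)
        = (X.L m - (if m = 0 then X.intercept else 0) • 1) * X.c n := by
      rw [mul_sub, sub_mul, X.L_comm_c]
      simp
    have h := X.c_add_c (-m) n
    rw [← mul_assoc, e, mul_assoc, mul_assoc, ← mul_add, h, mul_zero]
  have h1 : X.gamma n = X.ghostDiff * X.c n + X.c n * X.ghostDiff := by
    have := opSum_anticommutator X.locFin_diff (X.c n)
    simp only [h0] at this
    rw [opSum_eq_zero fun _ => rfl] at this
    rw [gamma, D]
    linear_combination (norm := noncomm_ring) this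
  have h2 := X.ghostDiff_comm_a i k
  rw [h1, add_mul, mul_add, mul_assoc, ← X.a_comm_c, ← mul_assoc, h2, mul_assoc (X.c n), h2]
  simp only [← mul_assoc, X.a_comm_c]

end Fock

namespace Fock

variable {ι : Type*} [Fintype ι] [DecidableEq ι] {V : Type*} [AddCommGroup V] [Module ℂ V]
  (X : Fock ι V)

/-! ### Light-cone modes -/

/-- A light-cone direction in which the momentum does not vanish. -/
structure LightCone where
  time : ι
  space : ι
  sign : ℂ
  metric_time : X.metric time = -1
  metric_space : X.metric space = 1
  space_ne_liouville : space ≠ X.liouville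
  sign_mul_self : sign * sign = 1
  momentum_ne_zero : X.zero time + sign * X.zero space ≠ 0

namespace LightCone

variable {X} (Y : X.LightCone)

theorem time_ne_space : Y.time ≠ Y.space := fun h => by
  have := Y.metric_time
  rw [h, Y.metric_space] at this
  norm_num at this

theorem time_ne_liouville : Y.time ≠ X.liouville := fun h => by
  have := Y.metric_time
  rw [h, X.metric_liouville] at this
  norm_num at this

/-- The modes `a^0 + s a^j`. -/
def A (n : ℤ) : Module.End ℂ V := X.a Y.time n + Y.sign • X.a Y.space n

/-- The modes `-a^0 + s a^j`. -/
def B (n : ℤ) : Module.End ℂ V := Y.sign • X.a Y.space n - X.a Y.time n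

/-- The light-cone momentum. -/
def momentum : ℂ := X.zero Y.time + Y.sign * X.zero Y.space

theorem A_zero : Y.A 0 = Y.momentum • 1 := by
  rw [A, X.a_zero, X.a_zero, momentum]
  module

theorem B_zero : Y.B 0 = (Y.sign * X.zero Y.space - X.zero Y.time) • 1 := by
  rw [B, X.a_zero, X.a_zero]
  module

theorem time_comm_time (m n : ℤ) : X.a Y.time m * X.a Y.time n - X.a Y.time n * X.a Y.time m
    = (if m + n = 0 then -(m : ℂ) else 0) • 1 := by
  rw [X.a_comm, Y.metric_time]
  split_ifs <;> simp_all

theorem space_comm_space (m n : ℤ) : X.a Y.space m * X.a Y.space n - X.a Y.space n * X.a Y.space m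
    = (if m + n = 0 then (m : ℂ) else 0) • 1 := by
  rw [X.a_comm, Y.metric_space]
  split_ifs <;> simp_all

theorem time_comm_space (m n : ℤ) :
    X.a Y.time m * X.a Y.space n - X.a Y.space n * X.a Y.time m = 0 := by
  rw [X.a_comm, if_neg fun h => Y.time_ne_space h.1]

/-- The combination is null: the commutators of its timelike and spacelike parts cancel because
`sign * sign = 1`. Each of the two null directions is paired with the other one only. -/
theorem A_comm_A (m n : ℤ) : Y.A m * Y.A n - Y.A n * Y.A m = 0 := by
  have h1 := Y.time_comm_time m n
  have h2 := Y.space_comm_space m n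
  have h3 := Y.time_comm_space m n
  have h4 := Y.time_comm_space n m
  have h5 := Y.sign_mul_self
  simp only [A, add_mul, mul_add, smul_mul_assoc, mul_smul_comm, smul_add, smul_smul, h5, one_smul]
  split_ifs at h1 h2 <;>
    linear_combination (norm := module) h1 + h2 + Y.sign • h3 - Y.sign • h4

theorem B_comm_B (m n : ℤ) : Y.B m * Y.B n - Y.B n * Y.B m = 0 := by
  have h1 := Y.time_comm_time m n
  have h2 := Y.space_comm_space m n
  have h3 := Y.time_comm_space m n
  have h4 := Y.time_comm_space n m
  have h5 := Y.sign_mul_self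
  simp only [B, sub_mul, mul_sub, smul_mul_assoc, mul_smul_comm, smul_sub, smul_smul, h5, one_smul]
  split_ifs at h1 h2 <;>
    linear_combination (norm := module) h1 + h2 - Y.sign • h3 + Y.sign • h4

theorem A_comm_B (m n : ℤ) : Y.A m * Y.B n - Y.B n * Y.A m
    = (if m + n = 0 then 2 * (m : ℂ) else 0) • 1 := by
  have h1 := Y.time_comm_time m n
  have h2 := Y.space_comm_space m n
  have h3 := Y.time_comm_space m n
  have h4 := Y.time_comm_space n m
  have h5 := Y.sign_mul_self
  simp only [A, B, sub_mul, mul_sub, add_mul, mul_add, smul_mul_assoc, mul_smul_comm, smul_sub,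
    smul_add, smul_smul, h5, one_smul]
  split_ifs at h1 h2 ⊢ <;>
    linear_combination (norm := module) h2 - h1 + Y.sign • h3 + Y.sign • h4

theorem A_comm_a {i : ι} (h0 : i ≠ Y.time) (h1 : i ≠ Y.space) (m n : ℤ) :
    Y.A m * X.a i n - X.a i n * Y.A m = 0 := by
  have h2 := X.a_comm Y.time i m n
  have h3 := X.a_comm Y.space i m n
  rw [if_neg fun h => h0 h.1.symm] at h2
  rw [if_neg fun h => h1 h.1.symm] at h3
  simp only [A, add_mul, mul_add, smul_mul_assoc, mul_smul_comm]
  linear_combination (norm := module) h2 + Y.sign • h3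

theorem B_comm_a {i : ι} (h0 : i ≠ Y.time) (h1 : i ≠ Y.space) (m n : ℤ) :
    Y.B m * X.a i n - X.a i n * Y.B m = 0 := by
  have h2 := X.a_comm Y.time i m n
  have h3 := X.a_comm Y.space i m n
  rw [if_neg fun h => h0 h.1.symm] at h2
  rw [if_neg fun h => h1 h.1.symm] at h3
  simp only [B, sub_mul, mul_sub, smul_mul_assoc, mul_smul_comm]
  linear_combination (norm := module) Y.sign • h3 - h2

theorem A_comm {Z : Module.End ℂ V} (h : ∀ i n, X.a i n * Z = Z * X.a i n) (n : ℤ) :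
    Y.A n * Z = Z * Y.A n := by
  simp only [A, add_mul, mul_add, smul_mul_assoc, mul_smul_comm, h]

theorem B_comm {Z : Module.End ℂ V} (h : ∀ i n, X.a i n * Z = Z * X.a i n) (n : ℤ) :
    Y.B n * Z = Z * Y.B n := by
  simp only [B, sub_mul, mul_sub, smul_mul_assoc, mul_smul_comm, h]

theorem A_comm_c (m n : ℤ) : Y.A m * X.c n = X.c n * Y.A m := Y.A_comm (fun i k => X.a_comm_c i k n) m

theorem A_comm_b (m n : ℤ) : Y.A m * X.b n = X.b n * Y.A m := Y.A_comm (fun i k => X.a_comm_b i k n) m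

theorem B_comm_c (m n : ℤ) : Y.B m * X.c n = X.c n * Y.B m := Y.B_comm (fun i k => X.a_comm_c i k n) m

theorem B_comm_b (m n : ℤ) : Y.B m * X.b n = X.b n * Y.B m := Y.B_comm (fun i k => X.a_comm_b i k n) m

theorem A_apply_eq_zero {n : ℤ} {v : V} (h : ∀ i, X.a i n v = 0) : Y.A n v = 0 := by
  simp [A, h]

theorem B_apply_eq_zero {n : ℤ} {v : V} (h : ∀ i, X.a i n v = 0) : Y.B n v = 0 := by
  simp [B, h]

theorem locFin_mul_A (w : ℕ+ → ℂ) (Z : ℕ+ → Module.End ℂ V) :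
    LocFin fun m : ℕ+ => w m • (Z m * Y.A (m : ℤ)) := by
  refine LocFin.smul (T := fun m : ℕ+ => Z m * Y.A (m : ℤ)) (.of_pnat_bound fun v => ?_) w
  obtain ⟨N, -, hN⟩ := X.matter_bound v
  exact ⟨N, fun k hk => by rw [Module.End.mul_apply, Y.A_apply_eq_zero (hN _ hk), map_zero]⟩

theorem locFin_mul_B (w : ℕ+ → ℂ) (Z : ℕ+ → Module.End ℂ V) :
    LocFin fun m : ℕ+ => w m • (Z m * Y.B (m : ℤ)) := by
  refine LocFin.smul (T := fun m : ℕ+ => Z m * Y.B (m : ℤ)) (.of_pnat_bound fun v => ?_) w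
  obtain ⟨N, -, hN⟩ := X.matter_bound v
  exact ⟨N, fun k hk => by rw [Module.End.mul_apply, Y.B_apply_eq_zero (hN _ hk), map_zero]⟩

/-- The weighted number of excitations `A_{-m}`, `m > 0`. -/
def weightA (w : ℤ → ℂ) : Module.End ℂ V :=
  opSum fun m : ℕ+ => w m • (Y.A (-(m : ℤ)) * Y.B (m : ℤ))

/-- The weighted number of excitations `B_{-m}`, `m > 0`. -/
def weightB (w : ℤ → ℂ) : Module.End ℂ V :=
  opSum fun m : ℕ+ => w m • (Y.B (-(m : ℤ)) * Y.A (m : ℤ))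

theorem AB_comm_A (m k : ℤ) : Y.A (-m) * Y.B m * Y.A k - Y.A k * (Y.A (-m) * Y.B m)
    = (if k + m = 0 then 2 * (m : ℂ) else 0) • Y.A (-m) := by
  have h1 := Y.A_comm_A (-m) k
  have h2 := Y.A_comm_B k m
  have e : Y.A (-m) * Y.B m * Y.A k - Y.A k * (Y.A (-m) * Y.B m)
      = (Y.A (-m) * Y.A k - Y.A k * Y.A (-m)) * Y.B m
        - Y.A (-m) * (Y.A k * Y.B m - Y.B m * Y.A k) := by noncomm_ring
  rw [e, h1, h2]
  split_ifs with h
  · obtain rfl : k = -m := by omega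
    simp
  · simp

theorem AB_comm_B (m k : ℤ) : Y.A (-m) * Y.B m * Y.B k - Y.B k * (Y.A (-m) * Y.B m)
    = (if -m + k = 0 then -2 * (m : ℂ) else 0) • Y.B m := by
  have h1 := Y.B_comm_B m k
  have h2 := Y.A_comm_B (-m) k
  have e : Y.A (-m) * Y.B m * Y.B k - Y.B k * (Y.A (-m) * Y.B m)
      = Y.A (-m) * (Y.B m * Y.B k - Y.B k * Y.B m)
        + (Y.A (-m) * Y.B k - Y.B k * Y.A (-m)) * Y.B m := by noncomm_ring
  rw [e, h1, h2]
  split_ifs with h <;> simp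

theorem BA_comm_A (m k : ℤ) : Y.B (-m) * Y.A m * Y.A k - Y.A k * (Y.B (-m) * Y.A m)
    = (if k + -m = 0 then -2 * (m : ℂ) else 0) • Y.A m := by
  have h1 := Y.A_comm_A m k
  have h2 := Y.A_comm_B k (-m)
  have e : Y.B (-m) * Y.A m * Y.A k - Y.A k * (Y.B (-m) * Y.A m)
      = Y.B (-m) * (Y.A m * Y.A k - Y.A k * Y.A m)
        - (Y.A k * Y.B (-m) - Y.B (-m) * Y.A k) * Y.A m := by noncomm_ring
  rw [e, h1, h2]
  split_ifs with h
  · obtain rfl : k = m := by omega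
    simp
  · simp

theorem BA_comm_B (m k : ℤ) : Y.B (-m) * Y.A m * Y.B k - Y.B k * (Y.B (-m) * Y.A m)
    = (if m + k = 0 then 2 * (m : ℂ) else 0) • Y.B (-m) := by
  have h1 := Y.B_comm_B (-m) k
  have h2 := Y.A_comm_B m k
  have e : Y.B (-m) * Y.A m * Y.B k - Y.B k * (Y.B (-m) * Y.A m)
      = Y.B (-m) * (Y.A m * Y.B k - Y.B k * Y.A m)
        + (Y.B (-m) * Y.B k - Y.B k * Y.B (-m)) * Y.A m := by noncomm_ring
  rw [e, h1, h2]
  split_ifs with h <;> simp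

/-- The commutator of a sum over `m > 0` only one of whose terms contributes. -/
theorem opSum_comm_pnat {T : ℕ+ → Module.End ℂ V} (hT : LocFin T) {Z : Module.End ℂ V}
    (f : ℤ → ℂ) (n : ℤ) (h : ∀ m : ℕ+, T m * Z - Z * T m = (if (m : ℤ) = n then f m else 0) • Z) :
    opSum T * Z - Z * opSum T = (if 0 < n then f n else 0) • Z := by
  split_ifs with hn
  · obtain ⟨l, rfl⟩ := exists_pnat hn
    refine opSum_commutator_single hT l (fun k hk => ?_) ?_
    · rw [h, if_neg (pnat_ne hk), zero_smul]
    · rw [h, if_pos rfl]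
  · rw [zero_smul]
    refine opSum_commutator_zero hT fun k => ?_
    have := k.pos
    rw [h, if_neg (by omega), zero_smul]

/-- Since [A_m, B_{-m}] = 2m, the excitation A_{-m} is counted with `2 m w(m)`. The weights `1 / (2
m)` in `lcCharge` therefore count each excitation once. -/
theorem weightA_comm_A (w : ℤ → ℂ) (k : ℤ) : Y.weightA w * Y.A k - Y.A k * Y.weightA w
    = (if 0 < -k then w (-k) * (2 * (-k : ℤ)) else 0) • Y.A k :=
  opSum_comm_pnat (Y.locFin_mul_B (fun m => w m) _) (fun m => w m * (2 * m)) (-k) fun m => by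
    rw [smul_mul_assoc, mul_smul_comm, ← smul_sub, AB_comm_A, smul_smul]
    by_cases h : k + m = 0
    · obtain rfl : k = -m := by omega
      simp
    · rw [if_neg h, if_neg (by omega)]
      simp

theorem weightA_comm_B (w : ℤ → ℂ) (k : ℤ) : Y.weightA w * Y.B k - Y.B k * Y.weightA w
    = (if 0 < k then w k * (-2 * (k : ℤ)) else 0) • Y.B k :=
  opSum_comm_pnat (Y.locFin_mul_B (fun m => w m) _) (fun m => w m * (-2 * m)) k fun m => by
    rw [smul_mul_assoc, mul_smul_comm, ← smul_sub, AB_comm_B, smul_smul]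
    by_cases h : -(m : ℤ) + k = 0
    · obtain rfl : k = m := by omega
      simp
    · rw [if_neg h, if_neg (by omega)]
      simp

theorem weightB_comm_A (w : ℤ → ℂ) (k : ℤ) : Y.weightB w * Y.A k - Y.A k * Y.weightB w
    = (if 0 < k then w k * (-2 * (k : ℤ)) else 0) • Y.A k :=
  opSum_comm_pnat (Y.locFin_mul_A (fun m => w m) _) (fun m => w m * (-2 * m)) k fun m => by
    rw [smul_mul_assoc, mul_smul_comm, ← smul_sub, BA_comm_A, smul_smul]
    by_cases h : k + -(m : ℤ) = 0
    · obtain rfl : k = m := by omega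
      simp
    · rw [if_neg h, if_neg (by omega)]
      simp

theorem weightB_comm_B (w : ℤ → ℂ) (k : ℤ) : Y.weightB w * Y.B k - Y.B k * Y.weightB w
    = (if 0 < -k then w (-k) * (2 * (-k : ℤ)) else 0) • Y.B k :=
  opSum_comm_pnat (Y.locFin_mul_A (fun m => w m) _) (fun m => w m * (2 * m)) (-k) fun m => by
    rw [smul_mul_assoc, mul_smul_comm, ← smul_sub, BA_comm_B, smul_smul]
    by_cases h : (m : ℤ) + k = 0
    · obtain rfl : k = -m := by omega
      simp
    · rw [if_neg h, if_neg (by omega)]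
      simp

theorem weightA_commute {Z : Module.End ℂ V} (hA : ∀ n, Y.A n * Z = Z * Y.A n)
    (hB : ∀ n, Y.B n * Z = Z * Y.B n) (w : ℤ → ℂ) : Y.weightA w * Z = Z * Y.weightA w :=
  opSum_commute (Y.locFin_mul_B (fun m => w m) _) fun m => by
    rw [smul_mul_assoc, mul_smul_comm, mul_assoc, hB, ← mul_assoc, hA, mul_assoc]

theorem weightB_commute {Z : Module.End ℂ V} (hA : ∀ n, Y.A n * Z = Z * Y.A n)
    (hB : ∀ n, Y.B n * Z = Z * Y.B n) (w : ℤ → ℂ) : Y.weightB w * Z = Z * Y.weightB w :=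
  opSum_commute (Y.locFin_mul_A (fun m => w m) _) fun m => by
    rw [smul_mul_assoc, mul_smul_comm, mul_assoc, hA, ← mul_assoc, hB, mul_assoc]

/-! ### The light-cone charge -/

/-- The charge counting `A` and `c` with sign `+`, and `B` and `b` with sign `-`. -/
def lcCharge : Module.End ℂ V :=
  Y.weightA (fun m => 1 / (2 * m)) - Y.weightB (fun m => 1 / (2 * m)) + X.ghostNumber

/-- The mode `k = 0` is excluded because A_0 is a scalar and has charge zero. The filtration
argument rests on this discrepancy. -/
theorem lcCharge_comm_A {k : ℤ} (hk : k ≠ 0) :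
    Y.lcCharge * Y.A k - Y.A k * Y.lcCharge = ((1 : ℤ) : ℂ) • Y.A k := by
  have h1 := Y.weightA_comm_A (fun m => 1 / (2 * m)) k
  have h2 := Y.weightB_comm_A (fun m => 1 / (2 * m)) k
  have h3 := Y.A_comm (fun i n => (X.ghostNumber_comm_a i n).symm) k
  have e : Y.lcCharge * Y.A k - Y.A k * Y.lcCharge
      = (Y.weightA (fun m => 1 / (2 * m)) * Y.A k - Y.A k * Y.weightA (fun m => 1 / (2 * m)))
        - (Y.weightB (fun m => 1 / (2 * m)) * Y.A k - Y.A k * Y.weightB (fun m => 1 / (2 * m)))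
        - (Y.A k * X.ghostNumber - X.ghostNumber * Y.A k) := by
    rw [lcCharge]; noncomm_ring
  have hk' : (k : ℂ) ≠ 0 := by exact_mod_cast hk
  rw [e, h1, h2, h3, sub_self, sub_zero, ← sub_smul]
  congr 1
  rcases lt_or_gt_of_ne hk with h | h
  · rw [if_pos (by omega), if_neg (by omega)]
    push_cast
    field_simp
    simp
  · rw [if_neg (by omega), if_pos (by omega)]
    push_cast
    field_simp
    simp

theorem lcCharge_comm_B {k : ℤ} (hk : k ≠ 0) :
    Y.lcCharge * Y.B k - Y.B k * Y.lcCharge = ((-1 : ℤ) : ℂ) • Y.B k := by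
  have h1 := Y.weightA_comm_B (fun m => 1 / (2 * m)) k
  have h2 := Y.weightB_comm_B (fun m => 1 / (2 * m)) k
  have h3 := Y.B_comm (fun i n => (X.ghostNumber_comm_a i n).symm) k
  have e : Y.lcCharge * Y.B k - Y.B k * Y.lcCharge
      = (Y.weightA (fun m => 1 / (2 * m)) * Y.B k - Y.B k * Y.weightA (fun m => 1 / (2 * m)))
        - (Y.weightB (fun m => 1 / (2 * m)) * Y.B k - Y.B k * Y.weightB (fun m => 1 / (2 * m)))
        - (Y.B k * X.ghostNumber - X.ghostNumber * Y.B k) := by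
    rw [lcCharge]; noncomm_ring
  have hk' : (k : ℂ) ≠ 0 := by exact_mod_cast hk
  rw [e, h1, h2, h3, sub_self, sub_zero, ← sub_smul]
  congr 1
  rcases lt_or_gt_of_ne hk with h | h
  · rw [if_neg (by omega), if_pos (by omega)]
    push_cast
    field_simp
    simp
  · rw [if_pos (by omega), if_neg (by omega)]
    push_cast
    field_simp
    simp

theorem lcCharge_comm {Z : Module.End ℂ V} (hA : ∀ n, Y.A n * Z = Z * Y.A n)
    (hB : ∀ n, Y.B n * Z = Z * Y.B n) :
    Y.lcCharge * Z - Z * Y.lcCharge = X.ghostNumber * Z - Z * X.ghostNumber := by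
  simp only [lcCharge, add_mul, sub_mul, mul_add, mul_sub, Y.weightA_commute hA hB,
    Y.weightB_commute hA hB]
  abel

theorem lcCharge_comm_a {i : ι} (h0 : i ≠ Y.time) (h1 : i ≠ Y.space) (n : ℤ) :
    Y.lcCharge * X.a i n - X.a i n * Y.lcCharge = ((0 : ℤ) : ℂ) • X.a i n := by
  rw [Y.lcCharge_comm (fun m => sub_eq_zero.1 (Y.A_comm_a h0 h1 m n))
    fun m => sub_eq_zero.1 (Y.B_comm_a h0 h1 m n), X.ghostNumber_comm_a]
  simp

theorem lcCharge_comm_c (n : ℤ) :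
    Y.lcCharge * X.c n - X.c n * Y.lcCharge = ((1 : ℤ) : ℂ) • X.c n := by
  rw [Y.lcCharge_comm (fun m => Y.A_comm_c m n) fun m => Y.B_comm_c m n, X.ghostNumber_comm_c]
  simp

theorem lcCharge_comm_b (n : ℤ) :
    Y.lcCharge * X.b n - X.b n * Y.lcCharge = ((-1 : ℤ) : ℂ) • X.b n := by
  rw [Y.lcCharge_comm (fun m => Y.A_comm_b m n) fun m => Y.B_comm_b m n, X.ghostNumber_comm_b]
  simp

theorem lcCharge_comm_ghostVir (n : ℤ) :
    Y.lcCharge * X.ghostVir n - X.ghostVir n * Y.lcCharge = ((0 : ℤ) : ℂ) • X.ghostVir n := by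
  have h := fun i k => (X.ghostVir_comm_a n i k).symm
  have h1 := X.ghostNumber_comm_Ltot n
  have h2 : X.ghostNumber * X.L n = X.L n * X.ghostNumber :=
    (X.L_commute (fun i k => (X.ghostNumber_comm_a i k).symm) n).symm
  rw [Y.lcCharge_comm (Y.A_comm h) (Y.B_comm h)]
  simp only [Ltot, mul_add, add_mul, mul_sub, sub_mul, h2, smul_mul_assoc, mul_smul_comm, one_mul,
    mul_one] at h1
  rw [Int.cast_zero, zero_smul, ← h1]
  abel

/-! ### Light-cone words -/

/-- The modes in the light-cone basis. -/
def mode (i : ι) : ℤ → Module.End ℂ V :=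
  if i = Y.time then Y.A else if i = Y.space then Y.B else X.a i

theorem mode_time : Y.mode Y.time = Y.A := if_pos rfl

theorem mode_space : Y.mode Y.space = Y.B := by
  rw [mode, if_neg Y.time_ne_space.symm, if_pos rfl]

theorem mode_of_ne {i : ι} (h0 : i ≠ Y.time) (h1 : i ≠ Y.space) : Y.mode i = X.a i := by
  rw [mode, if_neg h0, if_neg h1]

/-- The words in the light-cone creation operators. -/
def lcWord : List (Letter ι) → V := word (creator Y.mode X.c X.b) X.vac

theorem a_time (n : ℤ) : X.a Y.time n = (1 / 2 : ℂ) • (Y.A n - Y.B n) := by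
  rw [A, B]
  module

theorem a_space (n : ℤ) : X.a Y.space n = (Y.sign / 2) • (Y.A n + Y.B n) := by
  have e : X.a Y.space n = (Y.sign * Y.sign) • X.a Y.space n := by rw [Y.sign_mul_self, one_smul]
  rw [A, B]
  linear_combination (norm := module) e

/-- The original modes in the time and space directions are combinations of A and B, so a subspace
stable under the light-cone creators is stable under all creators. -/
theorem span_lcWord : Submodule.span ℂ (Set.range Y.lcWord) = ⊤ := by
  refine span_word_eq_top fun S h0 hS => X.cyclic S h0 fun x v hv => ?_
  have hA : ∀ k : ℕ+, Y.A (-(k : ℤ)) v ∈ S := fun k => by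
    have := hS (Sum.inl (Y.time, k)) v hv
    rwa [creator, Y.mode_time] at this
  have hB : ∀ k : ℕ+, Y.B (-(k : ℤ)) v ∈ S := fun k => by
    have := hS (Sum.inl (Y.space, k)) v hv
    rwa [creator, Y.mode_space] at this
  rcases x with ⟨i, k⟩ | x
  · rw [creator]
    by_cases h0 : i = Y.time
    · rw [h0, Y.a_time]
      exact S.smul_mem _ (S.sub_mem (hA k) (hB k))
    by_cases h1 : i = Y.space
    · rw [h1, Y.a_space]
      exact S.smul_mem _ (S.add_mem (hA k) (hB k))
    · have := hS (Sum.inl (i, k)) v hv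
      rwa [creator, Y.mode_of_ne h0 h1] at this
  · have := hS (Sum.inr x) v hv
    rcases x with k | k <;> exact this

theorem ext_lcWord {Z W : Module.End ℂ V} (h : ∀ l, Z (Y.lcWord l) = W (Y.lcWord l)) : Z = W :=
  LinearMap.ext_on_range Y.span_lcWord h

/-- The weight of a light-cone creation operator, given the weights of the modes. -/
def letterWeight (wA wB wc wb : ℕ → ℤ) : Letter ι → ℤ
  | Sum.inl (i, k) => if i = Y.time then wA k else if i = Y.space then wB k else 0
  | Sum.inr (Sum.inl k) => wc k
  | Sum.inr (Sum.inr k) => wb k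

theorem lcWord_eigen {O : Module.End ℂ V} {wA wB wc wb : ℕ → ℤ} (h0 : O X.vac = 0)
    (hA : ∀ k : ℕ+, O * Y.A (-(k : ℤ)) - Y.A (-(k : ℤ)) * O = (wA k : ℂ) • Y.A (-(k : ℤ)))
    (hB : ∀ k : ℕ+, O * Y.B (-(k : ℤ)) - Y.B (-(k : ℤ)) * O = (wB k : ℂ) • Y.B (-(k : ℤ)))
    (ha : ∀ i, i ≠ Y.time → i ≠ Y.space → ∀ n, O * X.a i n - X.a i n * O = 0)
    (hc : ∀ k : ℕ, O * X.c (-(k : ℤ)) - X.c (-(k : ℤ)) * O = (wc k : ℂ) • X.c (-(k : ℤ)))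
    (hb : ∀ k : ℕ+, O * X.b (-(k : ℤ)) - X.b (-(k : ℤ)) * O = (wb k : ℂ) • X.b (-(k : ℤ)))
    (l : List (Letter ι)) :
    O (Y.lcWord l) = (((l.map (Y.letterWeight wA wB wc wb)).sum : ℤ) : ℂ) • Y.lcWord l := by
  have := word_eigen (C := creator Y.mode X.c X.b) (vac := X.vac) (O := O) (o := 0)
    (w := fun x => (Y.letterWeight wA wB wc wb x : ℂ)) (by rw [h0, zero_smul]) ?_ l
  · rw [lcWord, this, zero_add, Int.cast_list_sum, List.map_map]
    rfl
  · rintro (⟨i, k⟩ | k | k)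
    · rw [creator, letterWeight]
      by_cases h0 : i = Y.time
      · rw [if_pos h0, h0, Y.mode_time, hA]
      by_cases h1 : i = Y.space
      · rw [if_neg h0, if_pos h1, h1, Y.mode_space, hB]
      · rw [if_neg h0, if_neg h1, Y.mode_of_ne h0 h1, ha i h0 h1]
        simp
    · exact hc k
    · exact hb k

theorem A_vac {n : ℤ} (hn : 0 < n) : Y.A n X.vac = 0 := Y.A_apply_eq_zero fun i => X.a_vac i n hn

theorem B_vac {n : ℤ} (hn : 0 < n) : Y.B n X.vac = 0 := Y.B_apply_eq_zero fun i => X.a_vac i n hn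

theorem weightA_vac (w : ℤ → ℂ) : Y.weightA w X.vac = 0 :=
  opSum_apply_eq_zero fun k => by
    rw [LinearMap.smul_apply, Module.End.mul_apply, Y.B_vac (by exact_mod_cast k.pos), map_zero,
      smul_zero]

theorem weightB_vac (w : ℤ → ℂ) : Y.weightB w X.vac = 0 :=
  opSum_apply_eq_zero fun k => by
    rw [LinearMap.smul_apply, Module.End.mul_apply, Y.A_vac (by exact_mod_cast k.pos), map_zero,
      smul_zero]

theorem lcCharge_vac : Y.lcCharge X.vac = 0 := by
  rw [lcCharge, GhostModes.ghostNumber]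
  simp [weightA_vac, weightB_vac, X.ghostDegree_of_b_eq_zero fun n hn => X.b_vac n hn.le,
    X.antighostDegree_of_c_eq_zero X.c_vac, X.b_vac 0 le_rfl]

theorem lcCharge_lcWord (l : List (Letter ι)) : Y.lcCharge (Y.lcWord l)
    = (((l.map (Y.letterWeight (fun _ => 1) (fun _ => -1) (fun _ => 1) fun _ => -1)).sum : ℤ) : ℂ)
      • Y.lcWord l :=
  Y.lcWord_eigen (wA := fun _ => 1) (wB := fun _ => -1) (wc := fun _ => 1) (wb := fun _ => -1)
    Y.lcCharge_vac (fun k => Y.lcCharge_comm_A (by have := k.pos; omega))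
    (fun k => Y.lcCharge_comm_B (by have := k.pos; omega))
    (fun i h0 h1 n => by rw [Y.lcCharge_comm_a h0 h1]; simp)
    (fun k => Y.lcCharge_comm_c _) (fun k => Y.lcCharge_comm_b _) l

theorem iSup_eigenspace_lcCharge :
    ⨆ k : ℤ, Module.End.eigenspace Y.lcCharge (k : ℂ) = ⊤ := by
  rw [eq_top_iff, ← Y.span_lcWord, Submodule.span_le]
  rintro _ ⟨l, rfl⟩
  exact Submodule.mem_iSup_of_mem _ (Module.End.mem_eigenspace_iff.2 (Y.lcCharge_lcWord l))

/-- Operators that are diagonal on the same spanning family commute, so these commutators need not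
be computed mode by mode. -/
theorem comm_of_eigen {Z W : Module.End ℂ V} {z w : List (Letter ι) → ℂ}
    (hZ : ∀ l, Z (Y.lcWord l) = z l • Y.lcWord l) (hW : ∀ l, W (Y.lcWord l) = w l • Y.lcWord l) :
    Z * W - W * Z = 0 :=
  sub_eq_zero.2 <| Y.ext_lcWord fun l => by
    rw [Module.End.mul_apply, Module.End.mul_apply, hZ, hW, map_smul, map_smul, hZ, hW, smul_comm]

end LightCone

end Fock

namespace Fock

variable {ι : Type*} [Fintype ι] [DecidableEq ι] {V : Type*} [AddCommGroup V] [Module ℂ V]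
  {X : Fock ι V}

/-- The relative ghost number. -/
def relNumber (X : Fock ι V) : Module.End ℂ V := X.ghostDegree - X.antighostDegree

/-- Outside the Liouville direction the modes are primary: [L_k, a_n] has no scalar term. -/
theorem D_comm_mode (X : Fock ι V) {i : ι} (hi : i ≠ X.liouville) (n : ℤ) :
    X.D * X.a i n - X.a i n * X.D = opSum fun k : ℤ => (-(n : ℂ)) • (X.a i (k + n) * X.c (-k)) := by
  have h1 := opSum_commutator X.locFin_diff (X.a i n)
  have h2 := X.ghostDiff_comm_a i n
  have h3 : ∀ k : ℤ, (X.L k - (if k = 0 then X.intercept else 0) • 1) * X.c (-k) * X.a i n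
      - X.a i n * ((X.L k - (if k = 0 then X.intercept else 0) • 1) * X.c (-k))
      = (-(n : ℂ)) • (X.a i (k + n) * X.c (-k)) := fun k => by
    have e := X.L_comm_a k i n
    rw [if_neg fun h => hi h.1, zero_smul, add_zero] at e
    rw [mul_assoc, ← X.a_comm_c, ← mul_assoc, ← mul_assoc, ← sub_mul, ← smul_mul_assoc, ← e]
    simp only [sub_mul, mul_sub, smul_mul_assoc, mul_smul_comm, one_mul, mul_one]
    abel
  rw [D, add_mul, mul_add, h2, add_sub_add_right_eq_sub, h1]
  simp only [h3]

namespace LightCone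

variable (Y : X.LightCone)

/-! ### Comparison of the constraints with the light-cone modes -/

theorem raises_A {n : ℤ} (hn : n ≠ 0) : Raises Y.lcCharge (Y.A n) 1 :=
  .of_commutator (Y.lcCharge_comm_A hn)

theorem raises_B {n : ℤ} (hn : n ≠ 0) : Raises Y.lcCharge (Y.B n) (-1) :=
  .of_commutator (Y.lcCharge_comm_B hn)

theorem raises_a {i : ι} (h0 : i ≠ Y.time) (h1 : i ≠ Y.space) (n : ℤ) :
    Raises Y.lcCharge (X.a i n) 0 :=
  .of_commutator (Y.lcCharge_comm_a h0 h1 n)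

theorem raises_c (n : ℤ) : Raises Y.lcCharge (X.c n) 1 := .of_commutator (Y.lcCharge_comm_c n)

theorem raises_b (n : ℤ) : Raises Y.lcCharge (X.b n) (-1) := .of_commutator (Y.lcCharge_comm_b n)

theorem A_mul_B_add (m n : ℤ) : Y.A m * Y.B n + Y.B m * Y.A n
    = (2 : ℂ) • (X.a Y.space m * X.a Y.space n - X.a Y.time m * X.a Y.time n) := by
  have h5 := Y.sign_mul_self
  simp only [A, B, sub_mul, mul_sub, add_mul, mul_add, smul_mul_assoc, mul_smul_comm, smul_sub,
    smul_add, smul_smul, h5, one_smul]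
  module

/-- The metric gives the two directions opposite signs, so they enter L_m as a difference of
squares, which factors through A and B. -/
theorem lc_normal (m n : ℤ) : X.matterNormal Y.space m n - X.matterNormal Y.time m n
    = (1 / 2 : ℂ) • (if m ≤ n then Y.A m * Y.B n + Y.B m * Y.A n
      else Y.A n * Y.B m + Y.B n * Y.A m) := by
  simp only [matterNormal]
  split_ifs <;> rw [A_mul_B_add] <;> module

theorem raises_AB {m n : ℤ} (hm : m ≠ 0) (hn : n ≠ 0) :
    Raises Y.lcCharge (Y.A m * Y.B n + Y.B m * Y.A n) 0 :=
  (((Y.raises_A hm).mul (Y.raises_B hn)).mono (by omega)).add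
    (((Y.raises_B hm).mul (Y.raises_A hn)).mono (by omega))

/-- As A_0 is the scalar `momentum`, its product with B_m has charge -1. Removing it leaves B_0 A_m,
which has charge one. Without zero modes the products of A and B have charge zero, so these are the
only terms of negative charge. -/
theorem zero_mode_AB {m : ℤ} (hm : m ≠ 0) :
    Raises Y.lcCharge (Y.A 0 * Y.B m + Y.B 0 * Y.A m - Y.momentum • Y.B m) 0 ∧
      Raises Y.lcCharge (Y.A m * Y.B 0 + Y.B m * Y.A 0 - Y.momentum • Y.B m) 0 := by
  rw [Y.A_zero, Y.B_zero]
  simp only [smul_mul_assoc, mul_smul_comm, one_mul, mul_one, add_sub_cancel_left,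
    add_sub_cancel_right]
  exact ⟨((Y.raises_A hm).smul _).mono (by omega), ((Y.raises_A hm).smul _).mono (by omega)⟩

theorem raises_lc_normal {m : ℤ} (hm : m ≠ 0) (k : ℤ) : Raises Y.lcCharge
    (X.matterNormal Y.space (m + k) (-k) - X.matterNormal Y.time (m + k) (-k)
      - if k = 0 ∨ k = -m then (Y.momentum / 2) • Y.B m else 0) 0 := by
  rw [lc_normal]
  by_cases hk : k = 0 ∨ k = -m
  · rw [if_pos hk]
    obtain ⟨h1, h2⟩ := Y.zero_mode_AB hm
    have e : ∀ Z : Module.End ℂ V, (1 / 2 : ℂ) • Z - (Y.momentum / 2) • Y.B m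
        = (1 / 2 : ℂ) • (Z - Y.momentum • Y.B m) := fun Z => by module
    rw [e]
    rcases hk with rfl | rfl
    · rw [add_zero, neg_zero]
      split_ifs
      · exact h2.smul _
      · exact h1.smul _
    · rw [add_neg_cancel, neg_neg]
      split_ifs
      · exact h1.smul _
      · exact h2.smul _
  · rw [if_neg hk, sub_zero]
    rw [not_or] at hk
    split_ifs
    · exact (Y.raises_AB (by omega) (by omega)).smul _
    · exact (Y.raises_AB (by omega) (by omega)).smul _

theorem raises_matterNormal {i : ι} (h0 : i ≠ Y.time) (h1 : i ≠ Y.space) (m n : ℤ) :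
    Raises Y.lcCharge (X.matterNormal i m n) 0 := by
  unfold matterNormal
  split_ifs
  · exact ((Y.raises_a h0 h1 m).mul (Y.raises_a h0 h1 n)).mono (by omega)
  · exact ((Y.raises_a h0 h1 n).mul (Y.raises_a h0 h1 m)).mono (by omega)

/-- Up to terms of higher charge, the constraint `L_m` is the light-cone mode `½ p^+ B_m`. -/
theorem raises_L {m : ℤ} (hm : m ≠ 0) :
    Raises Y.lcCharge (X.L m - (Y.momentum / 2) • Y.B m) 0 := by
  have hsum : ∑ i, X.metric i • opSum (fun k : ℤ => X.matterNormal i (m + k) (-k))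
      = opSum (fun k : ℤ => X.matterNormal Y.space (m + k) (-k)
        - X.matterNormal Y.time (m + k) (-k))
        + ∑ i ∈ (Finset.univ.erase Y.time).erase Y.space,
          X.metric i • opSum (fun k : ℤ => X.matterNormal i (m + k) (-k)) := by
    rw [← Finset.add_sum_erase _ _ (Finset.mem_univ Y.time),
      ← Finset.add_sum_erase (Finset.univ.erase Y.time) _
        (Finset.mem_erase.2 ⟨Y.time_ne_space.symm, Finset.mem_univ Y.space⟩),
      Y.metric_time, Y.metric_space,
      opSum_sub (X.locFin_matterNormal Y.space m) (X.locFin_matterNormal Y.time m)]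
    module
  -- The zero mode occurs in the two summands `k = 0` and `k = -m`; the sum of both, times the
  -- factor 1/2 in L_m, gives the coefficient `momentum / 2`.
  have hcorr : opSum (fun k : ℤ => if k = 0 ∨ k = -m then (Y.momentum / 2) • Y.B m else 0)
      = Y.momentum • Y.B m := by
    rw [opSum_eq_sum {0, -m} fun k hk => if_neg (by simpa using hk),
      Finset.sum_pair (by omega), if_pos (Or.inl rfl), if_pos (Or.inr rfl)]
    module
  have hlc : LocFin fun k : ℤ => if k = 0 ∨ k = -m then (Y.momentum / 2) • Y.B m else 0 :=
    .of_eq_zero {0, -m} fun k hk => if_neg (by simpa using hk)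
  have e : X.L m - (Y.momentum / 2) • Y.B m
      = (1 / 2 : ℂ) • opSum (fun k : ℤ => X.matterNormal Y.space (m + k) (-k)
          - X.matterNormal Y.time (m + k) (-k)
          - if k = 0 ∨ k = -m then (Y.momentum / 2) • Y.B m else 0)
        + (1 / 2 : ℂ) • ∑ i ∈ (Finset.univ.erase Y.time).erase Y.space,
          X.metric i • opSum (fun k : ℤ => X.matterNormal i (m + k) (-k))
        + (X.slope * m) • X.a X.liouville m := by
    rw [L, hsum, if_neg hm, opSum_sub ((X.locFin_matterNormal _ m).sub (X.locFin_matterNormal _ m))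
      hlc, hcorr]
    module
  rw [e]
  refine (((Raises.opSum fun k => Y.raises_lc_normal hm k).smul _).add
    ((Raises.sum _ fun i hi => ?_).smul _)).add ((Y.raises_a ?_ ?_ m).smul _)
  · simp only [Finset.mem_erase, Finset.mem_univ, and_true] at hi
    exact (Raises.opSum fun k => Y.raises_matterNormal hi.2 hi.1 _ _).smul _
  · exact Y.time_ne_liouville.symm
  · exact Y.space_ne_liouville.symm

theorem raises_Ltot {m : ℤ} (hm : m ≠ 0) :
    Raises Y.lcCharge (X.Ltot m - (Y.momentum / 2) • Y.B m) 0 := by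
  have e : X.Ltot m - (Y.momentum / 2) • Y.B m
      = (X.L m - (Y.momentum / 2) • Y.B m) + X.ghostVir m := by
    rw [Ltot, if_neg hm]
    module
  rw [e]
  exact (Y.raises_L hm).add (.of_commutator (Y.lcCharge_comm_ghostVir m))

/-! ### The contracting homotopy -/

/-- The homotopy `∑_{m>0} A_{-m} b_m`. -/
def homotopy : Module.End ℂ V := opSum fun m : ℕ+ => Y.A (-(m : ℤ)) * X.b (m : ℤ)

theorem locFin_homotopy : LocFin fun m : ℕ+ => Y.A (-(m : ℤ)) * X.b (m : ℤ) := by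
  simpa using X.locFin_mul_b (fun _ => 1) fun m : ℕ+ => Y.A (-(m : ℤ))

/-- The Laplacian of the homotopy. -/
def laplacian : Module.End ℂ V := X.D * Y.homotopy + Y.homotopy * X.D

/-- The leading term of the Laplacian. -/
def leading : Module.End ℂ V := Y.weightA (fun _ => 1) + X.ghostWeight fun m => 2 * m

theorem D_comm_A (n : ℤ) :
    X.D * Y.A n - Y.A n * X.D = opSum fun k : ℤ => (-(n : ℂ)) • (Y.A (k + n) * X.c (-k)) := by
  have hl : ∀ i, LocFin fun k : ℤ => (-(n : ℂ)) • (X.a i (k + n) * X.c (-k)) := fun i => by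
    refine LocFin.smul (T := fun k : ℤ => X.a i (k + n) * X.c (-k)) (.of_int_bound fun v => ?_) _
    obtain ⟨N, h0, hN⟩ := X.ghost_bound v
    obtain ⟨N', h0', hN'⟩ := X.matter_bound v
    refine ⟨max N (N' + |n|), fun k hk => ?_⟩
    have := neg_abs_le n
    rcases hk with hk | hk
    · rw [Module.End.mul_apply, ← Module.End.mul_apply, X.a_comm_c, Module.End.mul_apply,
        hN' _ (by omega), map_zero]
    · rw [Module.End.mul_apply, (hN _ (by omega)).1, map_zero]
  have h1 := X.D_comm_mode Y.time_ne_liouville n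
  have h2 := X.D_comm_mode Y.space_ne_liouville n
  have e : X.D * Y.A n - Y.A n * X.D = (X.D * X.a Y.time n - X.a Y.time n * X.D)
      + Y.sign • (X.D * X.a Y.space n - X.a Y.space n * X.D) := by
    simp only [A, add_mul, mul_add, smul_mul_assoc, mul_smul_comm]
    module
  rw [e, h1, h2, smul_opSum (hl _), ← opSum_add (hl _) ((hl _).smul _)]
  congr 1
  funext k
  rw [A, add_mul, smul_mul_assoc]
  module

/-- The summand `k = m` contains A_0 = `momentum` and is the subtracted term of charge one. In all
other summands A and c each contribute one unit of charge. -/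
theorem raises_D_comm_A {m : ℤ} (hm : 0 < m) : Raises Y.lcCharge
    (X.D * Y.A (-m) - Y.A (-m) * X.D - ((m : ℂ) * Y.momentum) • X.c (-m)) 2 := by
  have hl : LocFin fun k : ℤ => (-((-m : ℤ) : ℂ)) • (Y.A (k + -m) * X.c (-k)) := by
    refine LocFin.smul (T := fun k : ℤ => Y.A (k + -m) * X.c (-k)) (.of_int_bound fun v => ?_) _
    obtain ⟨N, h0, hN⟩ := X.ghost_bound v
    obtain ⟨N', h0', hN'⟩ := X.matter_bound v
    refine ⟨max N (N' + m), fun k hk => ?_⟩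
    rcases hk with hk | hk
    · rw [A_comm_c, Module.End.mul_apply, Y.A_apply_eq_zero (hN' _ (by omega)), map_zero]
    · rw [Module.End.mul_apply, (hN _ (by omega)).1, map_zero]
  have hs : LocFin fun k : ℤ => if k = m then ((m : ℂ) * Y.momentum) • X.c (-m) else 0 :=
    .of_eq_zero {m} fun k hk => if_neg (by simpa using hk)
  have e : ((m : ℂ) * Y.momentum) • X.c (-m)
      = opSum fun k : ℤ => if k = m then ((m : ℂ) * Y.momentum) • X.c (-m) else 0 := by
    rw [opSum_eq_single m fun k hk => if_neg hk, if_pos rfl]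
  rw [D_comm_A, e, ← opSum_sub hl hs]
  refine .opSum fun k => ?_
  split_ifs with hk
  · subst hk
    have : (-((-k : ℤ) : ℂ)) • (Y.A (k + -k) * X.c (-k)) - ((k : ℂ) * Y.momentum) • X.c (-k) = 0 := by
      rw [add_neg_cancel, A_zero, smul_mul_assoc, one_mul]
      push_cast
      module
    rw [this]
    exact .zero _ _
  · rw [sub_zero]
    exact ((Y.raises_A (by omega)).mul (Y.raises_c _)).smul _

/-- By the Leibniz rule and {D, b_m} = L_m^tot, each term of the Laplacian splits into two pieces
whose leading charges are known. -/
theorem laplacian_term (m : ℤ) :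
    X.D * (Y.A (-m) * X.b m) + Y.A (-m) * X.b m * X.D
      = Y.A (-m) * X.Ltot m + (X.D * Y.A (-m) - Y.A (-m) * X.D) * X.b m := by
  rw [← X.D_anticomm_b]
  noncomm_ring

/-- The leading term of the Laplacian is a multiple of a counting operator. -/
theorem raises_laplacian :
    Raises Y.lcCharge (Y.laplacian - (Y.momentum / 2) • Y.leading) 1 := by
  have h1 : Y.laplacian = opSum fun m : ℕ+ =>
      X.D * (Y.A (-(m : ℤ)) * X.b (m : ℤ)) + Y.A (-(m : ℤ)) * X.b (m : ℤ) * X.D := by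
    rw [laplacian, homotopy, add_comm, opSum_anticommutator Y.locFin_homotopy]
    simp only [add_comm]
  have hA : LocFin fun m : ℕ+ => (1 : ℂ) • (Y.A (-(m : ℤ)) * Y.B (m : ℤ)) :=
    Y.locFin_mul_B (fun _ => 1) _
  have hg : LocFin fun m : ℕ+ => (2 * ((m : ℤ) : ℂ)) • (X.c (-(m : ℤ)) * X.b (m : ℤ)) :=
    X.locFin_mul_b (fun m : ℕ+ => 2 * ((m : ℤ) : ℂ)) _
  have h2 : (Y.momentum / 2) • Y.leading = opSum fun m : ℕ+ =>
      (Y.momentum / 2) • ((1 : ℂ) • (Y.A (-(m : ℤ)) * Y.B (m : ℤ))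
        + (2 * ((m : ℤ) : ℂ)) • (X.c (-(m : ℤ)) * X.b (m : ℤ))) := by
    rw [leading, weightA, GhostModes.ghostWeight, ← opSum_add hA hg, smul_opSum (hA.add hg)]
  have hT : LocFin fun m : ℕ+ =>
      X.D * (Y.A (-(m : ℤ)) * X.b (m : ℤ)) + Y.A (-(m : ℤ)) * X.b (m : ℤ) * X.D :=
    (Y.locFin_homotopy.comp_left _).add (Y.locFin_homotopy.comp_right _)
  rw [h1, h2, ← opSum_sub hT ((hA.add hg).smul _)]
  refine .opSum fun m => ?_
  have hm : (0 : ℤ) < m := by exact_mod_cast m.pos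
  have e : X.D * (Y.A (-(m : ℤ)) * X.b (m : ℤ)) + Y.A (-(m : ℤ)) * X.b (m : ℤ) * X.D
      - (Y.momentum / 2) • ((1 : ℂ) • (Y.A (-(m : ℤ)) * Y.B (m : ℤ))
        + (2 * ((m : ℤ) : ℂ)) • (X.c (-(m : ℤ)) * X.b (m : ℤ)))
      = Y.A (-(m : ℤ)) * (X.Ltot m - (Y.momentum / 2) • Y.B m)
        + (X.D * Y.A (-(m : ℤ)) - Y.A (-(m : ℤ)) * X.D
          - (((m : ℤ) : ℂ) * Y.momentum) • X.c (-(m : ℤ))) * X.b m := by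
    rw [laplacian_term]
    simp only [mul_sub, sub_mul, smul_mul_assoc, mul_smul_comm]
    module
  rw [e]
  -- The charges add to 1 + 0 for the first product and to 2 - 1 for the second, one unit above the
  -- charge zero of the leading term.
  exact (((Y.raises_A (by omega)).mul (Y.raises_Ltot (by omega))).mono (by omega)).add
    (((Y.raises_D_comm_A hm).mul (Y.raises_b _)).mono (by omega))

/-! ### Injectivity -/

/-- Each letter A_{-k} and each letter c_{-k} counts with `2 k`. In particular c_0 does not count,
just as it does not enter the relative ghost number. -/
theorem leading_lcWord (l : List (Letter ι)) : Y.leading (Y.lcWord l)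
    = (((l.map (Y.letterWeight (fun k => 2 * k) (fun _ => 0) (fun k => 2 * k)
      fun _ => 0)).sum : ℤ) : ℂ) • Y.lcWord l := by
  have key : ∀ Z : Module.End ℂ V, Y.leading * Z - Z * Y.leading
      = (Y.weightA (fun _ => 1) * Z - Z * Y.weightA (fun _ => 1))
        + ((X.ghostWeight fun m => 2 * m) * Z - Z * X.ghostWeight fun m => 2 * m) := fun Z => by
    rw [leading]
    noncomm_ring
  have hgw : ∀ Z : Module.End ℂ V, (∀ n, X.b n * Z = Z * X.b n) → (∀ n, X.c n * Z = Z * X.c n) →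
      (X.ghostWeight fun m => 2 * m) * Z = Z * X.ghostWeight fun m => 2 * m := fun Z hb hc =>
    opSum_commute (X.locFin_mul_b (fun m : ℕ+ => 2 * ((m : ℤ) : ℂ)) _) fun m => by
      rw [smul_mul_assoc, mul_smul_comm, mul_assoc, hb, ← mul_assoc, hc, mul_assoc]
  refine Y.lcWord_eigen ?_ (fun k => ?_) (fun k => ?_) (fun i h0 h1 n => ?_) (fun k => ?_)
    (fun k => ?_) l
  · rw [leading, LinearMap.add_apply, weightA_vac, zero_add]
    refine opSum_apply_eq_zero fun k => ?_
    rw [LinearMap.smul_apply, Module.End.mul_apply, X.b_vac _ (by positivity), map_zero, smul_zero]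
  · have := k.pos
    rw [key, weightA_comm_A, if_pos (by omega), hgw _ (fun n => (Y.A_comm_b _ n).symm)
      fun n => (Y.A_comm_c _ n).symm, sub_self, add_zero]
    simp
  · have := k.pos
    rw [key, weightA_comm_B, if_neg (by omega), hgw _ (fun n => (Y.B_comm_b _ n).symm)
      fun n => (Y.B_comm_c _ n).symm]
    simp
  · rw [key, Y.weightA_commute (fun m => sub_eq_zero.1 (Y.A_comm_a h0 h1 m n))
      fun m => sub_eq_zero.1 (Y.B_comm_a h0 h1 m n), hgw _ (fun m => (X.a_comm_b i n m).symm)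
      fun m => (X.a_comm_c i n m).symm]
    simp
  · rw [key, Y.weightA_commute (fun m => Y.A_comm_c m _) fun m => Y.B_comm_c m _,
      X.ghostWeight_comm_c]
    split_ifs with h
    · simp
    · obtain rfl : k = 0 := by omega
      simp
  · have := k.pos
    rw [key, Y.weightA_commute (fun m => Y.A_comm_b m _) fun m => Y.B_comm_b m _,
      X.ghostWeight_comm_b, if_neg (by omega)]
    simp

theorem relNumber_lcWord (l : List (Letter ι)) : X.relNumber (Y.lcWord l)
    = (((l.map (Y.letterWeight (fun _ => 0) (fun _ => 0) (fun k => if k = 0 then 0 else 1)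
      fun _ => -1)).sum : ℤ) : ℂ) • Y.lcWord l := by
  have key : ∀ Z : Module.End ℂ V, X.relNumber * Z - Z * X.relNumber
      = (X.ghostDegree * Z - Z * X.ghostDegree)
        - (X.antighostDegree * Z - Z * X.antighostDegree) := fun Z => by
    rw [relNumber]
    noncomm_ring
  have hG := Y.A_comm (fun i n => (X.ghostDegree_comm_a i n).symm)
  have hG' := Y.A_comm (fun i n => (X.antighostDegree_comm_a i n).symm)
  have hH := Y.B_comm (fun i n => (X.ghostDegree_comm_a i n).symm)
  have hH' := Y.B_comm (fun i n => (X.antighostDegree_comm_a i n).symm)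
  refine Y.lcWord_eigen ?_ (fun k => ?_) (fun k => ?_) (fun i h0 h1 n => ?_) (fun k => ?_)
    (fun k => ?_) l
  · rw [relNumber, LinearMap.sub_apply, X.ghostDegree_of_b_eq_zero fun n hn => X.b_vac n hn.le,
      X.antighostDegree_of_c_eq_zero X.c_vac, sub_zero]
  · rw [key, hG, hG']
    simp
  · rw [key, hH, hH']
    simp
  · rw [key, X.ghostDegree_comm_a, X.antighostDegree_comm_a]
    simp
  · rw [key, X.ghostDegree_comm_c, X.antighostDegree_comm_c]
    rcases Nat.eq_zero_or_pos k with rfl | hk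
    · simp
    · rw [if_pos (by omega), if_neg (by omega), if_neg (by omega)]
      simp
  · have := k.pos
    rw [key, X.ghostDegree_comm_b, X.antighostDegree_comm_b, if_neg (by omega), if_pos (by omega)]
    simp

/-- The Laplacian is injective in positive relative ghost number. -/
theorem laplacian_injective {r : ℤ} (hr : 0 < r) {v : V} (hv : X.relNumber v = (r : ℂ) • v)
    (h0 : Y.laplacian v = 0) : v = 0 := by
  have hmom : Y.momentum / 2 ≠ 0 := div_ne_zero Y.momentum_ne_zero two_ne_zero
  refine eq_zero_of_lowest (G := (Y.momentum / 2) • Y.leading) (g := 0)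
    (R := Y.laplacian - (Y.momentum / 2) • Y.leading) Y.iSup_eigenspace_lcCharge
    (Y.comm_of_eigen Y.lcCharge_lcWord Y.relNumber_lcWord) ?_ Y.raises_laplacian ?_ hv
    (by rw [add_sub_cancel, h0])
  · rw [mul_smul_comm, smul_mul_assoc, ← smul_sub,
      Y.comm_of_eigen Y.lcCharge_lcWord Y.leading_lcWord]
    simp
  · intro y hy hQ
    rw [LinearMap.smul_apply, smul_eq_zero_iff_right hmom] at hQ
    -- A letter c_{-k} with `k > 0` adds 1 to the relative ghost number but `2 k` to the leading
    -- operator, and every other letter adds at least as much to the latter as to the former. So the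
    -- difference has no positive eigenvalue, while on `y` it would be `r > 0`.
    refine eq_zero_of_eigen Y.span_lcWord (O := X.relNumber - Y.leading) (μ := r)
      (ev := fun l => ((l.map (Y.letterWeight (fun _ => 0) (fun _ => 0)
        (fun k => if k = 0 then 0 else 1) fun _ => -1)).sum : ℤ)
        - ((l.map (Y.letterWeight (fun k => 2 * k) (fun _ => 0) (fun k => 2 * k)
          fun _ => 0)).sum : ℤ)) (fun l => ?_) (by simp [hy, hQ]) fun l hl => ?_
    · rw [LinearMap.sub_apply, relNumber_lcWord, leading_lcWord, sub_smul]
    · rw [← Int.cast_sub, Int.cast_inj] at hl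
      have hle : (l.map (Y.letterWeight (fun _ => 0) (fun _ => 0)
          (fun k => if k = 0 then 0 else 1) fun _ => -1)).sum
          ≤ (l.map (Y.letterWeight (fun k => 2 * k) (fun _ => 0) (fun k => 2 * k)
            fun _ => 0)).sum := by
        refine List.sum_le_sum fun x _ => ?_
        rcases x with ⟨i, k⟩ | k | k <;> simp only [letterWeight] <;> (try split_ifs) <;> omega
      omega

/-- The operator B_{-1} A_1 is twice the number of excitations B_{-1} and has no negative
eigenvalue. If B_{-1} v = 0, then [A_1, B_{-1}] = 2 makes `v` an eigenvector with eigenvalue -2. -/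
theorem B_neg_one_injective {v : V} (h0 : Y.B (-1) v = 0) : v = 0 := by
  have hO : ∀ l, (Y.B (-1) * Y.A 1) (Y.lcWord l) = (((l.map (Y.letterWeight (fun _ => 0)
      (fun k => if k = 1 then 2 else 0) (fun _ => 0) fun _ => 0)).sum : ℤ) : ℂ) • Y.lcWord l := by
    refine Y.lcWord_eigen ?_ (fun k => ?_) (fun k => ?_) (fun i h0 h1 n => ?_) (fun k => ?_)
      (fun k => ?_)
    · rw [Module.End.mul_apply, Y.A_vac one_pos, map_zero]
    · have := k.pos
      rw [BA_comm_A, if_neg (by omega)]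
      simp
    · rw [BA_comm_B]
      by_cases hk : (k : ℕ) = 1
      · rw [hk]
        simp
      · rw [if_neg (by omega), if_neg hk]
        simp
    · have h2 := Y.A_comm_a h0 h1 1 n
      have h3 := Y.B_comm_a h0 h1 (-1) n
      linear_combination (norm := noncomm_ring) Y.B (-1) * h2 + h3 * Y.A 1
    · have h2 := Y.A_comm_c 1 (-k)
      have h3 := Y.B_comm_c (-1) (-k)
      rw [mul_assoc, h2, ← mul_assoc, h3]
      simp [mul_assoc]
    · have h2 := Y.A_comm_b 1 (-k)
      have h3 := Y.B_comm_b (-1) (-k)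
      rw [mul_assoc, h2, ← mul_assoc, h3]
      simp [mul_assoc]
  have h1 := apply_of_commutator (Y.A_comm_B 1 (-1)) v
  rw [h0, map_zero, if_pos (by norm_num)] at h1
  refine eq_zero_of_eigen Y.span_lcWord hO (μ := ((-2 : ℤ) : ℂ)) (y := v) ?_ fun l hl => ?_
  · rw [Module.End.mul_apply, eq_neg_of_add_eq_zero_left h1.symm]
    simp
  · rw [Int.cast_inj] at hl
    have : 0 ≤ (l.map (Y.letterWeight (fun _ => 0) (fun k => if k = 1 then 2 else 0) (fun _ => 0)
        fun _ => 0)).sum := by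
      refine List.sum_nonneg fun x hx => ?_
      obtain ⟨x, -, rfl⟩ := List.mem_map.1 hx
      rcases x with ⟨i, k⟩ | k | k <;> simp only [letterWeight] <;> (try split_ifs) <;> omega
    omega

/-- The part of L_{-1} of lowest charge is a non-zero multiple of B_{-1}, which is injective. No
further grading is needed, so `N = 0` and `r = 0` are taken. -/
theorem L_neg_one_injective (Y : X.LightCone) {v : V} (h0 : X.L (-1) v = 0) : v = 0 := by
  have hmom : Y.momentum / 2 ≠ 0 := div_ne_zero Y.momentum_ne_zero two_ne_zero
  refine eq_zero_of_lowest (G := (Y.momentum / 2) • Y.B (-1)) (g := -1) (N := 0) (r := 0)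
    (R := X.L (-1) - (Y.momentum / 2) • Y.B (-1)) Y.iSup_eigenspace_lcCharge
    (by simp) ?_ ((Y.raises_L (by decide)).mono (by decide)) ?_ (by simp) (by rw [add_sub_cancel, h0])
  · rw [mul_smul_comm, smul_mul_assoc, ← smul_sub, Y.lcCharge_comm_B (by decide), smul_comm]
  · intro y _ hy
    rw [LinearMap.smul_apply, smul_eq_zero_iff_right hmom] at hy
    exact Y.B_neg_one_injective hy

end LightCone

end Fock

/-! ### The ghost relations applied to vectors -/

namespace GhostModes

variable {V : Type*} [AddCommGroup V] [Module ℂ V] {G : GhostModes V}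

theorem c_b_apply (m n : ℤ) (v : V) :
    G.c m (G.b n v) = (if m + n = 0 then v else 0) - G.b n (G.c m v) := by
  rw [Fock.apply_of_anticommutator (G.c_add_b m n)]
  split_ifs <;> simp

theorem b_c_apply (m n : ℤ) (v : V) :
    G.b n (G.c m v) = (if m + n = 0 then v else 0) - G.c m (G.b n v) := by
  rw [c_b_apply]
  abel

theorem c_c_apply (m n : ℤ) (v : V) : G.c m (G.c n v) = -G.c n (G.c m v) := by
  rw [Fock.apply_of_anticommutator (G.c_add_c m n), LinearMap.zero_apply, zero_sub]

theorem b_b_apply (m n : ℤ) (v : V) : G.b m (G.b n v) = -G.b n (G.b m v) := by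
  rw [Fock.apply_of_anticommutator (G.b_add_b m n), LinearMap.zero_apply, zero_sub]

theorem c_c_self (n : ℤ) (v : V) : G.c n (G.c n v) = 0 := by
  have h : (2 : ℂ) • G.c n (G.c n v) = 0 := by
    linear_combination (norm := module) G.c_c_apply n n v
  simpa using h

theorem b_b_self (n : ℤ) (v : V) : G.b n (G.b n v) = 0 := by
  have h : (2 : ℂ) • G.b n (G.b n v) = 0 := by
    linear_combination (norm := module) G.b_b_apply n n v
  simpa using h

end GhostModes

namespace Fock

open GhostModes

variable {ι : Type*} [Fintype ι] [DecidableEq ι] {V : Type*} [AddCommGroup V] [Module ℂ V]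
  (X : Fock ι V)

/-! ### States without ghost excitations -/

/-- The vectors without ghost excitations. -/
def bare : Submodule ℂ V where
  carrier := {v | (∀ n, 0 < n → X.c n v = 0) ∧ ∀ n, 0 ≤ n → X.b n v = 0}
  zero_mem' := by simp
  add_mem' := fun hv hw => ⟨fun n hn => by rw [map_add, hv.1 n hn, hw.1 n hn, add_zero],
    fun n hn => by rw [map_add, hv.2 n hn, hw.2 n hn, add_zero]⟩
  smul_mem' := fun s v hv => ⟨fun n hn => by rw [map_smul, hv.1 n hn, smul_zero],
    fun n hn => by rw [map_smul, hv.2 n hn, smul_zero]⟩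

variable {X}

theorem b_D_apply (n : ℤ) (v : V) : X.b n (X.D v) = X.Ltot n v - X.D (X.b n v) := by
  rw [← X.D_anticomm_b n]
  simp

theorem D_b_apply (n : ℤ) (v : V) : X.D (X.b n v) = X.Ltot n v - X.b n (X.D v) := by
  rw [← X.D_anticomm_b n]
  simp

theorem L_mem_bare {v : V} (hv : v ∈ X.bare) (m : ℤ) : X.L m v ∈ X.bare :=
  ⟨fun n hn => by rw [← Module.End.mul_apply, ← X.L_comm_c, Module.End.mul_apply, hv.1 n hn, map_zero],
    fun n hn => by rw [← Module.End.mul_apply, ← X.L_comm_b, Module.End.mul_apply, hv.2 n hn, map_zero]⟩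

theorem ghostNumber_of_bare {v : V} (hv : v ∈ X.bare) : X.ghostNumber v = 0 := by
  rw [GhostModes.ghostNumber]
  simp [X.ghostDegree_of_b_eq_zero fun n hn => hv.2 n hn.le,
    X.antighostDegree_of_c_eq_zero hv.1, hv.2 0 le_rfl]

theorem Ltot_of_bare {v : V} (hv : v ∈ X.bare) {m : ℤ} (hm : 0 ≤ m) :
    X.Ltot m v = X.L m v - (if m = 0 then X.intercept else 0) • v := by
  rw [Ltot, LinearMap.sub_apply, LinearMap.add_apply, X.ghostVir_vac hv.1 hv.2 hm, add_zero,
    LinearMap.smul_apply, Module.End.one_apply]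

theorem Ltot_neg_one_of_bare {v : V} (hv : v ∈ X.bare) :
    X.Ltot (-1) v = X.L (-1) v + X.c 0 (X.b (-1) v) := by
  have h : X.ghostVir (-1) v = X.c 0 (X.b (-1) v) := by
    refine (opSum_apply_eq_single (X.locFin_ghostVir (-1)) 0 fun k hk => ?_).trans ?_
    · rw [LinearMap.smul_apply, GhostModes.normal, if_neg (by omega)]
      split_ifs with h
      · rw [LinearMap.neg_apply, Module.End.mul_apply, hv.1 _ h, map_zero, neg_zero, smul_zero]
      · rw [Module.End.mul_apply, hv.2 _ (by omega), map_zero, smul_zero]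
    · simp [GhostModes.normal]
  rw [Ltot, if_neg (by decide), zero_smul, sub_zero, LinearMap.add_apply, h]

theorem ghostNumber_c_apply {v : V} {s : ℂ} (hv : X.ghostNumber v = s • v) (n : ℤ) :
    X.ghostNumber (X.c n v) = (s + 1) • X.c n v := by
  rw [apply_of_commutator (X.ghostNumber_comm_c n), hv, map_smul]
  module

theorem ghostNumber_b_apply {v : V} {s : ℂ} (hv : X.ghostNumber v = s • v) (n : ℤ) :
    X.ghostNumber (X.b n v) = (s - 1) • X.b n v := by
  rw [apply_of_commutator (X.ghostNumber_comm_b n), hv, map_smul, LinearMap.neg_apply]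
  module

theorem ghostNumber_D_apply {v : V} {s : ℂ} (hv : X.ghostNumber v = s • v) :
    X.ghostNumber (X.D v) = (s + 1) • X.D v := by
  rw [apply_of_commutator X.ghostNumber_comm_D, hv, map_smul]
  module

/-- For `n > 0` the vector b_n v still has no antighosts, but its ghost number is -1, so it
vanishes. -/
theorem mem_bare_of_c {v : V} (hc : ∀ n, 0 < n → X.c n v = 0) (h0 : X.b 0 v = 0)
    (hN : X.ghostNumber v = 0) : v ∈ X.bare := by
  refine ⟨hc, fun n hn => ?_⟩
  rcases hn.eq_or_lt with rfl | hn
  · exact h0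
  refine X.eq_zero_of_ghostNumber_neg (s := -1) (fun m hm => ?_) (by decide) ?_
  · rw [c_b_apply, if_neg (by omega), hc m hm, map_zero, sub_zero]
  · rw [ghostNumber_b_apply (s := 0) (by rw [hN, zero_smul])]
    simp

/-- The physical state conditions. -/
theorem D_eq_zero_iff_of_bare {v : V} (hv : v ∈ X.bare) : X.D v = 0 ↔
    ∀ m : ℤ, 0 ≤ m → X.L m v = (if m = 0 then X.intercept else 0) • v := by
  have hb : ∀ m : ℤ, 0 ≤ m →
      X.b m (X.D v) = X.L m v - (if m = 0 then X.intercept else 0) • v := fun m hm => by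
    rw [b_D_apply, hv.2 m hm, map_zero, sub_zero, Ltot_of_bare hv hm]
  refine ⟨fun h m hm => ?_, fun h => ?_⟩
  · rw [← sub_eq_zero, ← hb m hm, h, map_zero]
  -- The vector `D v` has ghost number one. If all b_m with `m ≥ 0` kill it, it has no ghosts, and
  -- so it must vanish.
  · refine X.eq_zero_of_ghostNumber_pos (s := 1) (fun m hm => ?_) one_pos ?_
    · rw [hb m hm, h m hm, sub_self]
    · rw [ghostNumber_D_apply (s := 0) (by rw [ghostNumber_of_bare hv, zero_smul])]
      simp

/-! ### The polarized relative complex -/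

variable (X)

/-- The vectors annihilated by the commutators `[L_m, D]`, `m ≥ 0`. -/
def pol : Submodule ℂ V := ⨅ m : ℕ, LinearMap.ker (X.Ltot m * X.D - X.D * X.Ltot m)

/-- The polarized cochains without the ghost zero mode. -/
def polNoZero : Submodule ℂ V := X.pol ⊓ LinearMap.ker (X.b 0)

/-- The polarized relative complex. -/
def polRel : Submodule ℂ V := X.polNoZero ⊓ LinearMap.ker (X.Ltot 0)

/-- The polarized relative cochains of relative ghost number `r`. -/
def polRelDeg (r : ℤ) : Submodule ℂ V :=
  X.polRel ⊓ LinearMap.ker (X.relNumber - (r : ℂ) • 1)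

variable {X}

/-- The defining commutators are κ(m) c_m, and `m = 0` imposes nothing because κ(0) = 0. -/
theorem mem_pol {v : V} : v ∈ X.pol ↔ ∀ m : ℤ, 0 < m → X.kappa m ≠ 0 → X.c m v = 0 := by
  simp only [pol, Submodule.mem_iInf, LinearMap.mem_ker, X.Ltot_comm_D, LinearMap.smul_apply,
    smul_eq_zero]
  refine ⟨fun h m hm hk => ?_, fun h m => ?_⟩
  · lift m to ℕ using hm.le
    exact (h m).resolve_left hk
  · rcases Nat.eq_zero_or_pos m with rfl | hm
    · simp
    · exact or_iff_not_imp_left.2 fun hk => h m (by exact_mod_cast hm) hk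

theorem bare_le_polNoZero : X.bare ≤ X.polNoZero := fun _ hv =>
  ⟨mem_pol.2 fun m hm _ => hv.1 m hm, hv.2 0 le_rfl⟩

theorem relNumber_of_b {v : V} (hv : X.b 0 v = 0) : X.relNumber v = X.ghostNumber v := by
  rw [relNumber, GhostModes.ghostNumber, LinearMap.add_apply, Module.End.mul_apply, hv, map_zero,
    add_zero]

theorem mem_polRelDeg {r : ℤ} {v : V} : v ∈ X.polRelDeg r ↔
    v ∈ X.pol ∧ X.b 0 v = 0 ∧ X.Ltot 0 v = 0 ∧ X.ghostNumber v = (r : ℂ) • v := by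
  simp only [polRelDeg, polRel, polNoZero, Submodule.mem_inf, LinearMap.mem_ker,
    LinearMap.sub_apply, LinearMap.smul_apply, Module.End.one_apply, sub_eq_zero, and_assoc]
  refine and_congr_right fun _ => and_congr_right fun hb => ?_
  rw [relNumber_of_b hb]

/-- When b_0 v = 0, the extra term c_0 b_0 in the level drops out, and the mass-shell condition
fixes the level to be the intercept. -/
theorem finiteDimensional_polRelDeg (r : ℤ) : FiniteDimensional ℂ (X.polRelDeg r) := by
  have := X.finiteDimensional_eigenspace_level X.intercept
  refine Submodule.finiteDimensional_of_le (S₂ := Module.End.eigenspace X.level X.intercept)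
    fun v hv => ?_
  obtain ⟨-, hb, hL, -⟩ := mem_polRelDeg.1 hv
  rw [Module.End.mem_eigenspace_iff, level]
  simp only [Ltot, if_true, LinearMap.sub_apply, LinearMap.add_apply, LinearMap.smul_apply,
    Module.End.one_apply] at hL
  simp only [LinearMap.add_apply, Module.End.mul_apply, hb, map_zero, add_zero]
  exact sub_eq_zero.1 hL

theorem c_of_mem_pol (hκ : ∀ m : ℤ, 2 ≤ m → X.kappa m ≠ 0) {v : V} (hv : v ∈ X.pol) {m : ℤ}
    (hm : 2 ≤ m) : X.c m v = 0 := mem_pol.1 hv m (by omega) (hκ m hm)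

theorem anomalyOp_of_mem_pol {v : V} (hv : v ∈ X.pol) : X.anomalyOp v = 0 :=
  opSum_apply_eq_zero fun m => by
    rw [LinearMap.smul_apply, Module.End.mul_apply, smul_eq_zero, or_iff_not_imp_left]
    intro hm
    rw [mem_pol.1 hv m (by positivity) hm, map_zero]

theorem D_D_apply {v : V} (hv : v ∈ X.pol) : X.D (X.D v) = 0 := by
  rw [← Module.End.mul_apply, X.D_mul_D, anomalyOp_of_mem_pol hv]

/-- Moving L_m^tot past c_k produces a multiple of c_{m+k}, and `m + k ≥ 2`. -/
theorem Ltot_mem_pol (hκ : ∀ m : ℤ, 2 ≤ m → X.kappa m ≠ 0) {v : V} (hv : v ∈ X.pol) {m : ℤ}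
    (hm : 0 < m) : X.Ltot m v ∈ X.pol := by
  refine mem_pol.2 fun k hk hk' => ?_
  have h := apply_of_commutator (X.Ltot_comm_c m k) v
  rw [mem_pol.1 hv k hk hk', map_zero, LinearMap.smul_apply,
    c_of_mem_pol hκ hv (by omega : 2 ≤ m + k), smul_zero, add_zero] at h
  exact h.symm

/-- For κ(m) ≠ 0 the vector κ(m) c_m D v is [L_m^tot, D] D v. Since D² v = 0 and L_m^tot D v = D
L_m^tot v, it equals -D² L_m^tot v, and this vanishes because L_m^tot v is polarized. -/
theorem D_mem_pol (hκ : ∀ m : ℤ, 2 ≤ m → X.kappa m ≠ 0) {v : V} (hv : v ∈ X.pol) :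
    X.D v ∈ X.pol := by
  refine mem_pol.2 fun m hm hk => ?_
  have h1 := apply_of_commutator (X.Ltot_comm_D m) (X.D v)
  have h2 := apply_of_commutator (X.Ltot_comm_D m) v
  rw [LinearMap.smul_apply, mem_pol.1 hv m hm hk, smul_zero, add_zero] at h2
  rw [D_D_apply hv, map_zero, h2, D_D_apply (Ltot_mem_pol hκ hv hm), zero_add, LinearMap.smul_apply,
    eq_comm, smul_eq_zero_iff_right hk] at h1
  exact h1

theorem D_mem_polRelDeg (hκ : ∀ m : ℤ, 2 ≤ m → X.kappa m ≠ 0) {r : ℤ} {v : V}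
    (hv : v ∈ X.polRelDeg r) : X.D v ∈ X.polRelDeg (r + 1) := by
  obtain ⟨hP, hb, hL, hN⟩ := mem_polRelDeg.1 hv
  refine mem_polRelDeg.2 ⟨D_mem_pol hκ hP, ?_, ?_, ?_⟩
  · rw [b_D_apply, hL, hb, map_zero, sub_zero]
  · rw [apply_of_commutator (X.Ltot_comm_D 0), hL]
    simp
  · rw [ghostNumber_D_apply hN]
    push_cast
    rfl

/-! ### The homotopy on the relative complex -/

namespace LightCone

variable (Y : X.LightCone)

/-- The homotopy contains only b_m with `m > 0`, which are paired with the creators c_{-m}.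
Anticommuting with the c_n, `n > 0`, it preserves the polarization. -/
theorem homotopy_anticomm_c {n : ℤ} (hn : 0 ≤ n) : Y.homotopy * X.c n + X.c n * Y.homotopy = 0 := by
  rw [homotopy, opSum_anticommutator Y.locFin_homotopy]
  refine opSum_eq_zero fun m => ?_
  have h := X.c_add_b n m
  have := m.pos
  rw [if_neg (by omega)] at h
  rw [← mul_assoc, ← Y.A_comm_c, mul_assoc, mul_assoc, ← mul_add, add_comm, h, mul_zero]

theorem homotopy_anticomm_b (n : ℤ) : Y.homotopy * X.b n + X.b n * Y.homotopy = 0 := by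
  rw [homotopy, opSum_anticommutator Y.locFin_homotopy]
  refine opSum_eq_zero fun m => ?_
  rw [← mul_assoc, ← Y.A_comm_b, mul_assoc, mul_assoc, ← mul_add, X.b_add_b, mul_zero]

theorem Ltot_zero_comm_A (n : ℤ) :
    Y.A n * X.Ltot 0 - X.Ltot 0 * Y.A n = (n : ℂ) • Y.A n := by
  have h1 := X.L_comm_a 0 Y.time n
  have h2 := X.L_comm_a 0 Y.space n
  have h3 := Y.A_comm (fun i k => (X.ghostVir_comm_a 0 i k).symm) n
  rw [if_neg fun h => Y.time_ne_liouville h.1, zero_add] at h1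
  rw [if_neg fun h => Y.space_ne_liouville h.1, zero_add] at h2
  simp only [Ltot, mul_add, add_mul, mul_sub, sub_mul, h3, mul_smul_comm, smul_mul_assoc, mul_one,
    one_mul]
  simp only [A, add_mul, mul_add, smul_mul_assoc, mul_smul_comm]
  linear_combination (norm := module) -h1 - Y.sign • h2

theorem homotopy_comm_Ltot_zero : Y.homotopy * X.Ltot 0 - X.Ltot 0 * Y.homotopy = 0 := by
  rw [homotopy]
  refine opSum_commutator_zero Y.locFin_homotopy fun m => ?_
  have h1 := Y.Ltot_zero_comm_A (-m)
  have h2 := X.Ltot_comm_b 0 m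
  have e : Y.A (-(m : ℤ)) * X.b m * X.Ltot 0 - X.Ltot 0 * (Y.A (-(m : ℤ)) * X.b m)
      = (Y.A (-(m : ℤ)) * X.Ltot 0 - X.Ltot 0 * Y.A (-(m : ℤ))) * X.b m
        - Y.A (-(m : ℤ)) * (X.Ltot 0 * X.b m - X.b m * X.Ltot 0) := by noncomm_ring
  rw [e, h1, h2, zero_add, smul_mul_assoc, mul_smul_comm]
  push_cast
  module

theorem homotopy_comm_ghostNumber :
    Y.homotopy * X.ghostNumber - X.ghostNumber * Y.homotopy = Y.homotopy := by
  rw [homotopy, opSum_commutator Y.locFin_homotopy]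
  congr 1
  funext m
  have h1 := Y.A_comm (fun i n => (X.ghostNumber_comm_a i n).symm) (-m)
  have h2 := X.ghostNumber_comm_b m
  linear_combination (norm := noncomm_ring) -Y.A (-(m : ℤ)) * h2 + h1 * X.b m

theorem homotopy_mem_polRelDeg {r : ℤ} {v : V} (hv : v ∈ X.polRelDeg r) :
    Y.homotopy v ∈ X.polRelDeg (r - 1) := by
  obtain ⟨hP, hb, hL, hN⟩ := mem_polRelDeg.1 hv
  refine mem_polRelDeg.2 ⟨mem_pol.2 fun m hm hk => ?_, ?_, ?_, ?_⟩
  · have := apply_of_anticommutator (Y.homotopy_anticomm_c hm.le) v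
    rw [mem_pol.1 hP m hm hk, map_zero, LinearMap.zero_apply, zero_sub] at this
    exact neg_eq_zero.1 this.symm
  · have := apply_of_anticommutator (Y.homotopy_anticomm_b 0) v
    rw [hb, map_zero, LinearMap.zero_apply, zero_sub] at this
    exact neg_eq_zero.1 this.symm
  · have := apply_of_commutator Y.homotopy_comm_Ltot_zero v
    rw [hL, map_zero, LinearMap.zero_apply, add_zero] at this
    exact this.symm
  · have := apply_of_commutator Y.homotopy_comm_ghostNumber v
    rw [hN, map_smul] at this
    push_cast
    rw [sub_smul, this, one_smul, add_sub_cancel_right]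

theorem laplacian_of_cocycle {v : V} (hv : X.D v = 0) : Y.laplacian v = X.D (Y.homotopy v) := by
  simp [laplacian, hv]

theorem laplacian_mem (hκ : ∀ m : ℤ, 2 ≤ m → X.kappa m ≠ 0) {r : ℤ} {v : V}
    (hv : v ∈ X.polRelDeg r ⊓ LinearMap.ker X.D) :
    Y.laplacian v ∈ X.polRelDeg r ⊓ LinearMap.ker X.D := by
  have h1 := Y.homotopy_mem_polRelDeg hv.1
  rw [Y.laplacian_of_cocycle hv.2]
  have h2 := D_mem_polRelDeg hκ h1
  rw [sub_add_cancel] at h2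
  exact ⟨h2, D_D_apply (mem_polRelDeg.1 h1).1⟩

/-- An injective endomorphism of a finite-dimensional subspace is surjective. -/
theorem _root_.MassiveString.exists_preimage {T : Module.End ℂ V} (S : Submodule ℂ V)
    [FiniteDimensional ℂ S] (hT : ∀ v ∈ S, T v ∈ S) (hinj : ∀ v ∈ S, T v = 0 → v = 0) {v : V}
    (hv : v ∈ S) : ∃ w ∈ S, T w = v := by
  have hi : Function.Injective (T.restrict hT) := by
    rw [← LinearMap.ker_eq_bot, LinearMap.ker_eq_bot']
    intro w hw
    exact Subtype.ext (hinj w w.2 (congrArg Subtype.val hw))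
  obtain ⟨w, hw⟩ := LinearMap.injective_iff_surjective.1 hi ⟨v, hv⟩
  exact ⟨w, w.2, congrArg Subtype.val hw⟩

/-- The relative cohomology vanishes in positive degrees. -/
theorem exact_of_pos (Y : X.LightCone) (hκ : ∀ m : ℤ, 2 ≤ m → X.kappa m ≠ 0) {r : ℤ} (hr : 0 < r) {v : V}
    (hv : v ∈ X.polRelDeg r) (hD : X.D v = 0) : ∃ w ∈ X.polRelDeg (r - 1), X.D w = v := by
  have := X.finiteDimensional_polRelDeg r
  have hfin : FiniteDimensional ℂ ↥(X.polRelDeg r ⊓ LinearMap.ker X.D) :=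
    Submodule.finiteDimensional_of_le inf_le_left
  have hinj : ∀ w ∈ X.polRelDeg r ⊓ LinearMap.ker X.D, Y.laplacian w = 0 → w = 0 := by
    intro w hw h0
    obtain ⟨-, hb, -, hN⟩ := mem_polRelDeg.1 hw.1
    exact Y.laplacian_injective hr ((relNumber_of_b hb).trans hN) h0
  -- On the finite-dimensional space of cocycles the injective Laplacian is onto, and there it
  -- equals D after the homotopy; so `v = D (K w)`.
  obtain ⟨w, hw, hwv⟩ := exists_preimage (T := Y.laplacian) (X.polRelDeg r ⊓ LinearMap.ker X.D)
    (fun w hw => Y.laplacian_mem hκ hw) hinj (v := v) ⟨hv, hD⟩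
  exact ⟨_, Y.homotopy_mem_polRelDeg hw.1, (Y.laplacian_of_cocycle hw.2).symm.trans hwv⟩

/-- Commuting {D, c_1} past b_m with `m > 0` produces a multiple of c_{m+1}, which kills polarized
vectors since `m + 1 ≥ 2`. -/
theorem gamma_comm_homotopy (hκ : ∀ m : ℤ, 2 ≤ m → X.kappa m ≠ 0) {v : V} (hv : v ∈ X.pol) :
    Y.homotopy (X.gamma 1 v) = X.gamma 1 (Y.homotopy v) := by
  have h : (Y.homotopy * X.gamma 1 - X.gamma 1 * Y.homotopy) v = 0 := by
    rw [homotopy, opSum_commutator Y.locFin_homotopy]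
    refine opSum_apply_eq_zero fun m => ?_
    have hm := m.pos
    have h1 := X.gamma_comm_b (n := 1) (m := m) (by omega)
    have h2 := Y.A_comm (fun i k => (X.gamma_comm_a 1 i k).symm) (-m)
    have e : Y.A (-(m : ℤ)) * X.b m * X.gamma 1 - X.gamma 1 * (Y.A (-(m : ℤ)) * X.b m)
        = (Y.A (-(m : ℤ)) * X.gamma 1 - X.gamma 1 * Y.A (-(m : ℤ))) * X.b m
          - Y.A (-(m : ℤ)) * (X.gamma 1 * X.b m - X.b m * X.gamma 1) := by noncomm_ring
    rw [e, h1, h2, sub_self, zero_mul, zero_sub, LinearMap.neg_apply, Module.End.mul_apply,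
      LinearMap.smul_apply, c_of_mem_pol hκ hv (by omega), smul_zero, map_zero, neg_zero]
  exact sub_eq_zero.1 h

/-- As the homotopy K anticommutes with c_1, the commutator of {D, K} with c_1 reduces to that of K
with {D, c_1}, which vanishes on polarized vectors. -/
theorem c_one_laplacian (hκ : ∀ m : ℤ, 2 ≤ m → X.kappa m ≠ 0) {v : V} (hv : v ∈ X.pol) :
    Y.laplacian (X.c 1 v) = X.c 1 (Y.laplacian v) := by
  have h1 := Y.gamma_comm_homotopy hκ hv
  have h2 : ∀ w, Y.homotopy (X.c 1 w) = -X.c 1 (Y.homotopy w) := fun w => by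
    rw [apply_of_anticommutator (Y.homotopy_anticomm_c zero_le_one), LinearMap.zero_apply, zero_sub]
  simp only [gamma, LinearMap.add_apply, Module.End.mul_apply, map_add, h2] at h1
  simp only [laplacian, LinearMap.add_apply, Module.End.mul_apply, map_add, h2, map_neg]
  linear_combination (norm := module) h1

/-- Every relative cocycle of degree `0` is cohomologous to a state without ghost excitations. -/
theorem exists_bare (Y : X.LightCone) (hκ : ∀ m : ℤ, 2 ≤ m → X.kappa m ≠ 0) {v : V} (hv : v ∈ X.polRelDeg 0)
    (hD : X.D v = 0) : ∃ w ∈ X.polRelDeg (-1), v - X.D w ∈ X.bare := by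
  have := X.finiteDimensional_polRelDeg 0
  have hfin : FiniteDimensional ℂ ↥(X.polRelDeg 0 ⊓ LinearMap.ker X.D) :=
    Submodule.finiteDimensional_of_le inf_le_left
  set Z := X.polRelDeg 0 ⊓ LinearMap.ker X.D with hZ
  have hvZ : v ∈ Z := ⟨hv, hD⟩
  have hmaps : ∀ w ∈ Z.map (X.c 1), Y.laplacian w ∈ Z.map (X.c 1) := by
    rintro _ ⟨z, hz, rfl⟩
    rw [Y.c_one_laplacian hκ (mem_polRelDeg.1 hz.1).1]
    exact Submodule.mem_map_of_mem (Y.laplacian_mem hκ hz)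
  -- The mode c_1 leaves the mass shell, so c_1 Z does not lie in the relative complex. Injectivity
  -- of the Laplacian needs only the relative ghost number, which is 1 here.
  have hinj : ∀ w ∈ Z.map (X.c 1), Y.laplacian w = 0 → w = 0 := by
    rintro _ ⟨z, hz, rfl⟩ h0
    obtain ⟨-, hb, -, hN⟩ := mem_polRelDeg.1 hz.1
    have hb' : X.b 0 (X.c 1 z) = 0 := by
      rw [b_c_apply, hb, map_zero, if_neg (by decide), sub_zero]
    refine Y.laplacian_injective one_pos ?_ h0
    rw [relNumber_of_b hb', ghostNumber_c_apply hN]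
    simp
  -- On the finite-dimensional space c_1 Z the Laplacian is onto, so c_1 v = Δ c_1 z = c_1 Δ z for
  -- some cocycle `z`; here Δ z = D K z.
  obtain ⟨w, ⟨z, hz, rfl⟩, hw'⟩ := exists_preimage (T := Y.laplacian) (Z.map (X.c 1)) hmaps hinj
    (v := X.c 1 v) (Submodule.mem_map_of_mem hvZ)
  rw [Y.c_one_laplacian hκ (mem_polRelDeg.1 hz.1).1] at hw'
  have hmem := Y.homotopy_mem_polRelDeg hz.1
  rw [zero_sub] at hmem
  refine ⟨Y.homotopy z, hmem, ?_⟩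
  rw [← Y.laplacian_of_cocycle hz.2]
  have hmem := Z.sub_mem hvZ (Y.laplacian_mem hκ hz)
  obtain ⟨hP, hb, -, hN⟩ := mem_polRelDeg.1 hmem.1
  refine mem_bare_of_c (fun n hn => ?_) hb (by simpa using hN)
  by_cases h2 : 2 ≤ n
  · exact c_of_mem_pol hκ hP h2
  · obtain rfl : n = 1 := by omega
    rw [map_sub, hw', sub_self]

end LightCone

/-! ### Negative degrees and gauge states -/

/-- The polarization excludes all antighosts but b_{-1}, and c_1 v = 0 excludes that one; without
antighosts the ghost number is not negative. -/
theorem eq_zero_of_c {r : ℤ} (hr : r < 0) {v : V} (hv : X.ghostNumber v = (r : ℂ) • v)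
    (hκ : ∀ m : ℤ, 2 ≤ m → X.kappa m ≠ 0) (hP : v ∈ X.pol) (h1 : X.c 1 v = 0) : v = 0 := by
  refine X.eq_zero_of_ghostNumber_neg (fun n hn => ?_) hr hv
  by_cases h2 : 2 ≤ n
  · exact c_of_mem_pol hκ hP h2
  · obtain rfl : n = 1 := by omega
    exact h1

/-- A single b_{-1} lowers the degree by one only. In terms of modes, c_1 v has no antighosts and
still negative ghost number, so it vanishes. -/
theorem eq_zero_of_lt_neg_one (hκ : ∀ m : ℤ, 2 ≤ m → X.kappa m ≠ 0) {r : ℤ} (hr : r < -1) {v : V}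
    (hv : v ∈ X.polRelDeg r) : v = 0 := by
  obtain ⟨hP, hb, -, hN⟩ := mem_polRelDeg.1 hv
  refine eq_zero_of_c (by omega) hN hκ hP ?_
  have hN' := ghostNumber_c_apply hN 1
  refine X.eq_zero_of_ghostNumber_neg (s := r + 1) (fun n hn => ?_) (by omega) (by exact_mod_cast hN')
  by_cases h2 : 2 ≤ n
  · rw [c_c_apply, c_of_mem_pol hκ hP h2, map_zero, neg_zero]
  · obtain rfl : n = 1 := by omega
    exact c_c_self 1 v

theorem eq_zero_of_neg_one (hκ : ∀ m : ℤ, 2 ≤ m → X.kappa m ≠ 0) (h1 : X.kappa 1 ≠ 0) {v : V}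
    (hv : v ∈ X.polRelDeg (-1)) : v = 0 := by
  obtain ⟨hP, -, -, hN⟩ := mem_polRelDeg.1 hv
  exact eq_zero_of_c (by decide) hN hκ hP (mem_pol.1 hP 1 one_pos h1)

/-- The relative cochains of degree `-1` contain a single excitation `b_{-1}`. -/
theorem c_one_mem_bare (hκ : ∀ m : ℤ, 2 ≤ m → X.kappa m ≠ 0) {v : V}
    (hv : v ∈ X.polRelDeg (-1)) : X.c 1 v ∈ X.bare ∧ v = X.b (-1) (X.c 1 v) := by
  obtain ⟨hP, hb, -, hN⟩ := mem_polRelDeg.1 hv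
  have hc : ∀ n : ℤ, 0 < n → X.c n (X.c 1 v) = 0 := fun n hn => by
    by_cases h2 : 2 ≤ n
    · rw [c_c_apply, c_of_mem_pol hκ hP h2, map_zero, neg_zero]
    · obtain rfl : n = 1 := by omega
      exact c_c_self 1 v
  have hb0 : X.b 0 (X.c 1 v) = 0 := by
    rw [b_c_apply, hb, map_zero, if_neg (by decide), sub_zero]
  have hN1 := ghostNumber_c_apply hN 1
  have hbare := mem_bare_of_c hc hb0 (by rw [hN1]; simp)
  refine ⟨hbare, sub_eq_zero.1 (X.eq_zero_of_ghostNumber_neg (s := -1) (fun n hn => ?_) (by decide) ?_)⟩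
  · rw [map_sub, c_b_apply, hc n hn, map_zero, sub_zero]
    by_cases h2 : 2 ≤ n
    · rw [c_of_mem_pol hκ hP h2, if_neg (by omega), sub_zero]
    · obtain rfl : n = 1 := by omega
      rw [if_pos (by decide), sub_self]
  · have h0 := ghostNumber_b_apply (s := 0) (by rw [ghostNumber_of_bare hbare, zero_smul]) (-1)
    rw [map_sub, hN, h0]
    push_cast
    module

/-- The condition on c_1 forces b_{-1} D u = -b_{-1} c_0 u. In D b_{-1} u = L_{-1}^tot u - b_{-1} D
u this cancels the ghost term c_0 b_{-1} u of L_{-1}^tot u. The condition holds both for cocycles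
and when the image has no ghost excitations. -/
theorem D_b_neg_one {u : V} (hu : u ∈ X.bare) (h : X.c 1 (X.D (X.b (-1) u)) = 0) :
    X.D (X.b (-1) u) = X.L (-1) u := by
  have h1 := X.D_b_apply (-1) u
  have h2 : X.c 1 (X.Ltot (-1) u) = -X.c 0 u := by
    have := apply_of_commutator (X.Ltot_comm_c (-1) 1) u
    rw [hu.1 1 one_pos, map_zero] at this
    norm_num at this
    exact eq_neg_of_add_eq_zero_left this.symm
  rw [h1, map_sub, h2, c_b_apply, if_pos (by decide)] at h
  have e : X.D u = X.b (-1) (X.c 1 (X.D u)) - X.c 0 u := by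
    linear_combination (norm := module) -h
  have h3 : X.b (-1) (X.D u) = -X.b (-1) (X.c 0 u) := by
    rw [e, map_sub, b_b_self, zero_sub]
  rw [h1, h3, Ltot_neg_one_of_bare hu, c_b_apply, if_neg (by decide)]
  abel

/-- There are no relative cocycles in negative degrees. -/
theorem LightCone.eq_zero_of_cocycle (Y : X.LightCone) (hκ : ∀ m : ℤ, 2 ≤ m → X.kappa m ≠ 0)
    {r : ℤ} (hr : r < 0) {v : V} (hv : v ∈ X.polRelDeg r) (hD : X.D v = 0) : v = 0 := by
  rcases (show r < -1 ∨ r = -1 by omega) with h | rfl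
  · exact eq_zero_of_lt_neg_one hκ h hv
  · obtain ⟨hu, hvu⟩ := c_one_mem_bare hκ hv
    rw [hvu] at hD
    have h := D_b_neg_one hu (by rw [hD, map_zero])
    rw [hD] at h
    rw [hvu, Y.L_neg_one_injective h.symm, map_zero]

/-! ### The bigraded structure -/

end Fock

namespace GhostModes

variable {V : Type*} [AddCommGroup V] [Module ℂ V] (G : GhostModes V)

/-- The operators `τ_m`. -/
def tauPos (m : ℕ+) : Module.End ℂ V :=
  opSum fun k : {k : ℤ // (m : ℤ) < k} =>
    ((m : ℂ) + ((k : ℤ) : ℂ)) • (G.b ((m : ℤ) - k) * G.c k)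

/-- The operators `τ_{-m}`. -/
def tauNeg (m : ℕ+) : Module.End ℂ V :=
  opSum fun k : {k : ℤ // (m : ℤ) < k} =>
    ((m : ℂ) + ((k : ℤ) : ℂ)) • (G.c (-(k : ℤ)) * G.b ((k : ℤ) - m))

/-- The operator `∂`. -/
def del : Module.End ℂ V :=
  (-(1 / 2) : ℂ) • opSum fun mk : ℕ+ × ℕ+ =>
    ((mk.1 : ℂ) - (mk.2 : ℂ))
      • (G.b (-(mk.2 : ℤ) - (mk.1 : ℤ)) * G.c (mk.2 : ℤ) * G.c (mk.1 : ℤ))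

/-- The operator `∂̄`. -/
def delBar : Module.End ℂ V :=
  (-(1 / 2) : ℂ) • opSum fun mk : ℕ+ × ℕ+ =>
    ((mk.1 : ℂ) - (mk.2 : ℂ))
      • (G.c (-(mk.1 : ℤ)) * G.c (-(mk.2 : ℤ)) * G.b ((mk.2 : ℤ) + (mk.1 : ℤ)))

variable {G}

theorem c_mul_tauPos_apply {v : V} (hv : ∀ n, 0 < n → G.c n v = 0) :
    opSum (fun m : ℕ+ => G.c (-(m : ℤ)) * G.tauPos m) v = 0 :=
  opSum_apply_eq_zero fun m => by
    rw [Module.End.mul_apply, tauPos, opSum_apply_eq_zero fun k => ?_, map_zero]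
    rw [LinearMap.smul_apply, Module.End.mul_apply, hv _ (by have := m.pos; have := k.2; omega),
      map_zero, smul_zero]

theorem delBar_apply {v : V} (hv : ∀ n, 0 ≤ n → G.b n v = 0) : G.delBar v = 0 := by
  rw [delBar, LinearMap.smul_apply, opSum_apply_eq_zero fun k => ?_, smul_zero]
  rw [LinearMap.smul_apply, Module.End.mul_apply, hv _ (by positivity), map_zero, smul_zero]

theorem c_b_neg_one {v : V} (hv : ∀ n, 0 < n → G.c n v = 0) (m : ℕ+) :
    G.c m (G.b (-1) v) = if m = 1 then v else 0 := by
  rw [c_b_apply, hv _ (by positivity), map_zero, sub_zero]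
  by_cases h : m = 1
  · rw [if_pos h, if_pos (by rw [h]; decide)]
  · have := pnat_ne h
    rw [if_neg h, if_neg (by rw [PNat.one_coe] at this; omega)]

theorem c_mul_tauNeg_apply {v : V} (hv : ∀ n, 0 ≤ n → G.b n v = 0) :
    opSum (fun m : ℕ+ => G.c (m : ℤ) * G.tauNeg m) (G.b (-1) v) = 0 :=
  opSum_apply_eq_zero fun m => by
    rw [Module.End.mul_apply, tauNeg, opSum_apply_eq_zero fun k => ?_, map_zero]
    rw [LinearMap.smul_apply, Module.End.mul_apply, b_b_apply,
      hv _ (by have := m.pos; have := k.2; omega), map_zero, neg_zero, map_zero, smul_zero]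

theorem del_apply {v : V} (hv : ∀ n, 0 < n → G.c n v = 0) : G.del (G.b (-1) v) = 0 := by
  have hcc : ∀ m k : ℕ+, G.c k (G.c m (G.b (-1) v)) = 0 := fun m k => by
    rw [c_b_neg_one hv]
    split_ifs
    · exact hv _ (by positivity)
    · exact map_zero _
  rw [del, LinearMap.smul_apply, opSum_apply_eq_zero fun k => ?_, smul_zero]
  rw [LinearMap.smul_apply, Module.End.mul_apply, Module.End.mul_apply, hcc, map_zero, smul_zero]

end GhostModes

/-! ### Relative cocycles, bidegree zero and gauge states in an abstract Fock space -/

namespace Fock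

open GhostModes

variable {ι : Type*} [Fintype ι] [DecidableEq ι] {V : Type*} [AddCommGroup V] [Module ℂ V]
  (X : Fock ι V)

/-- The states without ghost excitations are generated by the matter modes. -/
theorem bare_le {S : Submodule ℂ V} (h0 : X.vac ∈ S)
    (h : ∀ i, ∀ k : ℕ+, ∀ v ∈ S, X.a i (-(k : ℤ)) v ∈ S) : X.bare ≤ S := by
  intro v hv
  -- `O` counts all letters b and c, including c_0, so its kernel is spanned by the words made of
  -- matter letters only.
  set O := X.ghostDegree + X.antighostDegree + X.c 0 * X.b 0 with hO
  have hkill : ∀ w ∈ X.bare, O w = 0 := fun w hw => by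
    simp [hO, X.ghostDegree_of_b_eq_zero fun n hn => hw.2 n hn.le,
      X.antighostDegree_of_c_eq_zero hw.1, hw.2 0 le_rfl]
  let w : Letter ι → ℕ := Sum.elim (fun _ => 0) (Sum.elim (fun _ => 1) fun _ => 1)
  have hw : ∀ x, O * creator X.a X.c X.b x - creator X.a X.c X.b x * O
      = (w x : ℂ) • creator X.a X.c X.b x := by
    have key : ∀ Y : Module.End ℂ V, O * Y - Y * O = (X.ghostDegree * Y - Y * X.ghostDegree)
        + (X.antighostDegree * Y - Y * X.antighostDegree)
        + (X.c 0 * X.b 0 * Y - Y * (X.c 0 * X.b 0)) := fun Y => by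
      rw [hO]; noncomm_ring
    intro x
    rw [key]
    rcases x with ⟨i, k⟩ | k | k
    · simp [w, creator, X.ghostDegree_comm_a, X.antighostDegree_comm_a, X.c_b_zero_comm_a]
    · simp only [w, creator, X.ghostDegree_comm_c, X.antighostDegree_comm_c, X.cb_comm_c]
      rcases Nat.eq_zero_or_pos k with rfl | hk
      · simp
      · rw [if_pos (by omega), if_neg (by omega), if_neg (by omega)]
        simp
    · have := k.pos
      simp only [w, creator, X.ghostDegree_comm_b, X.antighostDegree_comm_b, X.cb_comm_b]
      rw [if_neg (by omega), if_pos (by omega), if_neg (by omega)]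
      simp
  have hvac : O X.vac = (0 : ℂ) • X.vac := by
    rw [hkill _ ⟨X.c_vac, X.b_vac⟩, zero_smul]
  have hmem := mem_span_of_eigen X.span_fockWord (word_eigen hvac hw) (μ := 0) (y := v)
    (by rw [hkill v hv, zero_smul])
  refine Submodule.span_le.2 ?_ hmem
  rintro _ ⟨l, hl₀, rfl⟩
  have hl : (l.map w).sum = 0 := by
    simp only [Set.mem_ofPred_eq, zero_add] at hl₀
    have : (((l.map w).sum : ℕ) : ℂ) = 0 := by
      rw [← hl₀]
      push_cast
      simp [List.map_map, Function.comp_def]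
    exact_mod_cast this
  clear hmem hl₀
  induction l with
  | nil => exact h0
  | cons x l ih =>
    rw [List.map_cons, List.sum_cons, Nat.add_eq_zero_iff] at hl
    rcases x with ⟨i, k⟩ | k | k
    · exact h i k _ (ih hl.2)
    · exact absurd hl.1 one_ne_zero
    · exact absurd hl.1 one_ne_zero

/-- The relative differential; the operator `W` is the coefficient of `b_0`. -/
def diffRel (W : Module.End ℂ V) : Module.End ℂ V := X.D - X.Ltot 0 * X.c 0 - W * X.b 0

/-- The relative cocycles. -/
def cocyclesRel (W : Module.End ℂ V) (r : ℤ) : Submodule ℂ V :=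
  X.polRelDeg r ⊓ LinearMap.ker (X.diffRel W)

/-- The relative coboundaries. -/
def coboundariesRel (W : Module.End ℂ V) (r : ℤ) : Submodule ℂ V :=
  (X.polRelDeg (r - 1)).map (X.diffRel W)

/-- The operator `𝒟`. -/
def dolb : Module.End ℂ V :=
  opSum (fun m : ℕ+ => X.L (-(m : ℤ)) * X.c (m : ℤ))
    + opSum (fun m : ℕ+ => X.c (m : ℤ) * X.tauNeg m) + X.del

/-- The operator `𝒟̄`. -/
def dolbBar : Module.End ℂ V :=
  opSum (fun m : ℕ+ => X.L (m : ℤ) * X.c (-(m : ℤ)))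
    + opSum (fun m : ℕ+ => X.c (-(m : ℤ)) * X.tauPos m) + X.delBar

/-- The polarized cochains without ghost zero mode of bidegree `(i, j)`. -/
def polBi (i j : ℕ) : Submodule ℂ V :=
  X.polNoZero ⊓ LinearMap.ker (X.ghostDegree - (i : ℂ) • 1)
    ⊓ LinearMap.ker (X.antighostDegree - (j : ℂ) • 1)

/-- The `𝒟̄`-cocycles of bidegree `(i, j)`. -/
def cocyclesBarOff (i j : ℕ) : Submodule ℂ V := X.polBi i j ⊓ LinearMap.ker X.dolbBar

/-- The on-shell `𝒟̄`-cocycles of bidegree `(i, j)`. -/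
def cocyclesBar (i j : ℕ) : Submodule ℂ V := X.cocyclesBarOff i j ⊓ LinearMap.ker (X.Ltot 0)

/-- The gauge subspace. -/
def gauge : Submodule ℂ V :=
  ((X.cocyclesBarOff 0 0).map (X.b (-1)) ⊓ X.polRel).map X.dolb

variable {X}

/-- Both corrections vanish on relative cochains: L_0^tot commutes with c_0 and kills `v`, and so
does b_0. The operator `W` is thus irrelevant and can be left arbitrary. -/
theorem diffRel_apply (W : Module.End ℂ V) {r : ℤ} {v : V} (hv : v ∈ X.polRelDeg r) :
    X.diffRel W v = X.D v := by
  obtain ⟨-, hb, hL, -⟩ := mem_polRelDeg.1 hv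
  have h := apply_of_commutator (X.Ltot_comm_c 0 0) v
  rw [hL, map_zero, zero_add] at h
  simp only [diffRel, LinearMap.sub_apply, Module.End.mul_apply, h, hb, map_zero]
  simp

theorem mem_cocyclesRel {W : Module.End ℂ V} {r : ℤ} {v : V} :
    v ∈ X.cocyclesRel W r ↔ v ∈ X.polRelDeg r ∧ X.D v = 0 :=
  and_congr_right fun hv => by
    change X.diffRel W v = 0 ↔ _
    rw [diffRel_apply W hv]

theorem mem_coboundariesRel {W : Module.End ℂ V} {r : ℤ} {v : V} :
    v ∈ X.coboundariesRel W r ↔ ∃ w ∈ X.polRelDeg (r - 1), X.D w = v := by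
  constructor
  · rintro ⟨w, hw, rfl⟩
    exact ⟨w, hw, (diffRel_apply W hw).symm⟩
  · rintro ⟨w, hw, rfl⟩
    exact ⟨w, hw, diffRel_apply W hw⟩

/-- If the antighost degree is 0, then c_n v would have antighost degree -1 for `n > 0`, so it is
zero. -/
theorem polBi_zero : X.polBi 0 0 = X.bare := by
  refine le_antisymm ?_ fun v hv => ?_
  · rintro v ⟨⟨⟨-, hb⟩, hg⟩, ha⟩
    simp only [SetLike.mem_coe, LinearMap.mem_ker, Nat.cast_zero, zero_smul, sub_zero] at hb hg ha
    refine mem_bare_of_c (fun n hn => ?_) hb ?_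
    · refine X.eq_zero_of_antighostDegree_neg (s := -1) (by decide) ?_
      rw [apply_of_commutator (X.antighostDegree_comm_c n), ha, map_zero, if_pos hn]
      simp
    · rw [← relNumber_of_b hb, relNumber, LinearMap.sub_apply, hg, ha, sub_zero]
  · refine ⟨⟨bare_le_polNoZero hv, ?_⟩, ?_⟩
    · simp [X.ghostDegree_of_b_eq_zero fun n hn => hv.2 n hn.le]
    · simp [X.antighostDegree_of_c_eq_zero hv.1]

theorem dolbBar_of_bare {v : V} (hv : v ∈ X.bare) :
    X.dolbBar v = opSum (fun m : ℕ+ => X.L (m : ℤ) * X.c (-(m : ℤ))) v := by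
  rw [dolbBar, LinearMap.add_apply, LinearMap.add_apply, c_mul_tauPos_apply hv.1,
    delBar_apply hv.2, add_zero, add_zero]

/-- On states without ghosts the image is ∑ L_m c_{-m} v, and b_k extracts the coefficient of
c_{-k}. -/
theorem b_dolbBar {v : V} (hv : v ∈ X.bare) (k : ℕ+) : X.b k (X.dolbBar v) = X.L k v := by
  have hl : LocFin fun m : ℕ+ => X.L (m : ℤ) * X.c (-(m : ℤ)) := by
    have := X.locFin_diff.comp_injective (f := fun m : ℕ+ => (m : ℤ))
      fun _ _ h => PNat.coe_injective (Int.ofNat_injective h)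
    simpa using this
  have hm : ∀ m : ℕ+, X.b k (X.L m (X.c (-(m : ℤ)) v)) = if m = k then X.L m v else 0 := fun m => by
    rw [← Module.End.mul_apply, ← X.L_comm_b, Module.End.mul_apply, b_c_apply,
      hv.2 _ (by positivity), map_zero, sub_zero]
    by_cases h : m = k
    · rw [if_pos h, if_pos (by rw [h]; omega)]
    · have := pnat_ne h
      rw [if_neg h, if_neg (by omega), map_zero]
  rw [dolbBar_of_bare hv, ← Module.End.mul_apply, mul_opSum hl,
    opSum_apply_eq_single (hl.comp_left _) k fun m hm' => ?_]
  · rw [Module.End.mul_apply, Module.End.mul_apply, hm, if_pos rfl]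
  · rw [Module.End.mul_apply, Module.End.mul_apply, hm, if_neg hm']

theorem mem_cocyclesBarOff {v : V} :
    v ∈ X.cocyclesBarOff 0 0 ↔ v ∈ X.bare ∧ ∀ m : ℤ, 0 < m → X.L m v = 0 := by
  rw [cocyclesBarOff, polBi_zero]
  refine and_congr_right fun hv => ⟨fun h m hm => ?_, fun h => ?_⟩
  · obtain ⟨k, rfl⟩ := exists_pnat hm
    have h : X.dolbBar v = 0 := h
    rw [← b_dolbBar hv, h, map_zero]
  · change X.dolbBar v = 0
    rw [dolbBar_of_bare hv]
    refine opSum_apply_eq_zero fun m => ?_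
    rw [X.L_comm_c, Module.End.mul_apply, h _ (by positivity), map_zero]

theorem mem_cocyclesBar {v : V} : v ∈ X.cocyclesBar 0 0 ↔
    v ∈ X.bare ∧ ∀ m : ℤ, 0 ≤ m → X.L m v = (if m = 0 then X.intercept else 0) • v := by
  rw [cocyclesBar, Submodule.mem_inf, mem_cocyclesBarOff, and_assoc]
  refine and_congr_right fun hv => ?_
  rw [LinearMap.mem_ker, Ltot_of_bare hv le_rfl, sub_eq_zero]
  refine ⟨fun h m hm => ?_, fun h => ⟨fun m hm => ?_, h 0 le_rfl⟩⟩
  · rcases hm.eq_or_lt with rfl | hm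
    · exact h.2
    · rw [h.1 m hm, if_neg hm.ne', zero_smul]
  · rw [h m hm.le, if_neg hm.ne', zero_smul]

theorem dolb_b_neg_one {v : V} (hv : v ∈ X.bare) : X.dolb (X.b (-1) v) = X.L (-1) v := by
  have hl : LocFin fun m : ℕ+ => X.L (-(m : ℤ)) * X.c (m : ℤ) := by
    simpa using X.locFin_mul_c (fun _ => 1) fun m : ℕ+ => X.L (-(m : ℤ))
  rw [dolb, LinearMap.add_apply, LinearMap.add_apply, c_mul_tauNeg_apply hv.2, del_apply hv.1,
    add_zero, add_zero, opSum_apply_eq_single hl 1 fun m hm => ?_]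
  · rw [Module.End.mul_apply, c_b_neg_one hv.1, if_pos rfl]
    rfl
  · rw [Module.End.mul_apply, c_b_neg_one hv.1, if_neg hm, map_zero]

/-- The vanishing of κ(1) is what admits the excitation b_{-1} in the polarized space. It raises the
level by one, hence the shifted eigenvalue `intercept - 1`. -/
theorem b_neg_one_mem_polRel (h1 : X.kappa 1 = 0) {u : V} (hu : u ∈ X.bare) :
    X.b (-1) u ∈ X.polRel ↔ X.L 0 u = (X.intercept - 1) • u := by
  have hP : X.b (-1) u ∈ X.polNoZero := by
    refine ⟨mem_pol.2 fun m hm hk => ?_, ?_⟩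
    · rw [c_b_apply, hu.1 m hm, map_zero, sub_zero, if_neg]
      intro h
      obtain rfl : m = 1 := by omega
      exact hk h1
    · change X.b 0 (X.b (-1) u) = 0
      rw [b_b_apply, hu.2 0 le_rfl, map_zero, neg_zero]
  have hL : X.Ltot 0 (X.b (-1) u) = X.b (-1) (X.L 0 u - (X.intercept - 1) • u) := by
    rw [apply_of_commutator (X.Ltot_comm_b 0 (-1)), Ltot_of_bare hu le_rfl, if_pos rfl, zero_add,
      LinearMap.smul_apply, map_sub, map_sub, map_smul, map_smul]
    push_cast
    module
  have hmem : X.b (-1) u ∈ X.polRel ↔ X.Ltot 0 (X.b (-1) u) = 0 := and_iff_right hP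
  rw [hmem, hL, ← sub_eq_zero (a := X.L 0 u)]
  refine ⟨fun h => ?_, fun h => by rw [h, map_zero]⟩
  have hw := X.bare.sub_mem (L_mem_bare hu 0) (X.bare.smul_mem (X.intercept - 1) hu)
  -- On states without ghost excitations c_1 is a left inverse of b_{-1}.
  have := c_b_apply (G := X.toGhostModes) 1 (-1) (X.L 0 u - (X.intercept - 1) • u)
  rw [h, map_zero, hw.1 1 one_pos, map_zero, if_pos (by decide), sub_zero] at this
  exact this.symm

theorem mem_gauge (h1 : X.kappa 1 = 0) {w : V} : w ∈ X.gauge ↔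
    ∃ u ∈ X.bare, (∀ m : ℤ, 0 < m → X.L m u = 0) ∧ X.L 0 u = (X.intercept - 1) • u
      ∧ X.L (-1) u = w := by
  constructor
  · rintro ⟨_, ⟨⟨u, hu, rfl⟩, hrel⟩, rfl⟩
    obtain ⟨hb, hL⟩ := mem_cocyclesBarOff.1 hu
    exact ⟨u, hb, hL, (b_neg_one_mem_polRel h1 hb).1 hrel, (dolb_b_neg_one hb).symm⟩
  · rintro ⟨u, hb, hL, h0, rfl⟩
    exact ⟨X.b (-1) u, ⟨⟨u, mem_cocyclesBarOff.2 ⟨hb, hL⟩, rfl⟩,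
      (b_neg_one_mem_polRel h1 hb).2 h0⟩, dolb_b_neg_one hb⟩

/-- The central charge cancels in κ(1), which equals `2 (intercept - 1)`. -/
theorem intercept_of_kappa_one (h1 : X.kappa 1 = 0) : X.intercept = 1 := by
  rw [kappa] at h1
  push_cast at h1
  linear_combination h1 / 2

/-! ### The vanishing theorem -/

theorem coboundariesRel_le (W : Module.End ℂ V) (hκ : ∀ m : ℤ, 2 ≤ m → X.kappa m ≠ 0) (r : ℤ) :
    X.coboundariesRel W r ≤ X.cocyclesRel W r := fun v hv => by
  obtain ⟨w, hw, rfl⟩ := mem_coboundariesRel.1 hv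
  have := D_mem_polRelDeg hκ hw
  rw [sub_add_cancel] at this
  exact mem_cocyclesRel.2 ⟨this, D_D_apply (mem_polRelDeg.1 hw).1⟩

theorem LightCone.cocyclesRel_le (Y : X.LightCone) (W : Module.End ℂ V)
    (hκ : ∀ m : ℤ, 2 ≤ m → X.kappa m ≠ 0) {r : ℤ} (hr : r ≠ 0) :
    X.cocyclesRel W r ≤ X.coboundariesRel W r := fun v hv => by
  obtain ⟨hv, hD⟩ := mem_cocyclesRel.1 hv
  rcases lt_or_gt_of_ne hr with hr | hr
  · rw [Y.eq_zero_of_cocycle hκ hr hv hD]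
    exact Submodule.zero_mem _
  · exact mem_coboundariesRel.2 (Y.exact_of_pos hκ hr hv hD)

theorem mem_cocyclesBar_of_cocycle {v : V} (hv : v ∈ X.bare) (hD : X.D v = 0) :
    v ∈ X.cocyclesBar 0 0 := mem_cocyclesBar.2 ⟨hv, (D_eq_zero_iff_of_bare hv).1 hD⟩

theorem cocyclesBar_le (W : Module.End ℂ V) : X.cocyclesBar 0 0 ≤ X.cocyclesRel W 0 := fun v hv => by
  obtain ⟨hb, hL⟩ := mem_cocyclesBar.1 hv
  refine mem_cocyclesRel.2 ⟨mem_polRelDeg.2 ⟨(bare_le_polNoZero hb).1, hb.2 0 le_rfl, hv.2, ?_⟩,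
    (D_eq_zero_iff_of_bare hb).2 hL⟩
  rw [ghostNumber_of_bare hb]
  simp

theorem LightCone.cocyclesRel_zero_le (Y : X.LightCone) (W : Module.End ℂ V)
    (hκ : ∀ m : ℤ, 2 ≤ m → X.kappa m ≠ 0) :
    X.cocyclesRel W 0 ≤ X.cocyclesBar 0 0 ⊔ X.coboundariesRel W 0 := fun v hv => by
  obtain ⟨hv, hD⟩ := mem_cocyclesRel.1 hv
  obtain ⟨w, hw, hb⟩ := Y.exists_bare hκ hv hD
  have hDD := D_D_apply (mem_polRelDeg.1 hw).1
  refine Submodule.mem_sup.2 ⟨v - X.D w, mem_cocyclesBar_of_cocycle hb (by rw [map_sub, hD, hDD,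
    sub_zero]), X.D w, mem_coboundariesRel.2 ⟨w, hw, rfl⟩, sub_add_cancel _ _⟩

theorem coboundariesRel_zero_eq_bot (W : Module.End ℂ V) (hκ : ∀ m : ℤ, 2 ≤ m → X.kappa m ≠ 0)
    (h1 : X.kappa 1 ≠ 0) : X.coboundariesRel W 0 = ⊥ := by
  refine (Submodule.eq_bot_iff _).2 fun v hv => ?_
  obtain ⟨w, hw, rfl⟩ := mem_coboundariesRel.1 hv
  rw [eq_zero_of_neg_one hκ h1 hw, map_zero]

/-- With intercept 1 one has L_0 u = 0, and L_m L_{-1} u = (m + 1) L_{m-1} u = 0 for `m > 0`,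
because the Virasoro cocycle vanishes at `m = 1`. Moreover L_0 L_{-1} u = L_{-1} u. -/
theorem gauge_le (h1 : X.kappa 1 = 0) : X.gauge ≤ X.cocyclesBar 0 0 := fun w hw => by
  obtain ⟨u, hu, hL, h0, rfl⟩ := (mem_gauge h1).1 hw
  have ha := intercept_of_kappa_one h1
  rw [ha, sub_self, zero_smul] at h0
  refine mem_cocyclesBar.2 ⟨L_mem_bare hu _, fun m hm => ?_⟩
  have hc := apply_of_commutator (X.L_comm_L m (-1)) u
  rw [hc]
  rcases hm.eq_or_lt with rfl | hm
  · rw [h0, if_neg (by decide), if_pos rfl, ha]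
    simp
  · rw [hL m hm, if_neg hm.ne', map_zero, zero_smul, zero_add, LinearMap.add_apply,
      LinearMap.smul_apply]
    have h2 : X.L (m + -1) u = 0 := by
      rcases (show m + -1 = 0 ∨ 0 < m + -1 by omega) with h | h
      · rw [h, h0]
      · exact hL _ h
    rw [h2, smul_zero, zero_add]
    split_ifs with h
    · obtain rfl : m = 1 := by omega
      simp
    · simp

theorem cocyclesBar_inf_coboundariesRel (W : Module.End ℂ V)
    (hκ : ∀ m : ℤ, 2 ≤ m → X.kappa m ≠ 0) (h1 : X.kappa 1 = 0) :
    X.cocyclesBar 0 0 ⊓ X.coboundariesRel W 0 = X.gauge := by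
  have ha := intercept_of_kappa_one h1
  refine le_antisymm ?_ (le_inf (gauge_le h1) fun w hw => ?_)
  · rintro v ⟨hv, hv'⟩
    obtain ⟨hvb, -⟩ := mem_cocyclesBar.1 hv
    obtain ⟨w, hw, rfl⟩ := mem_coboundariesRel.1 hv'
    rw [zero_sub] at hw
    obtain ⟨hu, hwu⟩ := c_one_mem_bare hκ hw
    generalize X.c 1 w = u at hu hwu
    subst hwu
    have hL := D_b_neg_one hu (hvb.1 1 one_pos)
    refine (mem_gauge h1).2 ⟨u, hu, fun m hm => ?_, (b_neg_one_mem_polRel h1 hu).1 hw.1, hL.symm⟩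
    have hb := hvb.2 m hm.le
    have h2 := b_D_apply (X := X) m u
    have h3 := apply_of_commutator (X.Ltot_comm_b (-1) m) u
    rw [hu.2 m hm.le, map_zero, sub_zero, Ltot_of_bare hu hm.le, if_neg hm.ne', zero_smul,
      sub_zero] at h2
    rw [hu.2 m hm.le, map_zero, LinearMap.smul_apply, hu.2 (-1 + m) (by omega), smul_zero,
      add_zero] at h3
    -- Applying b_m to the state D b_{-1} u, which has no ghosts, gives b_{-1} L_m u = 0; then c_1
    -- removes b_{-1}.
    rw [D_b_apply, map_sub, ← h3, b_b_apply, h2, zero_sub, neg_neg] at hb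
    have h4 := c_b_apply (G := X.toGhostModes) 1 (-1) (X.L m u)
    rw [hb, map_zero, (L_mem_bare hu m).1 1 one_pos, map_zero, if_pos (by decide), sub_zero] at h4
    exact h4.symm
  · obtain ⟨u, hu, hL, h0, rfl⟩ := (mem_gauge h1).1 hw
    have hrel := (b_neg_one_mem_polRel h1 hu).2 h0
    have hN := ghostNumber_b_apply (s := 0) (by rw [ghostNumber_of_bare hu, zero_smul]) (-1)
    -- The only physical state condition that fails for `u` is that of L_0, and it fails by -1, so D
    -- u consists of the c_0 term alone.
    have hD : X.D u = -X.c 0 u := by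
      rw [← add_eq_zero_iff_eq_neg]
      refine X.eq_zero_of_ghostNumber_pos (s := 1) (fun m hm => ?_) one_pos ?_
      · rw [map_add, b_D_apply, b_c_apply, hu.2 m hm, map_zero, map_zero, Ltot_of_bare hu hm,
          zero_add]
        rcases hm.eq_or_lt with rfl | hm
        · rw [h0, if_pos rfl, if_pos rfl]
          module
        · rw [hL m hm, if_neg hm.ne', if_neg hm.ne']
          simp
      · rw [map_add, ghostNumber_D_apply (s := 0) (by rw [ghostNumber_of_bare hu, zero_smul]),
          ghostNumber_c_apply (s := 0) (by rw [ghostNumber_of_bare hu, zero_smul])]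
        push_cast
        module
    refine mem_coboundariesRel.2 ⟨X.b (-1) u, mem_polRelDeg.2 ⟨hrel.1.1, hrel.1.2, hrel.2, ?_⟩, ?_⟩
    · rw [hN]
      simp
    · rw [D_b_apply, hD, Ltot_neg_one_of_bare hu, map_neg, c_b_apply, if_neg (by decide)]
      abel

end Fock

/-! ### Tensor products of matter and ghosts -/

theorem tmul_ne_zero_of_ne_zero {M V : Type*} [AddCommGroup M] [Module ℂ M] [AddCommGroup V]
    [Module ℂ V] {m : M} {v : V} (hm : m ≠ 0) (hv : v ≠ 0) : m ⊗ₜ[ℂ] v ≠ 0 := fun h => by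
  obtain ⟨f, hf⟩ := not_forall.1 ((Module.forall_dual_apply_eq_zero_iff ℂ m).not.2 hm)
  obtain ⟨g, hg⟩ := not_forall.1 ((Module.forall_dual_apply_eq_zero_iff ℂ v).not.2 hv)
  have := congrArg (fun x => TensorProduct.lid ℂ ℂ (TensorProduct.map f g x)) h
  simp [hf, hg] at this

/-- A Fock representation of the ghost modes. -/
structure GhostFock (V : Type*) [AddCommGroup V] [Module ℂ V] extends GhostModes V where
  vac : V
  vac_ne_zero : vac ≠ 0
  c_vac : ∀ n, 0 < n → c n vac = 0
  b_vac : ∀ n, 0 ≤ n → b n vac = 0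
  cyclic : ∀ S : Submodule ℂ V, vac ∈ S → (∀ k : ℕ, ∀ v ∈ S, c (-(k : ℤ)) v ∈ S) →
    (∀ k : ℕ+, ∀ v ∈ S, b (-(k : ℤ)) v ∈ S) → S = ⊤

/-- A Fock representation of the matter modes, together with the parameters of the constraints. -/
structure MatterFock (ι : Type*) [Fintype ι] [DecidableEq ι] (M : Type*) [AddCommGroup M]
    [Module ℂ M] where
  a : ι → ℤ → Module.End ℂ M
  metric : ι → ℂ
  zero : ι → ℂ
  vac : M
  liouville : ι
  slope : ℂ
  shift : ℂ
  intercept : ℂ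
  metric_mul_self : ∀ i, metric i * metric i = 1
  a_zero : ∀ i, a i 0 = zero i • 1
  a_comm : ∀ i j m n, a i m * a j n - a j n * a i m
    = if i = j ∧ m + n = 0 then ((m : ℂ) * metric i) • 1 else 0
  matter_bound : ∀ v, ∃ N : ℤ, 0 < N ∧ ∀ n, N ≤ n → ∀ i, a i n v = 0
  vac_ne_zero : vac ≠ 0
  a_vac : ∀ i n, 0 < n → a i n vac = 0
  cyclic : ∀ S : Submodule ℂ M, vac ∈ S → (∀ i, ∀ k : ℕ+, ∀ v ∈ S, a i (-(k : ℤ)) v ∈ S) → S = ⊤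
  metric_liouville : metric liouville = 1
  zero_liouville : zero liouville = 0
  slope_sq : slope ^ 2 = -2 * shift

section Tensor

variable {ι : Type*} [Fintype ι] [DecidableEq ι] {M : Type*} [AddCommGroup M] [Module ℂ M]
  {V : Type*} [AddCommGroup V] [Module ℂ V]

namespace MatterFock

variable (Q : MatterFock ι M)

/-- The normally ordered product of two matter modes. -/
def normal (i : ι) (m n : ℤ) : Module.End ℂ M :=
  if m ≤ n then Q.a i m * Q.a i n else Q.a i n * Q.a i m

/-- The matter constraints. -/
def L (m : ℤ) : Module.End ℂ M :=
  (1 / 2 : ℂ) • ∑ i, Q.metric i • opSum (fun k : ℤ => Q.normal i (m + k) (-k))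
    + (Q.slope * m) • Q.a Q.liouville m + (if m = 0 then Q.shift else 0) • 1

theorem locFin_normal (i : ι) (m : ℤ) : LocFin fun k : ℤ => Q.normal i (m + k) (-k) := by
  refine .of_int_bound fun v => ?_
  obtain ⟨N, h0, hN⟩ := Q.matter_bound v
  refine ⟨N + |m|, fun k hk => ?_⟩
  have hm := neg_abs_le m
  have hm' := abs_nonneg m
  unfold normal
  split_ifs
  · rw [Module.End.mul_apply, hN _ (by omega), map_zero]
  · rw [Module.End.mul_apply, hN _ (by omega), map_zero]

end MatterFock

/-- The action on the left factor of a tensor product. -/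
abbrev onLeft (V : Type*) [AddCommGroup V] [Module ℂ V] :
    Module.End ℂ M →ₐ[ℂ] Module.End ℂ (M ⊗[ℂ] V) := Module.End.rTensorAlgHom ℂ M V

/-- The action on the right factor of a tensor product. -/
abbrev onRight (M : Type*) [AddCommGroup M] [Module ℂ M] :
    Module.End ℂ V →ₐ[ℂ] Module.End ℂ (M ⊗[ℂ] V) := Module.End.lTensorAlgHom ℂ V M

theorem onLeft_eq (f : Module.End ℂ M) : onLeft V f = TensorProduct.map f 1 := rfl

theorem onRight_eq (f : Module.End ℂ V) : onRight M f = TensorProduct.map 1 f := rfl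

theorem onLeft_mul_onRight (f : Module.End ℂ M) (g : Module.End ℂ V) :
    onLeft V f * onRight M g = TensorProduct.map f g := by
  rw [onLeft_eq, onRight_eq, ← TensorProduct.map_mul, mul_one, one_mul]

theorem onRight_mul_onLeft (f : Module.End ℂ M) (g : Module.End ℂ V) :
    onRight M g * onLeft V f = TensorProduct.map f g := by
  rw [onLeft_eq, onRight_eq, ← TensorProduct.map_mul, mul_one, one_mul]

theorem onLeft_opSum {κ : Type*} {T : κ → Module.End ℂ M} (hT : LocFin T) :
    onLeft V (opSum T) = opSum fun k => onLeft V (T k) := by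
  have h : LocFin fun k => onLeft V (T k) :=
    LocFin.map (U := fun _ => 1) fun v w => (hT v).subset fun _ hk => hk.1
  refine TensorProduct.ext' fun m v => ?_
  rw [opSum_apply h]
  simp only [onLeft_eq, TensorProduct.map_tmul, opSum_apply hT]
  exact ((TensorProduct.mk ℂ M V).flip v).toAddMonoidHom.map_finsum (hT m)

theorem onRight_opSum {κ : Type*} {T : κ → Module.End ℂ V} (hT : LocFin T) :
    onRight M (opSum T) = opSum fun k => onRight M (T k) := by
  have h : LocFin fun k => onRight M (T k) :=
    LocFin.map (T := fun _ => 1) fun v w => (hT w).subset fun _ hk => hk.2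
  refine TensorProduct.ext' fun m v => ?_
  rw [opSum_apply h]
  simp only [onRight_eq, TensorProduct.map_tmul, opSum_apply hT]
  exact (TensorProduct.mk ℂ M V m).toAddMonoidHom.map_finsum (hT v)

theorem onLeft_tmul (f : Module.End ℂ M) (m : M) (v : V) : onLeft V f (m ⊗ₜ v) = f m ⊗ₜ v := rfl

theorem onRight_tmul (f : Module.End ℂ V) (m : M) (v : V) : onRight M f (m ⊗ₜ v) = m ⊗ₜ f v := rfl

/-- The tensor product of a matter and a ghost Fock space. -/
def Fock.tensor (Q : MatterFock ι M) (G : GhostFock V) : Fock ι (M ⊗[ℂ] V) where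
  c n := onRight M (G.c n)
  b n := onRight M (G.b n)
  c_add_b m n := by
    rw [← map_mul, ← map_mul, ← map_add, G.c_add_b]
    split_ifs <;> simp
  c_add_c m n := by rw [← map_mul, ← map_mul, ← map_add, G.c_add_c, map_zero]
  b_add_b m n := by rw [← map_mul, ← map_mul, ← map_add, G.b_add_b, map_zero]
  ghost_bound x := by
    induction x using TensorProduct.induction_on with
    | zero => exact ⟨1, one_pos, fun n _ => ⟨map_zero _, map_zero _⟩⟩
    | tmul m v =>
      obtain ⟨N, h0, hN⟩ := G.ghost_bound v
      refine ⟨N, h0, fun n hn => ?_⟩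
      rw [onRight_tmul, onRight_tmul, (hN n hn).1, (hN n hn).2, TensorProduct.tmul_zero]
      exact ⟨rfl, rfl⟩
    | add x y hx hy =>
      obtain ⟨N, h0, hN⟩ := hx
      obtain ⟨N', h0', hN'⟩ := hy
      refine ⟨max N N', by omega, fun n hn => ?_⟩
      rw [map_add, map_add, (hN n (by omega)).1, (hN n (by omega)).2, (hN' n (by omega)).1,
        (hN' n (by omega)).2, add_zero]
      exact ⟨rfl, rfl⟩
  a i n := onLeft V (Q.a i n)
  metric := Q.metric
  zero := Q.zero
  vac := Q.vac ⊗ₜ G.vac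
  liouville := Q.liouville
  slope := Q.slope
  shift := Q.shift
  intercept := Q.intercept
  metric_mul_self := Q.metric_mul_self
  a_zero i := by rw [Q.a_zero, map_smul, map_one]
  a_comm i j m n := by
    rw [← map_mul, ← map_mul, ← map_sub, Q.a_comm]
    split_ifs
    · rw [map_smul, map_one]
    · rw [map_zero]
  a_comm_c i m n := by rw [onLeft_mul_onRight, onRight_mul_onLeft]
  a_comm_b i m n := by rw [onLeft_mul_onRight, onRight_mul_onLeft]
  matter_bound x := by
    induction x using TensorProduct.induction_on with
    | zero => exact ⟨1, one_pos, fun n _ i => map_zero _⟩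
    | tmul m v =>
      obtain ⟨N, h0, hN⟩ := Q.matter_bound m
      refine ⟨N, h0, fun n hn i => ?_⟩
      rw [onLeft_tmul, hN n hn, TensorProduct.zero_tmul]
    | add x y hx hy =>
      obtain ⟨N, h0, hN⟩ := hx
      obtain ⟨N', h0', hN'⟩ := hy
      refine ⟨max N N', by omega, fun n hn i => ?_⟩
      rw [map_add, hN n (by omega), hN' n (by omega), add_zero]
  vac_ne_zero := tmul_ne_zero_of_ne_zero Q.vac_ne_zero G.vac_ne_zero
  a_vac i n hn := by rw [onLeft_tmul, Q.a_vac i n hn, TensorProduct.zero_tmul]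
  c_vac n hn := by rw [onRight_tmul, G.c_vac n hn, TensorProduct.tmul_zero]
  b_vac n hn := by rw [onRight_tmul, G.b_vac n hn, TensorProduct.tmul_zero]
  -- First the matter modes fill M ⊗ vac, then for each fixed matter vector the ghost modes fill the
  -- second factor.
  cyclic S h0 hS := by
    have h1 : S.comap ((TensorProduct.mk ℂ M V).flip G.vac) = ⊤ :=
      Q.cyclic _ h0 fun i k v hv => hS (Sum.inl (i, k)) _ hv
    have h2 : ∀ m, S.comap (TensorProduct.mk ℂ M V m) = ⊤ := fun m =>
      G.cyclic _ (h1 ▸ Submodule.mem_top : m ∈ S.comap ((TensorProduct.mk ℂ M V).flip G.vac))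
        (fun k v hv => hS (Sum.inr (Sum.inl k)) _ hv)
        fun k v hv => hS (Sum.inr (Sum.inr k)) _ hv
    rw [eq_top_iff, ← TensorProduct.span_tmul_eq_top, Submodule.span_le]
    rintro _ ⟨m, v, rfl⟩
    exact (h2 m ▸ Submodule.mem_top : v ∈ S.comap (TensorProduct.mk ℂ M V m))
  metric_liouville := Q.metric_liouville
  zero_liouville := Q.zero_liouville
  slope_sq := Q.slope_sq

namespace Fock

variable (Q : MatterFock ι M) (G : GhostFock V)

theorem tensor_L (m : ℤ) : (tensor Q G).L m = onLeft V (Q.L m) := by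
  have h : ∀ i m n, (tensor Q G).matterNormal i m n = onLeft V (Q.normal i m n) := fun i m n => by
    unfold matterNormal MatterFock.normal
    split_ifs
    · exact (map_mul (onLeft V) _ _).symm
    · exact (map_mul (onLeft V) _ _).symm
  simp only [L, h]
  rw [MatterFock.L, map_add, map_add, map_smul, map_smul, map_smul, map_one, map_sum]
  simp only [map_smul, onLeft_opSum (Q.locFin_normal _ m)]
  rfl

theorem tensor_normal (m n : ℤ) : (tensor Q G).normal m n = onRight M (G.normal m n) := by
  unfold GhostModes.normal
  split_ifs
  · rw [map_smul, map_sub, map_mul, map_mul]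
    rfl
  · rw [map_neg, map_mul]
    rfl
  · rw [map_mul]
    rfl

theorem tensor_ghostVir (m : ℤ) : (tensor Q G).ghostVir m = onRight M (G.ghostVir m) := by
  rw [GhostModes.ghostVir, GhostModes.ghostVir, onRight_opSum (G.locFin_ghostVir m)]
  simp only [map_smul, tensor_normal]

theorem tensor_ghostDiff : (tensor Q G).ghostDiff = onRight M G.ghostDiff := by
  simp only [GhostModes.ghostDiff, map_add, map_smul, map_mul, onRight_opSum G.locFin_c_ghostVir,
    onRight_opSum G.locFin_ghostVir_c, tensor_ghostVir]
  rfl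

theorem tensor_ghostDegree : (tensor Q G).ghostDegree = onRight M G.ghostDegree := by
  have hl : LocFin fun m : ℕ+ => G.c (-(m : ℤ)) * G.b (m : ℤ) := by
    simpa using G.locFin_mul_b (fun _ => 1) fun m : ℕ+ => G.c (-(m : ℤ))
  rw [GhostModes.ghostDegree, GhostModes.ghostDegree, onRight_opSum hl]
  simp only [map_mul]
  rfl

theorem tensor_antighostDegree : (tensor Q G).antighostDegree = onRight M G.antighostDegree := by
  have hl : LocFin fun m : ℕ+ => G.b (-(m : ℤ)) * G.c (m : ℤ) := by
    simpa using G.locFin_mul_c (fun _ => 1) fun m : ℕ+ => G.b (-(m : ℤ))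
  rw [GhostModes.antighostDegree, GhostModes.antighostDegree, onRight_opSum hl]
  simp only [map_mul]
  rfl

theorem tensor_relNumber :
    (tensor Q G).relNumber = TensorProduct.map 1 (G.ghostDegree - G.antighostDegree) := by
  rw [relNumber, tensor_ghostDegree, tensor_antighostDegree, ← map_sub]
  rfl

theorem tensor_D : (tensor Q G).D
    = opSum (fun m : ℤ => TensorProduct.map (Q.L m - (if m = 0 then Q.intercept else 0) • 1)
        (G.c (-m))) + TensorProduct.map 1 G.ghostDiff := by
  rw [D, tensor_ghostDiff]
  congr 1
  congr 1
  funext m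
  rw [tensor_L, ← onLeft_mul_onRight, map_sub, map_smul, map_one]
  rfl

theorem tensor_Ltot (m : ℤ) : (tensor Q G).Ltot m
    = TensorProduct.map (Q.L m) 1 + TensorProduct.map 1 (G.ghostVir m)
      - (if m = 0 then Q.intercept else 0) • 1 := by
  rw [Ltot, tensor_L, tensor_ghostVir]
  rfl

/-- States without ghost excitations are generated from the vacuum by matter modes, and these act on
the left factor only. -/
theorem tensor_bare :
    (tensor Q G).bare = LinearMap.range ((TensorProduct.mk ℂ M V).flip G.vac) := by
  refine le_antisymm ((tensor Q G).bare_le ⟨Q.vac, rfl⟩ ?_) ?_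
  · rintro i k _ ⟨u, rfl⟩
    exact ⟨Q.a i (-(k : ℤ)) u, rfl⟩
  · rintro _ ⟨u, rfl⟩
    exact ⟨fun n hn => (congrArg (u ⊗ₜ[ℂ] ·) (G.c_vac n hn)).trans (TensorProduct.tmul_zero _ u),
      fun n hn => (congrArg (u ⊗ₜ[ℂ] ·) (G.b_vac n hn)).trans (TensorProduct.tmul_zero _ u)⟩

theorem tensor_L_mul_c (m n : ℤ) : (tensor Q G).L m * (tensor Q G).c n
    = TensorProduct.map (Q.L m) (G.c n) := by
  rw [tensor_L, ← onLeft_mul_onRight]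
  rfl

/-- Agreement on these vectors is all that is needed. The ghost terms vanish on them, so no sum of
composite ghost operators has to be transported through the tensor product. -/
theorem tensor_dolbBar_apply (u : M) :
    (opSum (fun m : ℕ+ => TensorProduct.map (Q.L (m : ℤ)) (G.c (-(m : ℤ))))
      + TensorProduct.map 1 (opSum fun m : ℕ+ => G.c (-(m : ℤ)) * G.tauPos m)
      + TensorProduct.map 1 G.delBar : Module.End ℂ (M ⊗[ℂ] V)) (u ⊗ₜ[ℂ] G.vac) = (tensor Q G).dolbBar (u ⊗ₜ[ℂ] G.vac) := by
  have hb : u ⊗ₜ[ℂ] G.vac ∈ (tensor Q G).bare := by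
    rw [tensor_bare]
    exact ⟨u, rfl⟩
  rw [dolbBar_of_bare hb, LinearMap.add_apply, LinearMap.add_apply, TensorProduct.map_tmul,
    TensorProduct.map_tmul, GhostModes.c_mul_tauPos_apply G.c_vac, GhostModes.delBar_apply G.b_vac,
    TensorProduct.tmul_zero, add_zero, add_zero]
  simp only [tensor_L_mul_c]

theorem tensor_dolb_apply (u : M) :
    (opSum (fun m : ℕ+ => TensorProduct.map (Q.L (-(m : ℤ))) (G.c (m : ℤ)))
      + TensorProduct.map 1 (opSum fun m : ℕ+ => G.c (m : ℤ) * G.tauNeg m)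
      + TensorProduct.map 1 G.del : Module.End ℂ (M ⊗[ℂ] V)) (u ⊗ₜ[ℂ] G.b (-1) G.vac)
      = (tensor Q G).dolb (u ⊗ₜ[ℂ] G.b (-1) G.vac) := by
  have hb : u ⊗ₜ[ℂ] G.vac ∈ (tensor Q G).bare := by
    rw [tensor_bare]
    exact ⟨u, rfl⟩
  have h : u ⊗ₜ[ℂ] G.b (-1) G.vac = (tensor Q G).b (-1) (u ⊗ₜ[ℂ] G.vac) := rfl
  have h' : (tensor Q G).dolb (u ⊗ₜ[ℂ] G.b (-1) G.vac)
      = opSum (fun m : ℕ+ => (tensor Q G).L (-(m : ℤ)) * (tensor Q G).c (m : ℤ))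
        (u ⊗ₜ[ℂ] G.b (-1) G.vac) := by
    rw [h, dolb, LinearMap.add_apply, LinearMap.add_apply, GhostModes.c_mul_tauNeg_apply hb.2,
      GhostModes.del_apply hb.1, add_zero, add_zero]
  rw [h', LinearMap.add_apply, LinearMap.add_apply, TensorProduct.map_tmul,
    TensorProduct.map_tmul, GhostModes.c_mul_tauNeg_apply G.b_vac, GhostModes.del_apply G.c_vac,
    TensorProduct.tmul_zero, add_zero, add_zero]
  simp only [tensor_L_mul_c]

end Fock

end Tensor

/-! ### Subquotients -/

theorem mem_submoduleOf {V : Type*} [AddCommGroup V] [Module ℂ V] {B Z : Submodule ℂ V} {z : Z} :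
    z ∈ B.submoduleOf Z ↔ (z : V) ∈ B := Iff.rfl

/-- A subspace `Z₀` of `Z` that represents all the classes modulo `B` is a model of `Z / B`, up to
the intersection with `B`. -/
theorem exists_subquotient_equiv {V : Type} [AddCommGroup V] [Module ℂ V]
    {Z B Z₀ : Submodule ℂ V} (hZ : Z₀ ≤ Z) (hB : Z ≤ Z₀ ⊔ B) {K : Submodule ℂ V}
    (hK : Z₀ ⊓ B = K) : ∃ e : Subquotient Z₀ K ≃ₗ[ℂ] Subquotient Z B,
      ∀ z : Z₀, e (Subquotient.mk Z₀ K z) = Subquotient.mk Z B ⟨z, hZ z.2⟩ := by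
  let f : Z₀ →ₗ[ℂ] Z ⧸ B.submoduleOf Z := (B.submoduleOf Z).mkQ ∘ₗ Submodule.inclusion hZ
  have hker : K.submoduleOf Z₀ = LinearMap.ker f := by
    ext z
    rw [LinearMap.mem_ker, LinearMap.comp_apply, Submodule.mkQ_apply, Submodule.Quotient.mk_eq_zero,
      mem_submoduleOf, mem_submoduleOf, ← hK]
    exact and_iff_right z.2
  have hsurj : Function.Surjective f := fun y => by
    obtain ⟨z, rfl⟩ := Submodule.mkQ_surjective _ y
    obtain ⟨x, hx, b, hb, hxb⟩ := Submodule.mem_sup.1 (hB z.2)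
    refine ⟨⟨x, hx⟩, ?_⟩
    rw [LinearMap.comp_apply, Submodule.mkQ_apply, Submodule.mkQ_apply, Submodule.Quotient.eq,
      mem_submoduleOf]
    have : x - (z : V) = -b := by rw [← hxb]; abel
    change x - (z : V) ∈ B
    rw [this]
    exact B.neg_mem hb
  exact ⟨(Submodule.quotEquivOfEq _ _ hker).trans (f.quotKerEquivOfSurjective hsurj), fun z => rfl⟩

theorem exists_equiv_subquotient {V : Type} [AddCommGroup V] [Module ℂ V]
    {Z B Z₀ : Submodule ℂ V} (hZ : Z₀ ≤ Z) (hB : Z ≤ Z₀ ⊔ B) (hK : Z₀ ⊓ B = ⊥) :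
    ∃ e : Z₀ ≃ₗ[ℂ] Subquotient Z B, ∀ z : Z₀, e z = Subquotient.mk Z B ⟨z, hZ z.2⟩ := by
  obtain ⟨e, he⟩ := exists_subquotient_equiv hZ hB hK
  refine ⟨LinearEquiv.ofBijective (e.toLinearMap ∘ₗ Subquotient.mk Z₀ ⊥) ⟨?_, ?_⟩, he⟩
  · refine e.injective.comp (LinearMap.ker_eq_bot.1 ?_)
    refine (Submodule.ker_mkQ _).trans ?_
    ext z
    rw [mem_submoduleOf, Submodule.mem_bot, Submodule.mem_bot, ZeroMemClass.coe_eq_zero]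
  · exact e.surjective.comp (Submodule.mkQ_surjective _)

theorem subsingleton_subquotient {V : Type} [AddCommGroup V] [Module ℂ V] {Z B : Submodule ℂ V}
    (h : Z ≤ B) : Subsingleton (Subquotient Z B) :=
  Submodule.Quotient.subsingleton_iff.2 (Submodule.submoduleOf_eq_top.2 h)

/-! ### The ghost Fock space -/

theorem create_create (g h : GhostIndex) (v : Ghost) : create g (create h v) = -create h (create g v) := by
  rw [eq_neg_iff_add_eq_zero]
  change ExteriorAlgebra.ι ℂ _ * (ExteriorAlgebra.ι ℂ _ * v) + ExteriorAlgebra.ι ℂ _ * (ExteriorAlgebra.ι ℂ _ * v) = 0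
  rw [← mul_assoc, ← mul_assoc, ← add_mul, ExteriorAlgebra.ι_add_mul_swap, zero_mul]

theorem annihilate_annihilate (g h : GhostIndex) (v : Ghost) :
    annihilate g (annihilate h v) = -annihilate h (annihilate g v) :=
  CliffordAlgebra.contractLeft_comm _ _ _

theorem annihilate_create (g h : GhostIndex) (v : Ghost) :
    annihilate g (create h v) = (if g = h then v else 0) - create h (annihilate g v) := by
  refine (CliffordAlgebra.contractLeft_ι_mul _ _ _).trans ?_
  congr 1
  simp only [Finsupp.lapply_apply, Finsupp.single_apply]
  by_cases hg : g = h
  · rw [if_pos hg, if_pos hg.symm, one_smul]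
  · rw [if_neg hg, if_neg (Ne.symm hg), zero_smul]

theorem annihilate_one (g : GhostIndex) : annihilate g 1 = 0 :=
  CliffordAlgebra.contractLeft_one (0 : QuadraticForm ℂ (GhostIndex →₀ ℂ)) (Finsupp.lapply g)

/-- An element of the exterior algebra involves only finitely many generators, and contraction with
any other generator kills it. -/
theorem annihilate_bound (v : Ghost) : ∃ s : Finset GhostIndex, ∀ g, g ∉ s → annihilate g v = 0 := by
  induction v using CliffordAlgebra.left_induction with
  | algebraMap r =>
    exact ⟨∅, fun g _ => CliffordAlgebra.contractLeft_algebraMap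
      (0 : QuadraticForm ℂ (GhostIndex →₀ ℂ)) (Finsupp.lapply g) r⟩
  | add x y hx hy =>
    classical
    obtain ⟨s, hs⟩ := hx
    obtain ⟨t, ht⟩ := hy
    refine ⟨s ∪ t, fun g hg => ?_⟩
    rw [Finset.notMem_union] at hg
    exact (map_add (annihilate g) x y).trans (by rw [hs g hg.1, ht g hg.2, add_zero])
  | ι_mul x m hx =>
    classical
    obtain ⟨s, hs⟩ := hx
    refine ⟨s ∪ m.support, fun g hg => ?_⟩
    rw [Finset.notMem_union, Finsupp.notMem_support_iff] at hg
    refine (CliffordAlgebra.contractLeft_ι_mul _ _ _).trans ?_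
    have h1 : CliffordAlgebra.contractLeft (Q := (0 : QuadraticForm ℂ (GhostIndex →₀ ℂ))) (Finsupp.lapply g) x = 0 := hs g hg.1
    rw [h1, mul_zero, sub_zero, Finsupp.lapply_apply, hg.2, zero_smul]

theorem ghost_cyclic (S : Submodule ℂ Ghost) (h0 : 1 ∈ S) (h : ∀ g, ∀ v ∈ S, create g v ∈ S) : S = ⊤ := by
  suffices hS : ∀ v, v ∈ S from eq_top_iff.2 fun v _ => hS v
  intro v
  induction v using CliffordAlgebra.left_induction with
  | algebraMap r =>
    have := S.smul_mem r h0
    rwa [Algebra.algebraMap_eq_smul_one]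
  | add x y hx hy => exact S.add_mem hx hy
  | ι_mul x m hx =>
    induction m using Finsupp.induction_linear with
    | zero => rw [map_zero, zero_mul]; exact S.zero_mem
    | add f g hf hg => rw [map_add, add_mul]; exact S.add_mem hf hg
    | single g r =>
      have h1 := S.smul_mem r (h g x hx)
      have h2 : Finsupp.single g r = r • Finsupp.single g (1 : ℂ) := by simp
      rw [h2, map_smul, smul_mul_assoc]
      exact h1

theorem ghost_c_add_b (m n : ℤ) (v : Ghost) :
    c m (b n v) + b n (c m v) = if m + n = 0 then v else 0 := by
  rcases m with (_ | k) | k <;> rcases n with l | l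
  · change create (.inl 0) (annihilate (.inl l) v) + annihilate (.inl l) (create (.inl 0) v) = _
    rw [annihilate_create, add_sub_cancel]
    refine if_congr ?_ rfl rfl
    simp
  · change create (.inl 0) (create (.inr l) v) + create (.inr l) (create (.inl 0) v) = _
    rw [create_create, neg_add_cancel, if_neg]
    rw [Int.negSucc_eq]; simp only [Int.ofNat_eq_natCast]; omega
  · change annihilate (.inr k) (annihilate (.inl l) v)
      + annihilate (.inl l) (annihilate (.inr k) v) = _
    rw [annihilate_annihilate, neg_add_cancel, if_neg]
    simp only [Int.ofNat_eq_natCast]; omega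
  · change annihilate (.inr k) (create (.inr l) v) + create (.inr l) (annihilate (.inr k) v) = _
    rw [annihilate_create, sub_add_cancel]
    refine if_congr ?_ rfl rfl
    rw [Int.negSucc_eq, Sum.inr.injEq]; simp only [Int.ofNat_eq_natCast]; omega
  · change create (.inl (k + 1)) (annihilate (.inl l) v)
      + annihilate (.inl l) (create (.inl (k + 1)) v) = _
    rw [annihilate_create, add_sub_cancel]
    refine if_congr ?_ rfl rfl
    rw [Int.negSucc_eq, Sum.inl.injEq]; simp only [Int.ofNat_eq_natCast]; omega
  · change create (.inl (k + 1)) (create (.inr l) v) + create (.inr l) (create (.inl (k + 1)) v) = _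
    rw [create_create, neg_add_cancel, if_neg]
    rw [Int.negSucc_eq, Int.negSucc_eq]; omega

theorem ghost_c_add_c (m n : ℤ) (v : Ghost) : c m (c n v) + c n (c m v) = 0 := by
  have hac : ∀ k l, annihilate (.inr k) (create (.inl l) v)
      + create (.inl l) (annihilate (.inr k) v) = 0 := fun k l => by
    rw [annihilate_create, if_neg Sum.inr_ne_inl, zero_sub, neg_add_cancel]
  have hca : ∀ k l, create (.inl l) (annihilate (.inr k) v)
      + annihilate (.inr k) (create (.inl l) v) = 0 := fun k l => by rw [add_comm, hac]
  have hcc : ∀ k l, create k (create l v) + create l (create k v) = 0 := fun k l => by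
    rw [create_create, neg_add_cancel]
  have haa : ∀ k l, annihilate k (annihilate l v) + annihilate l (annihilate k v) = 0 :=
    fun k l => by rw [annihilate_annihilate, neg_add_cancel]
  rcases m with (_ | k) | k <;> rcases n with (_ | l) | l
  exacts [hcc _ _, hca _ _, hcc _ _, hac _ _, haa _ _, hac _ _, hcc _ _, hca _ _, hcc _ _]

theorem ghost_b_add_b (m n : ℤ) (v : Ghost) : b m (b n v) + b n (b m v) = 0 := by
  have hac : ∀ k l, annihilate (.inl k) (create (.inr l) v)
      + create (.inr l) (annihilate (.inl k) v) = 0 := fun k l => by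
    rw [annihilate_create, if_neg Sum.inl_ne_inr, zero_sub, neg_add_cancel]
  have hca : ∀ k l, create (.inr l) (annihilate (.inl k) v)
      + annihilate (.inl k) (create (.inr l) v) = 0 := fun k l => by rw [add_comm, hac]
  have hcc : ∀ k l, create k (create l v) + create l (create k v) = 0 := fun k l => by
    rw [create_create, neg_add_cancel]
  have haa : ∀ k l, annihilate k (annihilate l v) + annihilate l (annihilate k v) = 0 :=
    fun k l => by rw [annihilate_annihilate, neg_add_cancel]
  rcases m with k | k <;> rcases n with l | l
  exacts [haa _ _, hac _ _, hca _ _, hcc _ _]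

theorem ghost_bound (v : Ghost) : ∃ N : ℤ, 0 < N ∧ ∀ n, N ≤ n → c n v = 0 ∧ b n v = 0 := by
  obtain ⟨s, hs⟩ := annihilate_bound v
  have hidx : ∀ g ∈ s, Sum.elim id id g ≤ s.sup (Sum.elim id id) := fun g hg =>
    Finset.le_sup (f := Sum.elim id id) hg
  -- The mode c_n with `n = k + 1` is the contraction labelled `k`, so both `k` and `k + 1` have to
  -- exceed every index in `s`.
  refine ⟨(s.sup (Sum.elim id id) : ℕ) + 2, by positivity, fun n hn => ?_⟩
  obtain ⟨k, rfl⟩ : ∃ k : ℕ, n = Int.ofNat (k + 1) :=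
    ⟨n.toNat - 1, by rw [Int.ofNat_eq_natCast]; omega⟩
  rw [Int.ofNat_eq_natCast] at hn
  refine ⟨hs (.inr k) fun h => ?_, hs (.inl (k + 1)) fun h => ?_⟩
  · have : k ≤ _ := hidx _ h
    omega
  · have : k + 1 ≤ _ := hidx _ h
    omega

theorem anticommutator_of_apply {V : Type*} [AddCommGroup V] [Module ℂ V] {S T : Module.End ℂ V}
    {P : Prop} [Decidable P] (h : ∀ v, S (T v) + T (S v) = if P then v else 0) :
    S * T + T * S = if P then 1 else 0 :=
  LinearMap.ext fun v => by
    rw [LinearMap.add_apply, Module.End.mul_apply, Module.End.mul_apply, h]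
    split_ifs <;> rfl

theorem anticommutator_eq_zero_of_apply {V : Type*} [AddCommGroup V] [Module ℂ V]
    {S T : Module.End ℂ V} (h : ∀ v, S (T v) + T (S v) = 0) : S * T + T * S = 0 :=
  LinearMap.ext h

/-- The Fock representation of the ghost modes on the exterior algebra. -/
def ghostFock : GhostFock Ghost where
  c := c
  b := b
  c_add_b m n := anticommutator_of_apply (ghost_c_add_b m n)
  c_add_c m n := anticommutator_eq_zero_of_apply (ghost_c_add_c m n)
  b_add_b m n := anticommutator_eq_zero_of_apply (ghost_b_add_b m n)
  ghost_bound := ghost_bound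
  vac := 1
  vac_ne_zero := one_ne_zero
  c_vac n hn := by
    obtain ⟨k, rfl⟩ : ∃ k : ℕ, n = Int.ofNat (k + 1) :=
      ⟨n.toNat - 1, by rw [Int.ofNat_eq_natCast]; omega⟩
    exact annihilate_one (.inr k)
  b_vac n hn := by
    obtain ⟨k, rfl⟩ : ∃ k : ℕ, n = Int.ofNat k := ⟨n.toNat, by rw [Int.ofNat_eq_natCast]; omega⟩
    exact annihilate_one (.inl k)
  cyclic S h0 hc hb := ghost_cyclic S h0 fun g v hv => by
    rcases g with (_ | k) | k
    · exact hc 0 v hv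
    · exact hc (k + 1) v hv
    · exact hb ⟨k + 1, k.succ_pos⟩ v hv

/-! ### The matter Fock space -/

theorem pderiv_comm {σ : Type*} (i j : σ) (v : MvPolynomial σ ℂ) :
    MvPolynomial.pderiv i (MvPolynomial.pderiv j v)
      = MvPolynomial.pderiv j (MvPolynomial.pderiv i v) := by
  classical
  have h : ⁅MvPolynomial.pderiv (R := ℂ) i, MvPolynomial.pderiv j⁆ = 0 :=
    MvPolynomial.derivation_ext fun k => by
      rw [Derivation.commutator_apply, MvPolynomial.pderiv_X, MvPolynomial.pderiv_X]
      simp only [Pi.single_apply]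
      split_ifs <;> simp
  have h' := congrArg (fun D => D v) h
  rw [Derivation.commutator_apply] at h'
  exact sub_eq_zero.1 h'

section Matter

variable (M : Model) (p : Fin M.d → ℝ)

theorem metric_mul_self {d : ℕ} (i : Direction d) : (metric i : ℂ) * metric i = 1 := by
  rcases i with _ | μ
  · simp [metric]
  · simp only [metric]
    split_ifs <;> simp

theorem pderiv_X_mul {σ : Type*} [DecidableEq σ] (i j : σ) (v : MvPolynomial σ ℂ) :
    MvPolynomial.pderiv i (MvPolynomial.X j * v)
      = MvPolynomial.X j * MvPolynomial.pderiv i v + if i = j then v else 0 := by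
  rw [Derivation.leibniz, MvPolynomial.pderiv_X, smul_eq_mul, smul_eq_mul, Pi.single_apply]
  by_cases h : i = j
  · rw [if_pos h, if_pos h.symm, mul_one]
  · rw [if_neg h, if_neg (Ne.symm h), mul_zero]

theorem osc_zero_apply (i : Direction M.d) (v : Matter M.d) :
    osc M p i (Int.ofNat 0) v = zeroMode M p i • v := rfl

theorem osc_pos_apply (i : Direction M.d) (k : ℕ) (v : Matter M.d) :
    osc M p i (Int.ofNat (k + 1)) v
      = (((k : ℂ) + 1) * metric i) • MvPolynomial.pderiv (i, k) v := rfl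

theorem osc_neg_apply (i : Direction M.d) (k : ℕ) (v : Matter M.d) :
    osc M p i (Int.negSucc k) v = MvPolynomial.X (i, k) * v := rfl

theorem osc_comm (i j : Direction M.d) (m n : ℤ) (v : Matter M.d) :
    osc M p i m (osc M p j n v) - osc M p j n (osc M p i m v)
      = if i = j ∧ m + n = 0 then ((m : ℂ) * metric i) • v else 0 := by
  rcases m with (_ | k) | k <;> rcases n with (_ | l) | l <;>
    simp only [osc_zero_apply, osc_pos_apply, osc_neg_apply]
  · rw [smul_comm, sub_self]
    simp
  · rw [Derivation.map_smul, smul_comm, sub_self, if_neg]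
    rintro ⟨-, h⟩
    simp only [Int.ofNat_eq_natCast] at h
    omega
  · rw [mul_smul_comm, sub_self, if_neg]
    rintro ⟨-, h⟩
    rw [Int.negSucc_eq, Int.ofNat_eq_natCast] at h
    omega
  · rw [Derivation.map_smul, smul_comm, sub_self, if_neg]
    rintro ⟨-, h⟩
    simp only [Int.ofNat_eq_natCast] at h
    omega
  · rw [Derivation.map_smul, Derivation.map_smul, smul_comm, pderiv_comm, sub_self, if_neg]
    rintro ⟨-, h⟩
    simp only [Int.ofNat_eq_natCast] at h
    omega
  · rw [pderiv_X_mul, mul_smul_comm, ← smul_sub, add_sub_cancel_left]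
    by_cases h : i = j ∧ k = l
    · obtain ⟨rfl, rfl⟩ := h
      rw [if_pos rfl, if_pos ⟨rfl, by rw [Int.negSucc_eq, Int.ofNat_eq_natCast]; omega⟩]
      simp
    · rw [if_neg fun hc => h ⟨(Prod.ext_iff.1 hc).1, (Prod.ext_iff.1 hc).2⟩, smul_zero, if_neg]
      rintro ⟨h1, h2⟩
      rw [Int.negSucc_eq, Int.ofNat_eq_natCast] at h2
      exact h ⟨h1, by omega⟩
  · rw [mul_smul_comm, sub_self, if_neg]
    rintro ⟨-, h⟩
    rw [Int.negSucc_eq, Int.ofNat_eq_natCast] at h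
    omega
  · rw [pderiv_X_mul, mul_smul_comm, ← smul_sub, sub_add_cancel_left]
    by_cases h : i = j ∧ k = l
    · obtain ⟨rfl, rfl⟩ := h
      rw [if_pos rfl, if_pos ⟨rfl, by rw [Int.negSucc_eq, Int.ofNat_eq_natCast]; omega⟩, Int.negSucc_eq]
      push_cast
      module
    · rw [if_neg fun hc => h ⟨(Prod.ext_iff.1 hc).1.symm, (Prod.ext_iff.1 hc).2.symm⟩, neg_zero,
        smul_zero, if_neg]
      rintro ⟨h1, h2⟩
      rw [Int.negSucc_eq, Int.ofNat_eq_natCast] at h2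
      exact h ⟨h1, by omega⟩
  · rw [mul_left_comm, sub_self, if_neg]
    rintro ⟨-, h⟩
    rw [Int.negSucc_eq, Int.negSucc_eq] at h
    omega

theorem commutator_of_apply {V : Type*} [AddCommGroup V] [Module ℂ V] {S T : Module.End ℂ V}
    {P : Prop} [Decidable P] {s : ℂ} (h : ∀ v, S (T v) - T (S v) = if P then s • v else 0) :
    S * T - T * S = if P then s • 1 else 0 :=
  LinearMap.ext fun v => by
    rw [LinearMap.sub_apply, Module.End.mul_apply, Module.End.mul_apply, h]
    split_ifs <;> rfl

theorem osc_bound (v : Matter M.d) :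
    ∃ N : ℤ, 0 < N ∧ ∀ n, N ≤ n → ∀ i, osc M p i n v = 0 := by
  have hidx : ∀ g ∈ v.vars, g.2 ≤ v.vars.sup Prod.snd := fun g hg =>
    Finset.le_sup (f := Prod.snd) hg
  refine ⟨(v.vars.sup Prod.snd : ℕ) + 2, by positivity, fun n hn i => ?_⟩
  obtain ⟨k, rfl⟩ : ∃ k : ℕ, n = Int.ofNat (k + 1) :=
    ⟨n.toNat - 1, by rw [Int.ofNat_eq_natCast]; omega⟩
  rw [Int.ofNat_eq_natCast] at hn
  rw [osc_pos_apply, MvPolynomial.pderiv_eq_zero_of_notMem_vars fun h => ?_, smul_zero]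
  have : k ≤ _ := hidx _ h
  omega

theorem matter_cyclic (S : Submodule ℂ (Matter M.d)) (h0 : 1 ∈ S)
    (h : ∀ i, ∀ k : ℕ+, ∀ v ∈ S, osc M p i (-(k : ℤ)) v ∈ S) : S = ⊤ := by
  refine eq_top_iff.2 fun v _ => ?_
  suffices hS : ∀ v, v ∈ S from hS v
  intro v
  induction v using MvPolynomial.induction_on with
  | C r =>
    have := S.smul_mem r h0
    rwa [← Algebra.algebraMap_eq_smul_one] at this
  | add x y hx hy => exact S.add_mem hx hy
  | mul_X x g hx =>
    have := h g.1 ⟨g.2 + 1, g.2.succ_pos⟩ x hx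
    rw [mul_comm]
    exact this

/-- The Fock representation of the matter modes on polynomials. -/
def matterFock : MatterFock (Direction M.d) (Matter M.d) where
  a := osc M p
  metric := metric
  zero := zeroMode M p
  vac := 1
  liouville := none
  slope := 2 * Complex.I * (M.β : ℂ) ^ (1 / 2 : ℂ)
  shift := 2 * (M.β : ℂ)
  intercept := M.a
  metric_mul_self := metric_mul_self
  a_zero _ := rfl
  a_comm i j m n := commutator_of_apply (osc_comm M p i j m n)
  matter_bound := osc_bound M p
  vac_ne_zero := one_ne_zero
  a_vac i n hn := by
    obtain ⟨k, rfl⟩ : ∃ k : ℕ, n = Int.ofNat (k + 1) :=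
      ⟨n.toNat - 1, by rw [Int.ofNat_eq_natCast]; omega⟩
    rw [osc_pos_apply, MvPolynomial.pderiv_one, smul_zero]
  cyclic := matter_cyclic M p
  metric_liouville := rfl
  zero_liouville := rfl
  -- The principal root squares to β for negative β as well, so (2i√β)² = -4β, which is -2 times the
  -- shift 2β.
  slope_sq := by
    have h := Complex.cpow_nat_inv_pow (M.β : ℂ) two_ne_zero
    have h2 : (1 / 2 : ℂ) = ((2 : ℕ) : ℂ)⁻¹ := by norm_num
    rw [h2, mul_pow, mul_pow, h, Complex.I_sq]
    ring

end Matter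

/-! ### The string complex -/

section String

variable (M : Model) (p : Fin M.d → ℝ)

/-- The Fock space of the massive string. -/
def stringFock : Fock (Direction M.d) (Total M.d) := Fock.tensor (matterFock M p) ghostFock

theorem diff_eq : diff M p = (stringFock M p).D :=
  (Fock.tensor_D (matterFock M p) ghostFock).symm

theorem virTot_eq (m : ℤ) : virTot M p m = (stringFock M p).Ltot m :=
  (Fock.tensor_Ltot (matterFock M p) ghostFock m).symm

theorem relNumber_eq : tens (d := M.d) 1 (ghostDegree - antighostDegree)
    = (stringFock M p).relNumber :=
  (Fock.tensor_relNumber (matterFock M p) ghostFock).symm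

theorem polarized_eq : polarized M p = (stringFock M p).pol := by
  simp only [polarized, diff_eq, virTot_eq]
  rfl

theorem polNoZero_eq : polNoZero M p = (stringFock M p).polNoZero := by
  rw [polNoZero, polarized_eq]
  rfl

theorem polRel_eq : polRel M p = (stringFock M p).polRel := by
  rw [polRel, polNoZero_eq, virTot_eq]
  rfl

theorem polRelDeg_eq (r : ℤ) : polRelDeg M p r = (stringFock M p).polRelDeg r := by
  rw [polRelDeg, polRel_eq, relNumber_eq M p]
  rfl

theorem diffRel_eq : diffRel M p = (stringFock M p).diffRel (tens 1 opM) := by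
  have h : tens (d := M.d) 1 (opM * b 0) = tens 1 opM * tens 1 (b 0) :=
    map_mul (onRight (Matter M.d)) opM (b 0)
  rw [diffRel, diff_eq, virTot_eq, h]
  rfl

theorem cocyclesRel_eq (r : ℤ) :
    cocyclesRel M p r = (stringFock M p).cocyclesRel (tens 1 opM) r := by
  rw [cocyclesRel, polRelDeg_eq, diffRel_eq]
  rfl

theorem coboundariesRel_eq (r : ℤ) :
    coboundariesRel M p r = (stringFock M p).coboundariesRel (tens 1 opM) r := by
  rw [coboundariesRel, polRelDeg_eq, diffRel_eq]
  rfl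

theorem polBi_eq (i j : ℕ) : polBi M p i j = (stringFock M p).polBi i j := by
  have h1 : tens (d := M.d) 1 ghostDegree = (stringFock M p).ghostDegree :=
    (Fock.tensor_ghostDegree (matterFock M p) ghostFock).symm
  have h2 : tens (d := M.d) 1 antighostDegree = (stringFock M p).antighostDegree :=
    (Fock.tensor_antighostDegree (matterFock M p) ghostFock).symm
  rw [polBi, polNoZero_eq, h1, h2]
  rfl

theorem mem_bare_iff {v : Total M.d} :
    v ∈ (stringFock M p).bare ↔ ∃ u, withVacuum M.d u = v := by
  rw [stringFock, Fock.tensor_bare]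
  rfl

theorem dolbBar_withVacuum (u : Matter M.d) :
    dolbBar M p (withVacuum M.d u) = (stringFock M p).dolbBar (withVacuum M.d u) :=
  Fock.tensor_dolbBar_apply (matterFock M p) ghostFock u

theorem dolb_withVacuum (u : Matter M.d) :
    dolb M p (tens 1 (b (-1)) (withVacuum M.d u))
      = (stringFock M p).dolb ((stringFock M p).b (-1) (withVacuum M.d u)) :=
  Fock.tensor_dolb_apply (matterFock M p) ghostFock u

theorem L_withVacuum (m : ℤ) (u : Matter M.d) :
    (stringFock M p).L m (withVacuum M.d u) = withVacuum M.d (vir M p m u) := by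
  rw [stringFock, Fock.tensor_L]
  rfl

theorem cocyclesBarOff_eq : cocyclesBarOff M p 0 0 = (stringFock M p).cocyclesBarOff 0 0 := by
  ext v
  rw [cocyclesBarOff, polBi_eq, Fock.cocyclesBarOff, Submodule.mem_inf, Submodule.mem_inf]
  refine and_congr_right fun hv => ?_
  rw [Fock.polBi_zero] at hv
  obtain ⟨u, rfl⟩ := (mem_bare_iff M p).1 hv
  rw [LinearMap.mem_ker, LinearMap.mem_ker, dolbBar_withVacuum]

theorem cocyclesBar_eq : cocyclesBar M p 0 0 = (stringFock M p).cocyclesBar 0 0 := by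
  rw [cocyclesBar, cocyclesBarOff_eq, virTot_eq]
  rfl

theorem gauge_eq : gauge M p = (stringFock M p).gauge := by
  have key : ∀ v ∈ (stringFock M p).cocyclesBarOff 0 0,
      dolb M p (tens 1 (b (-1)) v) = (stringFock M p).dolb ((stringFock M p).b (-1) v) := by
    intro v hv
    obtain ⟨u, rfl⟩ := (mem_bare_iff M p).1 (Fock.mem_cocyclesBarOff.1 hv).1
    exact dolb_withVacuum M p u
  rw [gauge, cocyclesBarOff_eq, polRel_eq]
  ext w
  constructor
  · rintro ⟨_, ⟨⟨v, hv, rfl⟩, hrel⟩, rfl⟩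
    exact ⟨_, ⟨⟨v, hv, rfl⟩, hrel⟩, (key v hv).symm⟩
  · rintro ⟨_, ⟨⟨v, hv, rfl⟩, hrel⟩, rfl⟩
    exact ⟨_, ⟨⟨v, hv, rfl⟩, hrel⟩, key v hv⟩

theorem withVacuum_injective : Function.Injective (withVacuum M.d) := by
  refine (injective_iff_map_eq_zero _).2 fun u hu => ?_
  by_contra h
  exact tmul_ne_zero_of_ne_zero h ghostFock.vac_ne_zero hu

theorem mem_physical {u : Matter M.d} : u ∈ physical M p ↔
    ∀ m : ℤ, 0 ≤ m → vir M p m u = (if m = 0 then (M.a : ℂ) else 0) • u := by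
  simp only [physical, Submodule.mem_iInf, LinearMap.mem_ker, LinearMap.sub_apply,
    LinearMap.smul_apply, Module.End.one_apply, sub_eq_zero]
  refine ⟨fun h m hm => ?_, fun h m => ?_⟩
  · lift m to ℕ using hm
    rw [h m]
    simp
  · rw [h m m.cast_nonneg]
    simp

theorem mem_gaugeParameters {u : Matter M.d} : u ∈ gaugeParameters M p ↔
    (∀ m : ℤ, 0 < m → vir M p m u = 0) ∧ vir M p 0 u = ((M.a : ℂ) - 1) • u := by
  simp only [gaugeParameters, Submodule.mem_iInf, LinearMap.mem_ker, LinearMap.add_apply,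
    LinearMap.smul_apply, Module.End.one_apply]
  refine ⟨fun h => ⟨fun m hm => ?_, ?_⟩, fun h m => ?_⟩
  · lift m to ℕ using hm.le
    have := h m
    rwa [if_neg (by omega), zero_smul, add_zero] at this
  · have := h 0
    rw [if_pos rfl] at this
    rw [← sub_eq_zero, ← this]
    push_cast
    module
  · rcases Nat.eq_zero_or_pos m with rfl | hm
    · rw [if_pos rfl, Nat.cast_zero, h.2]
      module
    · rw [h.1 m (by omega), if_neg (by omega), zero_smul, add_zero]

theorem cocyclesBar_eq_map : cocyclesBar M p 0 0 = (physical M p).map (withVacuum M.d) := by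
  have hi : (stringFock M p).intercept = M.a := rfl
  rw [cocyclesBar_eq]
  ext v
  rw [Fock.mem_cocyclesBar, mem_bare_iff, hi]
  constructor
  · rintro ⟨⟨u, rfl⟩, h⟩
    refine ⟨u, (mem_physical M p).2 fun m hm => withVacuum_injective M ?_, rfl⟩
    rw [← L_withVacuum, h m hm, map_smul]
  · rintro ⟨u, hu, rfl⟩
    refine ⟨⟨u, rfl⟩, fun m hm => ?_⟩
    rw [L_withVacuum, (mem_physical M p).1 hu m hm, map_smul]

theorem gauge_eq_map (h1 : (stringFock M p).kappa 1 = 0) :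
    gauge M p = ((gaugeParameters M p).map (vir M p (-1))).map (withVacuum M.d) := by
  have hi : (stringFock M p).intercept = M.a := rfl
  rw [gauge_eq]
  ext w
  rw [Fock.mem_gauge h1]
  constructor
  · rintro ⟨v, hv, hL, h0, rfl⟩
    obtain ⟨u, rfl⟩ := (mem_bare_iff M p).1 hv
    refine ⟨_, ⟨u, (mem_gaugeParameters M p).2 ⟨fun m hm => withVacuum_injective M ?_,
      withVacuum_injective M ?_⟩, rfl⟩, (L_withVacuum M p (-1) u).symm⟩
    · rw [← L_withVacuum, hL m hm, map_zero]
    · rw [← L_withVacuum, h0, map_smul, hi]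
  · rintro ⟨_, ⟨u, hu, rfl⟩, rfl⟩
    obtain ⟨hL, h0⟩ := (mem_gaugeParameters M p).1 hu
    refine ⟨withVacuum M.d u, (mem_bare_iff M p).2 ⟨u, rfl⟩, fun m hm => ?_, ?_,
      L_withVacuum M p (-1) u⟩
    · rw [L_withVacuum, hL m hm, map_zero]
    · rw [L_withVacuum, h0, map_smul, hi]

/-- There are d + 1 oscillator directions, so the matter charge is d + 1 + 48β; with -26 from the
ghosts the cubic coefficient is `anomaly / 12`. The linear coefficient is then -`anomaly * xi / 12`
by the definition of ξ. -/
theorem kappa_eq (hanomaly : M.anomaly ≠ 0) (m : ℤ) : (stringFock M p).kappa m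
    = ((M.anomaly / 12 * m * ((m : ℝ) ^ 2 - M.xi) : ℝ) : ℂ) := by
  have h : M.anomaly * M.xi = M.anomaly + 24 * (1 - M.a) := by
    rw [Model.xi]
    field_simp
  have h2 : (M.anomaly / 12 * m * ((m : ℝ) ^ 2 - M.xi) : ℝ)
      = M.anomaly / 12 * m ^ 3 - (M.anomaly + 24 * (1 - M.a)) / 12 * m := by
    rw [← h]
    ring
  have h3 : (stringFock M p).charge = (M.d : ℂ) + 1 + 48 * M.β := by
    have : (stringFock M p).charge = (Fintype.card (Direction M.d) : ℂ) + 24 * (2 * (M.β : ℂ)) := rfl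
    rw [this, Fintype.card_option, Fintype.card_fin]
    push_cast
    ring
  have h4 : (stringFock M p).intercept = M.a := rfl
  rw [h2, Fock.kappa, h3, h4, Model.anomaly]
  push_cast
  ring

theorem kappa_ne_zero (hanomaly : M.anomaly ≠ 0) {m : ℤ} (hm : 0 < m) (h : M.xi < (m : ℝ) ^ 2) :
    (stringFock M p).kappa m ≠ 0 := by
  rw [kappa_eq M p hanomaly, Complex.ofReal_ne_zero]
  have : (m : ℝ) ≠ 0 := by exact_mod_cast hm.ne'
  exact mul_ne_zero (mul_ne_zero (by positivity) this) (sub_ne_zero.2 h.ne')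

/-- If p^0 = 0, some spatial component is non-zero; otherwise p^0 + p^1 and p^0 - p^1 cannot both
vanish. The existence of p^1 uses d ≥ 2. -/
theorem exists_direction (hd : 2 ≤ M.d) (hp : p ≠ 0) :
    ∃ (j : Fin M.d) (s : ℝ), (j : ℕ) ≠ 0 ∧ s * s = 1 ∧ p ⟨0, by omega⟩ + s * p j ≠ 0 := by
  by_cases h0 : p ⟨0, by omega⟩ = 0
  · obtain ⟨j, hj⟩ := Function.ne_iff.1 hp
    refine ⟨j, 1, fun h => hj ?_, by norm_num, by simpa [h0] using hj⟩
    rwa [show j = ⟨0, by omega⟩ from Fin.ext h]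
  · by_cases h1 : p ⟨0, by omega⟩ + p ⟨1, by omega⟩ = 0
    · refine ⟨⟨1, by omega⟩, -1, one_ne_zero, by norm_num, fun h => h0 ?_⟩
      linarith
    · exact ⟨⟨1, by omega⟩, 1, one_ne_zero, by norm_num, by simpa using h1⟩

theorem nonempty_lightCone (hd : 2 ≤ M.d) (hα : 0 < M.α) (hp : p ≠ 0) :
    Nonempty (stringFock M p).LightCone := by
  obtain ⟨j, s, hj, hs, hne⟩ := exists_direction M p hd hp
  have h0 : metric (some ⟨0, by omega⟩ : Direction M.d) = -1 := by simp [metric]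
  have h1 : metric (some j : Direction M.d) = 1 := by simp [metric, hj]
  refine ⟨⟨some ⟨0, by omega⟩, some j, s, h0, h1, Option.some_ne_none j, by exact_mod_cast hs, ?_⟩⟩
  have h : ((p ⟨0, by omega⟩ / Real.sqrt M.α : ℝ) : ℂ) + s * ((p j / Real.sqrt M.α : ℝ) : ℂ)
      = (((p ⟨0, by omega⟩ + s * p j) / Real.sqrt M.α : ℝ) : ℂ) := by
    push_cast
    ring
  refine h.trans_ne (Complex.ofReal_ne_zero.2 (div_ne_zero hne (Real.sqrt_pos.2 hα).ne'))

end String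

end MassiveString

end

/-! ### The vanishing theorem for the concrete string complex -/

open MassiveString in
theorem theorem3p1 (M : Model) (p : Fin M.d → ℝ)
    (hd : 2 ≤ M.d) (hα : 0 < M.α) (hanomaly : M.anomaly ≠ 0) (hξ : M.xi ≤ 1) (hp : p ≠ 0) :
    (∀ r : ℤ, coboundariesRel M p r ≤ cocyclesRel M p r) ∧
    (∀ r : ℤ, r ≠ 0 → Subsingleton (cohomologyRel M p r)) ∧
    (M.xi < 1 →
      ∃ e : cocyclesBar M p 0 0 ≃ₗ[ℂ] cohomologyRel M p 0,
        ∀ z : cocyclesBar M p 0 0, ∃ hz : (z : Total M.d) ∈ cocyclesRel M p 0,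
          e z = classRel M p 0 ⟨z, hz⟩) ∧
    (M.xi = 1 →
      gauge M p ≤ cocyclesBar M p 0 0 ∧
      ∃ e : Subquotient (cocyclesBar M p 0 0) (gauge M p) ≃ₗ[ℂ] cohomologyRel M p 0,
        ∀ z : cocyclesBar M p 0 0, ∃ hz : (z : Total M.d) ∈ cocyclesRel M p 0,
          e (Subquotient.mk _ _ z) = classRel M p 0 ⟨z, hz⟩) ∧
    cocyclesBar M p 0 0 = (physical M p).map (withVacuum M.d) ∧
    (M.xi = 1 →
      gauge M p = ((gaugeParameters M p).map (vir M p (-1))).map (withVacuum M.d)) := by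
  obtain ⟨Y⟩ := nonempty_lightCone M p hd hα hp
  -- Here ξ ≤ 1 < 4 ≤ m², so m² - ξ is positive.
  have hκ : ∀ m : ℤ, 2 ≤ m → (stringFock M p).kappa m ≠ 0 := fun m hm =>
    kappa_ne_zero M p hanomaly (by omega) (by
      have : (2 : ℝ) ≤ m := by exact_mod_cast hm
      nlinarith)
  have hκ₁ : M.xi = 1 → (stringFock M p).kappa 1 = 0 := fun h => by
    rw [kappa_eq M p hanomaly, h]
    simp
  have hle : cocyclesBar M p 0 0 ≤ cocyclesRel M p 0 := by
    rw [cocyclesBar_eq, cocyclesRel_eq]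
    exact Fock.cocyclesBar_le _
  have hsup : cocyclesRel M p 0 ≤ cocyclesBar M p 0 0 ⊔ coboundariesRel M p 0 := by
    rw [cocyclesBar_eq, cocyclesRel_eq, coboundariesRel_eq]
    exact Y.cocyclesRel_zero_le _ hκ
  refine ⟨fun r => ?_, fun r hr => subsingleton_subquotient ?_, fun h => ?_, fun h => ⟨?_, ?_⟩,
    cocyclesBar_eq_map M p, fun h => gauge_eq_map M p (hκ₁ h)⟩
  · rw [cocyclesRel_eq, coboundariesRel_eq]
    exact Fock.coboundariesRel_le _ hκ r
  · rw [cocyclesRel_eq, coboundariesRel_eq]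
    exact Y.cocyclesRel_le _ hκ hr
  -- For ξ < 1 also κ(1) ≠ 0, so there are no cochains of degree -1 and hence no coboundaries to
  -- divide out.
  · obtain ⟨e, he⟩ := exists_equiv_subquotient hle hsup (by
      rw [coboundariesRel_eq, Fock.coboundariesRel_zero_eq_bot _ hκ
        (kappa_ne_zero M p hanomaly one_pos (by simpa using h)), inf_bot_eq])
    exact ⟨e, fun z => ⟨hle z.2, he z⟩⟩
  · rw [cocyclesBar_eq, gauge_eq]
    exact Fock.gauge_le (hκ₁ h)
  · obtain ⟨e, he⟩ := exists_subquotient_equiv hle hsup (K := gauge M p) (by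
      rw [cocyclesBar_eq, coboundariesRel_eq, gauge_eq]
      exact Fock.cocyclesBar_inf_coboundariesRel _ hκ (hκ₁ h))
    exact ⟨e, fun z => ⟨hle z.2, he z⟩⟩
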